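/- **Theorem (PDT-hardness of Tseitin contradictions on expanders).** Let $G=(V,E)$ be a finite simple graph with $|V|$ odd that is a $(|V|,d,\lambda)$-expander with $d\ge 1$ and $\lambda<1/1000$, i.e. $G$ is $d$-regular and all eigenvalues of its adjacency matrix other than one copy of $d$ have absolute value at most $\lambda d$. Let $n=|E|$ and enumerate the edges as $1,\dots,n$. Let $\alpha>0$, and let $g:\mathbb F_2^b\to\mathbb F_2$ be a gadget with $\bigl|\mathbb E_x[(-1)^{g(x)+\sum_{i\in S}x_i}]\bigr|\le 2^{-\alpha b}$ for all $S\subseteq[b]$ and with block size $b\ge\frac{250}{\alpha}\log_2 n$. Let $\Phi$ be the Tseitin contradiction on $G$: its variables are $z_e$, $e\in E$, and for each $v\in V$ the constraint $\sum_{e\ni v}z_e=1 \pmod 2$ is written as a set of clauses, one for each violating assignment to the edges at $v$. Then $\Phi$ is $(n/2000,\,n/2000)$-PDT-hard with respect to $g$. More precisely, the set $P$ of valid partial assignments and the distributions $\mu_\rho$ ($\rho\in P$) sampled by DTFooling, for every choice of the spanning trees and roots it uses, witness this hardness. The notions used are as follows. *Valid assignments.* For $\rho\in\{0,1,*\}^E$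 let $G_\rho$ be $G$ with the edges fixed by $\rho$ removed, and $f_\rho(v)=1+\sum_{e\ni v,\ \rho(e)\ne *}\rho(e)\in\mathbb F_2$. A component $C$ of $G_\rho$ is odd if $\sum_{v\in C}f_\rho(v)=1$. The assignment $\rho$ is valid if $G_\rho$ has exactly one odd component $C_\rho$ and $|C_\rho|>|V|/2$. *DTFooling.* Draw $v\in C_\rho$ uniformly. Take a spanning tree of $C_\rho$ with root $v$, and in every other component of $G_\rho$ any spanning tree with any root. Keep the values fixed by $\rho$, assign independent uniform bits to the unfixed non-tree edges, and extend to the tree edges in the unique way for which $\sum_{e\ni u,\ \rho(e)=*}z_e=f_\rho(u)$ for every $u$ that is not a root. The law of the resulting $z\in\mathbb F_2^E$ is $\mu_\rho$. *Lifted space and closures.* The coordinates of $\mathbb F_2^{nb}$ form $n$ blocks of size $b$; $x(i)$ is the $i$-th block of $x$. A set $W$ of vectors is safe if any $k$ linearly independent vectors of $\mathrm{span}(W)$ together meet at least $k$ blocks. For a non-empty affine space $A=\{x: Mx=c\}$, $\mathrm{Cl}(A)\subseteq[n]$ is the (unique) minimal set $S$ of blocks such that the rows of $M$, projected to the blocks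 outside $S$, form a safe set; $\widehat{\mathrm{Cl}}(A)$ is the lexicographically largest set $S$ of blocks such that one can pick one column of $M$ in each block of $S$ so that the picked columns are linearly independent. For an assignment $y$ to the blocks in $S$, $C_y$ is the set of $x\in\mathbb F_2^{nb}$ consistent with $y$, and $G(y)\in\{0,1,*\}^n$ is given by $G(y)_i=g(y(i))$ for $i\in S$ and $G(y)_i=*$ otherwise. For a distribution $\mu$ on $\mathbb F_2^n$, $G^{-1}(\mu)$ is the law of $x$ obtained by drawing $z\leftarrow\mu$ and then $x$ uniformly from $\{x: g(x(i))=z_i\ \forall i\}$. For a parity decision tree $T$ on $\mathbb F_2^{nb}$, $A_T(x)$ is the affine space of all inputs that answer all queries made by $T$ on $x$ as $x$ does. *PDT-hardness.* A non-empty set $P\subseteq\{0,1,*\}^n$ together with distributions $\mu_\alpha$ on $\mathbb F_2^n$ ($\alpha\in P$) witnesses that $\Phi$ is $(p,q)$-PDT-hard if: (i) no $\rho\in P$ falsifies a clause of $\Phi$; (ii) unfixing bits of some $\rho\in P$ gives again an element of $P$; (iii) for every affine space $A\subseteq\mathbb F_2^{nb}$ with $|\widehat{\mathrm{Cl}}(A)|\le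 p$ and every assignment $y$ to the blocks in $\mathrm{Cl}(A)$ with $A\cap C_y\neq\emptyset$ and $\alpha=G(y)\in P$: every $z\in\mathrm{supp}(\mu_\alpha)$ agrees with $\alpha$ on $\mathrm{Cl}(A)$, and for every parity decision tree $T$ of depth at most $q$, when $x$ is drawn from $G^{-1}(\mu_\alpha)$ conditioned on $x\in A\cap C_y$ (an event of positive probability), with probability at least $1/3$ we have $G\bigl(x|_{\mathrm{Cl}(A_T(x)\cap A\cap C_y)}\bigr)\in P$. The formula $\Phi$ is $(p,q)$-PDT-hard if such $P$ and $(\mu_\alpha)$ exist. -/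

import Mathlib

noncomputable section

open scoped ENNReal Classical

/-! ### CNF formulas and partial assignments over the variables `z_i`, `i : Fin n` -/

/-- A partial assignment in `{0, 1, *}^n`; `none` stands for `*`. -/
abbrev PartialAssignment (n : ℕ) := Fin n → Option (ZMod 2)

/-- A clause, as a set of literals; the literal `(i, c)` says that `z_i = c`. -/
abbrev Clause (n : ℕ) := Finset (Fin n × ZMod 2)

/-- A CNF formula, as a set of clauses. -/
abbrev CNF (n : ℕ) := Set (Clause n)

/-- `ρ` falsifies `C`: every literal of `C` is fixed by `ρ` to the wrong value. -/
def Falsifies {n : ℕ} (ρ : PartialAssignment n) (C : Clause n) : Prop :=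
  ∀ l ∈ C, ∃ a, ρ l.1 = some a ∧ a ≠ l.2

/-! ### The lifted space: `n` blocks of `b` bits each -/

/-- A vector whose coordinates are arranged in blocks of size `b` indexed by `ι`. -/
abbrev BlockVec (ι : Type*) (b : ℕ) := ι → Fin b → ZMod 2

/-- The inner product `⟨ℓ, x⟩` over `𝔽₂`. -/
def pairing {n b : ℕ} (l x : BlockVec (Fin n) b) : ZMod 2 :=
  ∑ i, ∑ j, l i j * x i j

/-- The set of blocks met by the support of one of the vectors `w t`. -/
def blockSupport {ι κ : Type*} [Fintype ι] {b : ℕ} (w : κ → BlockVec ι b) : Finset ι :=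
  {i | ∃ t, w t i ≠ 0}

/-- A set of vectors is safe if any `k` linearly independent vectors of its span together
meet at least `k` blocks. -/
def IsSafe {ι : Type*} [Fintype ι] {b : ℕ} (W : Set (BlockVec ι b)) : Prop :=
  ∀ (k : ℕ) (w : Fin k → BlockVec ι b), (∀ t, w t ∈ Submodule.span (ZMod 2) W) →
    LinearIndependent (ZMod 2) w → k ≤ (blockSupport w).card

/-- The projection `v[∖ S]` of `v` onto the blocks outside `S`. -/
def dropBlocks {n b : ℕ} (S : Finset (Fin n)) (v : BlockVec (Fin n) b) :
    BlockVec {i : Fin n // i ∉ S} b :=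
  fun i => v i

/-- `S` is a deviolator for `W` if the projections of the vectors of `W` onto the blocks
outside `S` form a safe set. -/
def IsDeviolator {n b : ℕ} (W : Set (BlockVec (Fin n) b)) (S : Finset (Fin n)) : Prop :=
  IsSafe (dropBlocks S '' W)

theorem exists_minimal_deviolator {n b : ℕ} (W : Set (BlockVec (Fin n) b)) :
    ∃ S, Minimal (IsDeviolator W) S := by
  have hu : IsDeviolator W Finset.univ := by
    intro k w _ hw
    rcases Nat.eq_zero_or_pos k with rfl | hk
    · exact Nat.zero_le _
    · exact absurd (funext fun i => absurd (Finset.mem_univ _) i.2) (hw.ne_zero ⟨0, hk⟩)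
  exact (Set.toFinite {S | IsDeviolator W S}).exists_minimal ⟨_, hu⟩

/-- The closure of a set of vectors: its (unique) minimal deviolator. -/
def vecClosure {n b : ℕ} (W : Set (BlockVec (Fin n) b)) : Finset (Fin n) :=
  Classical.choose (exists_minimal_deviolator W)

/-- A set `S` of blocks is acceptable for `W` if one can choose a coordinate in each block of
`S` so that the corresponding columns of the matrix with row set `W` are linearly independent. -/
def IsAcceptable {n b : ℕ} (W : Set (BlockVec (Fin n) b)) (S : Finset (Fin n)) : Prop :=
  ∃ c : S → Fin b, LinearIndependent (ZMod 2) (fun (s : S) (v : W) => v.1 s (c s))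

theorem exists_lexMax_acceptable {n b : ℕ} (W : Set (BlockVec (Fin n) b)) :
    ∃ S, IsAcceptable W S ∧ ∀ S', IsAcceptable W S' →
      toLex (fun i => decide (i ∈ S')) ≤ toLex (fun i => decide (i ∈ S)) := by
  have h0 : IsAcceptable W ∅ :=
    ⟨fun s => absurd s.2 (Finset.notMem_empty _), linearIndependent_empty_type⟩
  obtain ⟨S, hS, hmax⟩ := Finset.exists_max_image
    (Finset.univ.filter fun S => IsAcceptable W S)
    (fun S : Finset (Fin n) => toLex (fun i => decide (i ∈ S))) ⟨∅, by simpa using h0⟩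
  exact ⟨S, by simpa using hS, fun S' hS' => hmax S' (by simpa using hS')⟩

/-- The amortized closure of a set of vectors: the lexicographically largest acceptable set of
blocks (sets are compared through their indicator vectors). -/
def vecAmortizedClosure {n b : ℕ} (W : Set (BlockVec (Fin n) b)) : Finset (Fin n) :=
  Classical.choose (exists_lexMax_acceptable W)

/-- Affine subspaces of the lifted space. -/
abbrev AffSpace (n b : ℕ) := AffineSubspace (ZMod 2) (BlockVec (Fin n) b)

/-- The linear forms occurring in an equation `⟨ℓ, x⟩ = c` valid on `A`. If
`A = {x | M x = c}` is non-empty, they form the row space of `M`. -/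
def definingForms {n b : ℕ} (A : AffSpace n b) : Set (BlockVec (Fin n) b) :=
  {l | ∃ c : ZMod 2, ∀ x ∈ A, pairing l x = c}

/-- The closure `Cl(A)` of an affine space. -/
def closureBlocks {n b : ℕ} (A : AffSpace n b) : Finset (Fin n) :=
  vecClosure (definingForms A)

/-- The amortized closure of an affine space. -/
def amortizedClosure {n b : ℕ} (A : AffSpace n b) : Finset (Fin n) :=
  vecAmortizedClosure (definingForms A)

/-- The affine space `C_y` of all points consistent with the assignment `y` to the blocks in
`S`. -/
def consistentSpace {n b : ℕ} {S : Finset (Fin n)} (y : BlockVec S b) : AffSpace n b where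
  carrier := {x | ∀ i : S, x i = y i}
  smul_vsub_vadd_mem' c p₁ p₂ p₃ h₁ h₂ h₃ i := by
    simp [h₁ i, h₂ i, h₃ i]

/-- The restriction `x|_{VARS(S)}`. -/
def restrictBlocks {n b : ℕ} (x : BlockVec (Fin n) b) (S : Finset (Fin n)) : BlockVec S b :=
  fun i => x i

/-- The partial assignment `G(y)` obtained from an assignment `y` to the blocks in `S` by
applying the gadget `g` to each of these blocks. -/
def gadgetPartial {n b : ℕ} (g : (Fin b → ZMod 2) → ZMod 2) {S : Finset (Fin n)}
    (y : BlockVec S b) : PartialAssignment n :=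
  fun i => if h : i ∈ S then some (g (y ⟨i, h⟩)) else none

/-! ### Lifted distributions -/

/-- The set `G⁻¹(z)`. -/
def gadgetFiber {n b : ℕ} (g : (Fin b → ZMod 2) → ZMod 2) (z : Fin n → ZMod 2) :
    Finset (BlockVec (Fin n) b) :=
  {x | ∀ i, g (x i) = z i}

/-- The lifted distribution `G⁻¹(μ)`: sample `z` from `μ`, then a uniform point of `G⁻¹(z)`.
(If `g` takes both values, as it always does below, then `G⁻¹(z)` is non-empty and the
`else` branch is void.) -/
def liftDist {n b : ℕ} (g : (Fin b → ZMod 2) → ZMod 2) (μ : PMF (Fin n → ZMod 2)) :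
    PMF (BlockVec (Fin n) b) :=
  μ.bind fun z =>
    if h : (gadgetFiber g z).Nonempty then PMF.uniformOfFinset (gadgetFiber g z) h
    else PMF.pure 0

/-- The conditional probability of `s` given `t` (with value `0` if `t` has probability `0`). -/
def condProb {Ω : Type*} (D : PMF Ω) (s t : Set Ω) : ℝ≥0∞ :=
  D.toOuterMeasure (s ∩ t) / D.toOuterMeasure t

/-! ### Parity decision trees -/

/-- Parity decision trees on the lifted space. The node `query l T₀ T₁` queries `⟨l, x⟩` and
continues in `T₀` or `T₁` according to the answer. -/
inductive PDT (n b : ℕ) : Type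
  | leaf : PDT n b
  | query (l : BlockVec (Fin n) b) (T₀ T₁ : PDT n b) : PDT n b

/-- The depth: the largest number of queries on a path. -/
def PDT.depth {n b : ℕ} : PDT n b → ℕ
  | .leaf => 0
  | .query _ T₀ T₁ => max T₀.depth T₁.depth + 1

/-- The linear forms queried on input `x`. -/
def PDT.queries {n b : ℕ} : PDT n b → BlockVec (Fin n) b → List (BlockVec (Fin n) b)
  | .leaf, _ => []
  | .query l T₀ T₁, x => l :: (if pairing l x = 0 then T₀.queries x else T₁.queries x)

/-- The affine space `A_T(x)` of the points that give the same answers as `x` to all queries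
made by `T` on input `x`. -/
def PDT.pathSpace {n b : ℕ} (T : PDT n b) (x : BlockVec (Fin n) b) : AffSpace n b where
  carrier := {x' | ∀ l ∈ T.queries x, pairing l x' = pairing l x}
  smul_vsub_vadd_mem' c p₁ p₂ p₃ h₁ h₂ h₃ l hl := by
    have e : pairing l (c • (p₁ -ᵥ p₂) +ᵥ p₃)
        = c * (pairing l p₁ - pairing l p₂) + pairing l p₃ := by
      simp only [pairing, vsub_eq_sub, vadd_eq_add, Pi.add_apply, Pi.smul_apply, Pi.sub_apply,
        smul_eq_mul, ← Finset.sum_sub_distrib, Finset.mul_sum, ← Finset.sum_add_distrib]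
      refine Finset.sum_congr rfl fun i _ => Finset.sum_congr rfl fun j _ => by ring
    rw [e, h₁ l hl, h₂ l hl, h₃ l hl]
    ring

/-! ### PDT-hardness -/

/-- The set `P` of partial assignments is `(p, q)`-PDT-hard for `Φ` (with respect to the gadget
`g`), and the distributions `μ(α)`, `α ∈ P`, witness this. -/
structure IsPDTHardWith {n b : ℕ} (g : (Fin b → ZMod 2) → ZMod 2) (Φ : CNF n)
    (P : Set (PartialAssignment n)) (μ : ∀ α ∈ P, PMF (Fin n → ZMod 2)) (p q : ℝ) : Prop where
  nonempty : P.Nonempty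
  no_falsification : ∀ ρ ∈ P, ∀ C ∈ Φ, ¬ Falsifies ρ C
  downward_closure : ∀ ρ ∈ P, ∀ ρ' : PartialAssignment n,
    (∀ i, ρ' i = none ∨ ρ' i = ρ i) → ρ' ∈ P
  consistent : ∀ (A : AffSpace n b) (y : BlockVec (closureBlocks A) b),
    ((amortizedClosure A).card : ℝ) ≤ p → (∃ x ∈ A, x ∈ consistentSpace y) →
    ∀ hα : gadgetPartial g y ∈ P, ∀ z ∈ (μ _ hα).support, ∀ i : closureBlocks A, z i = g (y i)
  hard : ∀ (A : AffSpace n b) (y : BlockVec (closureBlocks A) b),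
    ((amortizedClosure A).card : ℝ) ≤ p → (∃ x ∈ A, x ∈ consistentSpace y) →
    ∀ hα : gadgetPartial g y ∈ P, ∀ T : PDT n b, (T.depth : ℝ) ≤ q →
      1 / 3 ≤ condProb (liftDist g (μ _ hα))
        {x | gadgetPartial g
          (restrictBlocks x (closureBlocks (T.pathSpace x ⊓ A ⊓ consistentSpace y))) ∈ P}
        (A ⊓ consistentSpace y : AffSpace n b)

/-- `Φ` is `(p, q)`-PDT-hard: it admits a (non-empty) `(p, q)`-PDT-hard set of partial
assignments. -/
def IsPDTHard {n b : ℕ} (g : (Fin b → ZMod 2) → ZMod 2) (Φ : CNF n) (p q : ℝ) : Prop :=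
  ∃ (P : Set (PartialAssignment n)) (μ : ∀ α ∈ P, PMF (Fin n → ZMod 2)),
    IsPDTHardWith g Φ P μ p q

/-! ### Gadgets -/

/-- The Fourier coefficient `𝔼_x [(-1)^{g(x)} (-1)^{∑_{i ∈ S} x_i}]`. -/
def gadgetFourierCoeff {b : ℕ} (g : (Fin b → ZMod 2) → ZMod 2) (S : Finset (Fin b)) : ℝ :=
  (∑ x : Fin b → ZMod 2, (-1 : ℝ) ^ (g x).val * (-1 : ℝ) ^ (∑ i ∈ S, x i).val) / 2 ^ b

/-! ### Expanders and Tseitin contradictions -/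

/-- `G` is a `(|V|, d, lam)`-expander: it is `d`-regular, and its adjacency matrix has norm at
most `lam * d` on the orthogonal complement of the constant vectors (that is, all its
eigenvalues other than one copy of `d` have absolute value at most `lam * d`). -/
def IsSpectralExpander {V : Type*} [Fintype V] (G : SimpleGraph V) (d : ℕ) (lam : ℝ) : Prop :=
  G.IsRegularOfDegree d ∧ ∀ x : V → ℝ, ∑ v, x v = 0 →
    ‖WithLp.toLp 2 ((G.adjMatrix ℝ).mulVec x)‖ ≤ lam * d * ‖WithLp.toLp 2 x‖

variable {V : Type*} [Fintype V] {G : SimpleGraph V} {n : ℕ}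

/-- The variables corresponding to the edges at `v`, for an enumeration `e` of the edges. -/
def incidentVars (e : Fin n ≃ G.edgeSet) (v : V) : Finset (Fin n) :=
  {i | v ∈ (e i : Sym2 V)}

/-- The Tseitin contradiction on `G`, with one variable per edge: for every vertex `v`, the
constraint `∑_{i at v} z_i = 1` is expressed by one clause for each assignment `a` to the edges
at `v` that violates it; this clause excludes exactly `a`. -/
def tseitin (e : Fin n ≃ G.edgeSet) : CNF n :=
  {C | ∃ (v : V) (a : Fin n → ZMod 2), ∑ i ∈ incidentVars e v, a i ≠ 1 ∧
    C = (incidentVars e v).image fun i => (i, a i + 1)}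

/-- The graph `G_ρ`: the edges fixed by `ρ` are removed. -/
def freeGraph (e : Fin n ≃ G.edgeSet) (ρ : PartialAssignment n) : SimpleGraph V :=
  G.deleteEdges {s | ∃ i, ρ i ≠ none ∧ (e i : Sym2 V) = s}

/-- `f_ρ(v) = 1 + ∑ ρ(i)`, over the edges `i` at `v` that are fixed by `ρ`. -/
def residualParity (e : Fin n ≃ G.edgeSet) (ρ : PartialAssignment n) (v : V) : ZMod 2 :=
  1 + ∑ i ∈ incidentVars e v, (ρ i).getD 0

/-- A connected component of `G_ρ` is odd if `f_ρ` sums to `1` over it. -/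
def IsOddComponent (e : Fin n ≃ G.edgeSet) (ρ : PartialAssignment n)
    (K : (freeGraph e ρ).ConnectedComponent) : Prop :=
  ∑ v with (freeGraph e ρ).connectedComponentMk v = K, residualParity e ρ v = 1

/-- `ρ` is valid: `G_ρ` has exactly one odd component, and this component contains more than
half of the vertices. -/
def IsValid (e : Fin n ≃ G.edgeSet) (ρ : PartialAssignment n) : Prop :=
  ∃ K, IsOddComponent e ρ K ∧ (∀ K', IsOddComponent e ρ K' → K' = K) ∧
    (Fintype.card V : ℝ) / 2 < (K.supp.ncard : ℝ)

/-- The vertices lying in an odd component of `G_ρ`; for valid `ρ`, this is the vertex set of the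
unique odd component `C_ρ`. -/
def oddVertices (e : Fin n ≃ G.edgeSet) (ρ : PartialAssignment n) : Finset V :=
  {v | IsOddComponent e ρ ((freeGraph e ρ).connectedComponentMk v)}

theorem oddVertices_nonempty {e : Fin n ≃ G.edgeSet} {ρ : PartialAssignment n}
    (h : IsValid e ρ) : (oddVertices e ρ).Nonempty := by
  obtain ⟨K, hK, -⟩ := h
  induction K using SimpleGraph.ConnectedComponent.ind with
  | h v => exact ⟨v, by simpa [oddVertices] using hK⟩

/-- The choices made by the sampling procedure `DTFooling` when the vertex `v` has been drawn: a
spanning tree of every connected component of `G_ρ` (their union is `forest`), and a root of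
every such tree, the root in the component of `v` being `v`. -/
structure TreeChoice (e : Fin n ≃ G.edgeSet) (ρ : PartialAssignment n) (v : V) where
  forest : SimpleGraph V
  forest_le : forest ≤ freeGraph e ρ
  acyclic : forest.IsAcyclic
  spanning : ∀ u w, (freeGraph e ρ).Reachable u w → forest.Reachable u w
  roots : Set V
  mem_roots : v ∈ roots
  existsUnique_root : ∀ K : (freeGraph e ρ).ConnectedComponent,
    ∃! u, u ∈ roots ∧ (freeGraph e ρ).connectedComponentMk u = K

/-- The unfixed edges that do not belong to one of the chosen spanning trees. -/
abbrev TreeChoice.NonTree {e : Fin n ≃ G.edgeSet} {ρ : PartialAssignment n} {v : V}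
    (t : TreeChoice e ρ v) : Type :=
  {i : Fin n // ρ i = none ∧ (e i : Sym2 V) ∉ t.forest.edgeSet}

/-- The (unique) total assignment that extends `ρ` and the assignment `h` to the non-tree edges
and satisfies the parity constraint at every vertex other than the roots. -/
def TreeChoice.extend {e : Fin n ≃ G.edgeSet} {ρ : PartialAssignment n} {v : V}
    (t : TreeChoice e ρ v) (h : t.NonTree → ZMod 2) : Fin n → ZMod 2 :=
  Classical.epsilon fun z =>
    (∀ i a, ρ i = some a → z i = a) ∧ (∀ i : t.NonTree, z i = h i) ∧
    ∀ u, u ∉ t.roots → ∑ i ∈ incidentVars e u with ρ i = none, z i = residualParity e ρ u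

/-- The distribution `μ_ρ` sampled by `DTFooling`: draw a uniform vertex `v` of the odd component
of `G_ρ`, assign uniform bits to the unfixed edges outside the spanning trees, and extend to the
tree edges. -/
def dtFooling (e : Fin n ≃ G.edgeSet) (ρ : PartialAssignment n) (hρ : IsValid e ρ)
    (t : ∀ v, TreeChoice e ρ v) : PMF (Fin n → ZMod 2) :=
  (PMF.uniformOfFinset (oddVertices e ρ) (oddVertices_nonempty hρ)).bind fun v =>
    (PMF.uniformOfFintype ((t v).NonTree → ZMod 2)).map (t v).extend

end

noncomputable section

open scoped ENNReal Classical

set_option linter.unusedSectionVars false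

/-! ### Ranks of block-supported subspaces -/

/-! Put B = A ∩ C_y. A leaf is harmless for an input x ∈ B as soon as the vertex violated by the
lifted assignment lies in the giant component left after deleting the edges in the closure of that
leaf (`isValid_of_violatesAt`). Three facts are needed: closures at leaves are small, deleting few
edges leaves a giant component, and the tree learns little about which vertex is violated.

Closures. For a space W of forms let r(S) be the dimension of the part of W supported on S. This
function is supermodular, and the closure maximises r(S) − |S|. The closure may jump after one
query, so the quantity tracked is `closureRank`, the minimum over U of |U| plus the rank of W
projected off U. It bounds the size of the closure, grows by at most one per query, does not grow
when closure blocks are fixed, and is at most |Ĉl(A)| by Rado's theorem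
(`closureRank_le_card_vecAmortizedClosure`). Every leaf therefore has a closure of at most n/2000 +
n/2000 blocks.

Expansion. Deleting n/1000 of the edges leaves a component with at least 998/999 of the vertices
(`IsSpectralExpander.card_compl_bigVertices_le`).

Equidistribution. Once the blocks of a deviolator S are fixed, safety of the remaining forms and the
small Fourier coefficients of the gadget make the gadget values outside S pointwise nearly uniform
on B (`IsDeviolator.exists_abs_card_fiberIn_sub_le`). Sums over B may then be compared with sums
over assignments resampled outside S, at the price of a factor κ close to 1.

Potential. Whatever the spanning trees are, μ_ρ is uniform on the extensions of ρ that violate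
exactly one constraint, at a vertex of the giant component. The number `violCount` of completions
violating a prescribed vertex is constant on that component, because flipping a path moves the
violation. Summed over B and suitably normalised, it loses one factor κ per query and one at the
leaf, where almost every vertex gets the same share (`mul_sum_violCount_le_goodCount`). Two more
factors κ come from comparing with the total mass of B, so the success probability is at least
(998/999) κ^(depth + 3), and the block size makes this larger than 1/3. -/

theorem Submodule.finrank_map_add_finrank_inf_ker {K E E' : Type*} [Field K] [AddCommGroup E]
    [Module K E] [AddCommGroup E'] [Module K E'] [FiniteDimensional K E] (f : E →ₗ[K] E')
    (W : Submodule K E) :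
    Module.finrank K (W.map f) + Module.finrank K (W ⊓ LinearMap.ker f : Submodule K E)
      = Module.finrank K W := by
  have h := LinearMap.finrank_range_add_finrank_ker (f.domRestrict W)
  rw [LinearMap.range_domRestrict] at h
  rw [← h]
  congr 1
  have : LinearMap.ker (f.domRestrict W) = (LinearMap.ker f).comap W.subtype := by
    ext x; simp
  rw [this]
  have h2 : ((LinearMap.ker f).comap W.subtype).map W.subtype = W ⊓ LinearMap.ker f := by
    rw [Submodule.map_comap_subtype]
  rw [← h2]
  exact (LinearEquiv.finrank_eq (Submodule.equivMapOfInjective _ W.injective_subtype _)).symm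

/-- `dropBlocks S` as a linear map. -/
def dropLin {n : ℕ} (b : ℕ) (S : Finset (Fin n)) :
    BlockVec (Fin n) b →ₗ[ZMod 2] BlockVec {i : Fin n // i ∉ S} b where
  toFun := dropBlocks S
  map_add' _ _ := rfl
  map_smul' _ _ := rfl

/-- The vectors supported on the blocks in `S`. -/
def supportedOn {n : ℕ} (b : ℕ) (S : Finset (Fin n)) : Submodule (ZMod 2) (BlockVec (Fin n) b) :=
  LinearMap.ker (dropLin b S)

variable {n b : ℕ}

theorem mem_supportedOn {S : Finset (Fin n)} {w : BlockVec (Fin n) b} :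
    w ∈ supportedOn b S ↔ ∀ i ∉ S, w i = 0 := by
  rw [supportedOn, LinearMap.mem_ker]
  constructor
  · intro h i hi
    exact congrFun h ⟨i, hi⟩
  · intro h
    funext i
    exact h i i.2

/-- The dimension of the subspace of vectors of `W` supported on `S`. -/
def blockRank (W : Submodule (ZMod 2) (BlockVec (Fin n) b)) (S : Finset (Fin n)) : ℕ :=
  Module.finrank (ZMod 2) (W ⊓ supportedOn b S : Submodule (ZMod 2) (BlockVec (Fin n) b))

theorem supportedOn_mono {S T : Finset (Fin n)} (h : S ⊆ T) :
    supportedOn b S ≤ supportedOn b T := by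
  intro w hw
  rw [mem_supportedOn] at hw ⊢
  exact fun i hi => hw i fun h' => hi (h h')

theorem supportedOn_inf (S T : Finset (Fin n)) :
    supportedOn b S ⊓ supportedOn b T = supportedOn b (S ∩ T) := by
  ext w
  simp only [Submodule.mem_inf, mem_supportedOn, Finset.mem_inter, not_and_or]
  constructor
  · rintro ⟨h1, h2⟩ i (hi | hi)
    exacts [h1 i hi, h2 i hi]
  · intro h
    exact ⟨fun i hi => h i (Or.inl hi), fun i hi => h i (Or.inr hi)⟩

/-- The sum of the two supported subspaces lies in the one for S ∪ T, and their intersection is the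
one for S ∩ T. -/
theorem blockRank_supermodular (W : Submodule (ZMod 2) (BlockVec (Fin n) b))
    (S T : Finset (Fin n)) :
    blockRank W S + blockRank W T ≤ blockRank W (S ∪ T) + blockRank W (S ∩ T) := by
  have h := Submodule.finrank_sup_add_finrank_inf_eq (W ⊓ supportedOn b S) (W ⊓ supportedOn b T)
  have h1 : (W ⊓ supportedOn b S) ⊓ (W ⊓ supportedOn b T) = W ⊓ supportedOn b (S ∩ T) := by
    rw [← supportedOn_inf, ← inf_inf_distrib_left]
  have h2 : (W ⊓ supportedOn b S) ⊔ (W ⊓ supportedOn b T) ≤ W ⊓ supportedOn b (S ∪ T) :=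
    sup_le (inf_le_inf_left _ (supportedOn_mono Finset.subset_union_left))
      (inf_le_inf_left _ (supportedOn_mono Finset.subset_union_right))
  rw [h1] at h
  have h3 := Submodule.finrank_mono h2
  unfold blockRank
  omega

theorem finrank_map_dropLin (W : Submodule (ZMod 2) (BlockVec (Fin n) b)) (S : Finset (Fin n)) :
    Module.finrank (ZMod 2) (W.map (dropLin b S)) + blockRank W S
      = Module.finrank (ZMod 2) W :=
  Submodule.finrank_map_add_finrank_inf_ker _ _

theorem finrank_map_dropLin_inf (W : Submodule (ZMod 2) (BlockVec (Fin n) b))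
    {S T : Finset (Fin n)} (h : S ⊆ T) :
    Module.finrank (ZMod 2) ((W ⊓ supportedOn b T).map (dropLin b S)) + blockRank W S
      = blockRank W T := by
  rw [blockRank, blockRank, ← Submodule.finrank_map_add_finrank_inf_ker (dropLin b S)
    (W ⊓ supportedOn b T)]
  congr 1
  change _ = Module.finrank (ZMod 2) (W ⊓ supportedOn b T ⊓ supportedOn b S : Submodule _ _)
  rw [inf_assoc, supportedOn_inf, Finset.inter_eq_right.2 h]

/-! ### Deviolators and closures -/

theorem span_dropBlocks_image (W : Submodule (ZMod 2) (BlockVec (Fin n) b))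
    (S : Finset (Fin n)) :
    Submodule.span (ZMod 2) (dropBlocks S '' (W : Set (BlockVec (Fin n) b)))
      = W.map (dropLin b S) := by
  change Submodule.span (ZMod 2) (dropLin b S '' (W : Set (BlockVec (Fin n) b))) = _
  rw [Submodule.span_image, Submodule.span_eq]

/-- Safety is applied to a basis of the projection of W ∩ supp(T), which can only meet blocks of T \
S. Together with the converse below, this turns deviolators into local maximality of r(S) − |S|
among supersets. -/
theorem IsDeviolator.blockRank_le {W : Submodule (ZMod 2) (BlockVec (Fin n) b)}
    {S : Finset (Fin n)} (h : IsDeviolator (W : Set (BlockVec (Fin n) b)) S)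
    {T : Finset (Fin n)} (hT : S ⊆ T) :
    blockRank W T + S.card ≤ blockRank W S + T.card := by
  have h1 := finrank_map_dropLin_inf W hT
  set U := (W ⊓ supportedOn b T).map (dropLin b S) with hU
  let B := Module.finBasis (ZMod 2) U
  have h2 := h (Module.finrank (ZMod 2) U) (fun t => (B t : BlockVec {i : Fin n // i ∉ S} b)) ?_ ?_
  · have h3 : (blockSupport fun t => (B t : BlockVec {i : Fin n // i ∉ S} b)).card
        ≤ (T \ S).card := by
      apply Finset.card_le_card_of_injOn Subtype.val _ Subtype.val_injective.injOn
      intro i hi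
      simp only [blockSupport, Finset.coe_filter, Set.mem_ofPred_eq, Finset.mem_univ,
        true_and] at hi
      obtain ⟨t, ht⟩ := hi
      obtain ⟨w, hw, hwt⟩ := (B t).2
      rw [Finset.coe_sdiff]
      refine ⟨?_, i.2⟩
      by_contra hiT
      apply ht
      rw [← hwt]
      exact mem_supportedOn.1 hw.2 i hiT
    rw [Finset.card_sdiff_of_subset hT] at h3
    have := Finset.card_le_card hT
    omega
  · intro t
    rw [span_dropBlocks_image]
    exact Submodule.map_mono inf_le_left (B t).2
  · exact B.linearIndependent.map' U.subtype (Submodule.ker_subtype U)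

/-- Independent projected vectors meeting exactly the blocks R lift to vectors of W supported on S ∪
R, so the hypothesis for T = S ∪ R bounds their number by |R|. -/
theorem isDeviolator_of_blockRank_le {W : Submodule (ZMod 2) (BlockVec (Fin n) b)}
    {S : Finset (Fin n)}
    (h : ∀ T, S ⊆ T → blockRank W T + S.card ≤ blockRank W S + T.card) :
    IsDeviolator (W : Set (BlockVec (Fin n) b)) S := by
  intro k w hw hli
  rw [span_dropBlocks_image] at hw
  set R := (blockSupport w).map (Function.Embedding.subtype _) with hR
  have hdisj : Disjoint S R := by
    rw [Finset.disjoint_right]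
    intro i hi
    rw [hR, Finset.mem_map] at hi
    obtain ⟨j, -, rfl⟩ := hi
    exact j.2
  have h1 := h (S ∪ R) Finset.subset_union_left
  rw [Finset.card_union_of_disjoint hdisj, hR, Finset.card_map, ← hR,
    ← finrank_map_dropLin_inf W (Finset.subset_union_left : S ⊆ S ∪ R)] at h1
  have h2 : k ≤ Module.finrank (ZMod 2) ((W ⊓ supportedOn b (S ∪ R)).map (dropLin b S)) := by
    have hmem : ∀ t, w t ∈ (W ⊓ supportedOn b (S ∪ R)).map (dropLin b S) := by
      intro t
      obtain ⟨u, hu, hut⟩ := hw t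
      refine ⟨u, ⟨hu, mem_supportedOn.2 fun i hi => ?_⟩, hut⟩
      rw [Finset.mem_union, not_or] at hi
      have h3 : u i = w t ⟨i, hi.1⟩ := by rw [← hut]; rfl
      rw [h3]
      by_contra h4
      apply hi.2
      rw [hR, Finset.mem_map]
      refine ⟨⟨i, hi.1⟩, ?_, rfl⟩
      simp only [blockSupport, Finset.mem_filter, Finset.mem_univ, true_and]
      exact ⟨t, h4⟩
    have hli' : LinearIndependent (ZMod 2)
        (fun t => (⟨w t, hmem t⟩ : (W ⊓ supportedOn b (S ∪ R)).map (dropLin b S))) :=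
      LinearIndependent.of_comp (Submodule.subtype _) hli
    simpa using hli'.fintype_card_le_finrank
  omega

theorem IsDeviolator.anti {W W' : Set (BlockVec (Fin n) b)} (hW : W ⊆ W') {S : Finset (Fin n)}
    (h : IsDeviolator W' S) : IsDeviolator W S := by
  intro k w hw
  exact h k w fun t => Submodule.span_mono (Set.image_mono hW) (hw t)

/-- Passing from S to U ∪ S does not increase r − |·|; by supermodularity, neither does passing from
U ∩ S to U. -/
theorem IsDeviolator.blockRank_inter {W : Submodule (ZMod 2) (BlockVec (Fin n) b)}
    {S : Finset (Fin n)} (h : IsDeviolator (W : Set (BlockVec (Fin n) b)) S)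
    (U : Finset (Fin n)) :
    blockRank W U + (U ∩ S).card ≤ blockRank W (U ∩ S) + U.card := by
  have h1 := h.blockRank_le (Finset.subset_union_right : S ⊆ U ∪ S)
  have h2 := blockRank_supermodular W U S
  have h3 := Finset.card_union_add_card_inter U S
  omega

/-- This makes a minimal deviolator the least one, so the arbitrary choice in `vecClosure` is
harmless. -/
theorem IsDeviolator.inter {W : Submodule (ZMod 2) (BlockVec (Fin n) b)}
    {S T : Finset (Fin n)} (hS : IsDeviolator (W : Set (BlockVec (Fin n) b)) S)
    (hT : IsDeviolator (W : Set (BlockVec (Fin n) b)) T) :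
    IsDeviolator (W : Set (BlockVec (Fin n) b)) (S ∩ T) := by
  apply isDeviolator_of_blockRank_le
  intro U hU
  have h1 := hS.blockRank_inter U
  have h2 := hT.blockRank_inter (U ∩ S)
  rw [Finset.inter_assoc, Finset.inter_eq_right.2 hU] at h2
  omega

theorem isDeviolator_vecClosure (W : Set (BlockVec (Fin n) b)) :
    IsDeviolator W (vecClosure W) :=
  (Classical.choose_spec (exists_minimal_deviolator W)).prop

theorem vecClosure_subset {W : Submodule (ZMod 2) (BlockVec (Fin n) b)} {S : Finset (Fin n)}
    (hS : IsDeviolator (W : Set (BlockVec (Fin n) b)) S) :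
    vecClosure (W : Set (BlockVec (Fin n) b)) ⊆ S := by
  have h := Classical.choose_spec (exists_minimal_deviolator (W : Set (BlockVec (Fin n) b)))
  have h1 : vecClosure (W : Set (BlockVec (Fin n) b)) ⊆
      vecClosure (W : Set (BlockVec (Fin n) b)) ∩ S :=
    h.le_of_le ((isDeviolator_vecClosure _).inter hS) Finset.inter_subset_left
  exact h1.trans Finset.inter_subset_right

theorem vecClosure_mono {W W' : Submodule (ZMod 2) (BlockVec (Fin n) b)} (h : W ≤ W') :
    vecClosure (W : Set (BlockVec (Fin n) b)) ⊆ vecClosure (W' : Set (BlockVec (Fin n) b)) :=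
  vecClosure_subset ((isDeviolator_vecClosure _).anti h)

/-- The closure maximises r(U) − |U| over all U, not only over supersets: a maximiser among the
subsets of the closure is itself a deviolator, hence is the whole closure. -/
theorem blockRank_le_vecClosure (W : Submodule (ZMod 2) (BlockVec (Fin n) b))
    (U : Finset (Fin n)) :
    blockRank W U + (vecClosure (W : Set (BlockVec (Fin n) b))).card
      ≤ blockRank W (vecClosure (W : Set (BlockVec (Fin n) b))) + U.card := by
  set S := vecClosure (W : Set (BlockVec (Fin n) b)) with hS
  have hdev : IsDeviolator (W : Set (BlockVec (Fin n) b)) S := isDeviolator_vecClosure _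
  obtain ⟨U₀, hU₀, hmax⟩ := Finset.exists_max_image S.powerset
    (fun T => (blockRank W T : ℤ) - T.card) ⟨∅, Finset.empty_mem_powerset _⟩
  rw [Finset.mem_powerset] at hU₀
  have hU₀' : S ⊆ U₀ := by
    rw [hS]
    apply vecClosure_subset
    apply isDeviolator_of_blockRank_le
    intro T _
    have h1 := hdev.blockRank_inter T
    have h2 := hmax (T ∩ S) (Finset.mem_powerset.2 Finset.inter_subset_right)
    omega
  have h1 := hdev.blockRank_inter U
  have h2 := hmax (U ∩ S) (Finset.mem_powerset.2 Finset.inter_subset_right)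
  rw [← hU₀'.antisymm hU₀] at h2
  omega

/-- The size of the closure plus the rank of what remains outside of it. -/
def closureRank (W : Submodule (ZMod 2) (BlockVec (Fin n) b)) : ℕ :=
  (vecClosure (W : Set (BlockVec (Fin n) b))).card + Module.finrank (ZMod 2)
    (W.map (dropLin b (vecClosure (W : Set (BlockVec (Fin n) b)))))

theorem card_vecClosure_le_closureRank (W : Submodule (ZMod 2) (BlockVec (Fin n) b)) :
    (vecClosure (W : Set (BlockVec (Fin n) b))).card ≤ closureRank W :=
  Nat.le_add_right _ _

/-- By rank-nullity the right side is dim W − (r(U) − |U|), which is smallest at the closure. Being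
a minimum, `closureRank` can be bounded by testing any convenient U. -/
theorem closureRank_le (W : Submodule (ZMod 2) (BlockVec (Fin n) b)) (U : Finset (Fin n)) :
    closureRank W ≤ U.card + Module.finrank (ZMod 2) (W.map (dropLin b U)) := by
  have h1 := blockRank_le_vecClosure W U
  have h2 := finrank_map_dropLin W U
  have h3 := finrank_map_dropLin W (vecClosure (W : Set (BlockVec (Fin n) b)))
  unfold closureRank
  omega

/-- Testing with the old closure, one new form raises the projected rank by at most one. The size of
the closure alone has no such bound. -/
theorem closureRank_le_add_one {W W' : Submodule (ZMod 2) (BlockVec (Fin n) b)}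
    {l : BlockVec (Fin n) b} (h : W' ≤ W ⊔ Submodule.span (ZMod 2) {l}) :
    closureRank W' ≤ closureRank W + 1 := by
  set S := vecClosure (W : Set (BlockVec (Fin n) b)) with hS
  have h1 := closureRank_le W' S
  have h2 : W'.map (dropLin b S)
      ≤ W.map (dropLin b S) ⊔ Submodule.span (ZMod 2) {dropLin b S l} := by
    refine (Submodule.map_mono h).trans ?_
    rw [Submodule.map_sup, Submodule.map_span, Set.image_singleton]
  have h3 := Submodule.finrank_mono h2
  have h4 := Submodule.finrank_add_le_finrank_add_finrank (W.map (dropLin b S))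
    (Submodule.span (ZMod 2) {dropLin b S l})
  have h5 : Module.finrank (ZMod 2) (Submodule.span (ZMod 2) {dropLin b S l}) ≤ 1 := by
    simpa using finrank_span_le_card (R := ZMod 2) ({dropLin b S l} : Set _)
  have h6 : closureRank W = S.card + Module.finrank (ZMod 2) (W.map (dropLin b S)) := rfl
  omega

/-- Forms supported on the closure disappear under the projection off the closure, so fixing closure
blocks costs nothing. -/
theorem closureRank_le_of_le_sup_supportedOn {W W' : Submodule (ZMod 2) (BlockVec (Fin n) b)}
    (h : W' ≤ W ⊔ supportedOn b (vecClosure (W : Set (BlockVec (Fin n) b)))) :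
    closureRank W' ≤ closureRank W := by
  set S := vecClosure (W : Set (BlockVec (Fin n) b)) with hS
  have h1 := closureRank_le W' S
  have h2 : W'.map (dropLin b S) ≤ W.map (dropLin b S) := by
    refine (Submodule.map_mono h).trans ?_
    rw [Submodule.map_sup, LinearMap.le_ker_iff_map.1 (le_refl (supportedOn b S)), sup_bot_eq]
  have h3 := Submodule.finrank_mono h2
  have h6 : closureRank W = S.card + Module.finrank (ZMod 2) (W.map (dropLin b S)) := rfl
  omega

theorem isDeviolator_of_le_sup_supportedOn {W W' : Submodule (ZMod 2) (BlockVec (Fin n) b)}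
    {S : Finset (Fin n)} (hS : IsDeviolator (W : Set (BlockVec (Fin n) b)) S)
    (h : W' ≤ W ⊔ supportedOn b S) :
    IsDeviolator (W' : Set (BlockVec (Fin n) b)) S := by
  have h2 : W'.map (dropLin b S) ≤ W.map (dropLin b S) := by
    refine (Submodule.map_mono h).trans ?_
    rw [Submodule.map_sup, LinearMap.le_ker_iff_map.1 (le_refl (supportedOn b S)), sup_bot_eq]
  intro k w hw
  rw [span_dropBlocks_image] at hw
  exact hS k w fun t => by rw [span_dropBlocks_image]; exact h2 (hw t)

/-! ### Independent transversals -/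

/-- Rado's theorem on independent transversals, in its deficiency version. -/
theorem exists_linearIndependent_transversal {K E ι X : Type*} [Field K] [AddCommGroup E]
    [Module K E] [FiniteDimensional K E] [Fintype ι] [DecidableEq ι] (f : X → E) (k m : ℕ)
    (A : ι → Finset X)
    (hm : ∑ i, (A i).card = m)
    (hA : ∀ T : Finset ι,
      k ≤ Module.finrank K (Submodule.span K (f '' {x | ∃ i ∈ T, x ∈ A i})) + Tᶜ.card) :
    ∃ (I : Finset ι) (c : I → X), (∀ i : I, c i ∈ A i) ∧ LinearIndependent K (f ∘ c) ∧
      k ≤ I.card := by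
  induction m using Nat.strong_induction_on generalizing A with
  | _ m ih =>
  -- As long as some set has two elements, one of them can be deleted without destroying the rank
  -- condition; the induction is on the total size.
  by_cases hbig : ∃ i, 1 < (A i).card
  · obtain ⟨i, hi⟩ := hbig
    obtain ⟨x, hx, y, hy, hxy⟩ := Finset.one_lt_card.1 hi
    let A' : X → ι → Finset X := fun z => Function.update A i ((A i).erase z)
    have hsub : ∀ z j, A' z j ⊆ A j := by
      intro z j
      by_cases hj : j = i
      · subst hj; simp only [A', Function.update_self]; exact Finset.erase_subset _ _
      · simp only [A', Function.update_of_ne hj]; exact Finset.Subset.refl _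
    have hne : ∀ z j, j ≠ i → A' z j = A j := fun z j hj => by
      simp only [A', Function.update_of_ne hj]
    have hself : ∀ z, A' z i = (A i).erase z := fun z => by
      simp only [A', Function.update_self]
    have key : ∀ z ∈ A i, (∀ T : Finset ι, k ≤ Module.finrank K
        (Submodule.span K (f '' {x | ∃ i ∈ T, x ∈ A' z i})) + Tᶜ.card) →
        ∃ (I : Finset ι) (c : I → X), (∀ i : I, c i ∈ A i) ∧ LinearIndependent K (f ∘ c) ∧
      k ≤ I.card := by
      intro z hz hT
      have hlt : ∑ j, (A' z j).card < m := by
        rw [← hm]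
        refine Finset.sum_lt_sum (fun j _ => Finset.card_le_card (hsub z j))
          ⟨i, Finset.mem_univ _, ?_⟩
        rw [hself]
        exact Finset.card_erase_lt_of_mem hz
      obtain ⟨I, c, hc, h⟩ := ih _ hlt (A' z) rfl hT
      exact ⟨I, c, fun j => hsub z j (hc j), h⟩
    by_contra hcon
    -- If neither deletion works, there are violating index sets T₁ and T₂, both containing i.
    -- Submodularity of rank, with the condition for T₁ ∪ T₂ and for (T₁ ∩ T₂) without i, is
    -- contradictory: dropping i loses one, while the two strict violations gain two.
    have h1 := mt (key x hx) hcon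
    have h2 := mt (key y hy) hcon
    push Not at h1 h2
    obtain ⟨T₁, h1⟩ := h1
    obtain ⟨T₂, h2⟩ := h2
    have hmem : ∀ z (T : Finset ι), Module.finrank K
        (Submodule.span K (f '' {x | ∃ i ∈ T, x ∈ A' z i})) + Tᶜ.card < k → i ∈ T := by
      intro z T hT
      by_contra hiT
      have h3 : {x | ∃ j ∈ T, x ∈ A' z j} = {x | ∃ j ∈ T, x ∈ A j} := by
        ext w
        constructor
        · rintro ⟨j, hj, hw⟩
          exact ⟨j, hj, hsub z j hw⟩
        · rintro ⟨j, hj, hw⟩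
          exact ⟨j, hj, by rwa [hne z j (fun h => hiT (h ▸ hj))]⟩
      rw [h3] at hT
      exact absurd (hA T) (not_le.2 hT)
    have hi1 := hmem x T₁ h1
    have hi2 := hmem y T₂ h2
    set P₁ := Submodule.span K (f '' {w | ∃ j ∈ T₁, w ∈ A' x j}) with hP1
    set P₂ := Submodule.span K (f '' {w | ∃ j ∈ T₂, w ∈ A' y j}) with hP2
    have hsup : Submodule.span K (f '' {w | ∃ j ∈ T₁ ∪ T₂, w ∈ A j}) ≤ P₁ ⊔ P₂ := by
      rw [Submodule.span_le]
      rintro _ ⟨w, ⟨j, hj, hw⟩, rfl⟩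
      have hl : ∀ j ∈ T₁, w ∈ A' x j → f w ∈ P₁ ⊔ P₂ := fun j hj hw =>
        Submodule.mem_sup_left (Submodule.subset_span ⟨w, ⟨j, hj, hw⟩, rfl⟩)
      have hr : ∀ j ∈ T₂, w ∈ A' y j → f w ∈ P₁ ⊔ P₂ := fun j hj hw =>
        Submodule.mem_sup_right (Submodule.subset_span ⟨w, ⟨j, hj, hw⟩, rfl⟩)
      by_cases hji : j = i
      · subst hji
        by_cases hwx : w = x
        · refine hr j hi2 ?_
          rw [hself, Finset.mem_erase]
          exact ⟨hwx ▸ hxy, hw⟩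
        · refine hl j hi1 ?_
          rw [hself, Finset.mem_erase]
          exact ⟨hwx, hw⟩
      · rcases Finset.mem_union.1 hj with h | h
        · exact hl j h (by rwa [hne _ _ hji])
        · exact hr j h (by rwa [hne _ _ hji])
    have hinf : Submodule.span K (f '' {w | ∃ j ∈ (T₁ ∩ T₂).erase i, w ∈ A j}) ≤ P₁ ⊓ P₂ := by
      rw [Submodule.span_le]
      rintro _ ⟨w, ⟨j, hj, hw⟩, rfl⟩
      rw [Finset.mem_erase, Finset.mem_inter] at hj
      exact ⟨Submodule.subset_span ⟨w, ⟨j, hj.2.1, by rwa [hne _ _ hj.1]⟩, rfl⟩,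
        Submodule.subset_span ⟨w, ⟨j, hj.2.2, by rwa [hne _ _ hj.1]⟩, rfl⟩⟩
    have h3 := Submodule.finrank_mono hsup
    have h4 := Submodule.finrank_mono hinf
    have h5 := Submodule.finrank_sup_add_finrank_inf_eq P₁ P₂
    have h6 := hA (T₁ ∪ T₂)
    have h7 := hA ((T₁ ∩ T₂).erase i)
    have h8 := Finset.card_union_add_card_inter T₁ T₂
    have h9 := Finset.card_erase_add_one (Finset.mem_inter.2 ⟨hi1, hi2⟩)
    have c1 := Finset.card_add_card_compl T₁
    have c2 := Finset.card_add_card_compl T₂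
    have c3 := Finset.card_add_card_compl (T₁ ∪ T₂)
    have c4 := Finset.card_add_card_compl ((T₁ ∩ T₂).erase i)
    omega
  -- Now every set has at most one element, so a basis of the total span picks its members from
  -- distinct sets.
  · push Not at hbig
    have hk := hA Finset.univ
    rw [Finset.compl_univ, Finset.card_empty, add_zero] at hk
    obtain ⟨t, hts, hspan, hli⟩ :=
      exists_linearIndependent K (f '' {x | ∃ i ∈ (Finset.univ : Finset ι), x ∈ A i})
    rw [← hspan] at hk
    have : Fintype t := Set.Finite.fintype hli.setFinite
    rw [finrank_span_set_eq_card hli] at hk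
    have hch : ∀ u : t, ∃ i x, x ∈ A i ∧ f x = u := by
      intro u
      obtain ⟨x, ⟨i, -, hx⟩, hfx⟩ := hts u.2
      exact ⟨i, x, hx, hfx⟩
    choose i x hx hfx using hch
    have hinj : Function.Injective i := by
      intro u v huv
      have h1 := hx u
      have h2 := hx v
      rw [← huv] at h2
      have h3 := Finset.card_le_one.1 (hbig (i u)) _ h1 _ h2
      apply Subtype.ext
      rw [← hfx u, ← hfx v, h3]
    have hu : ∀ j : Finset.univ.image i, ∃ u, i u = j := fun j => by
      obtain ⟨u, -, hu⟩ := Finset.mem_image.1 j.2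
      exact ⟨u, hu⟩
    choose u hu using hu
    refine ⟨Finset.univ.image i, fun j => x (u j), fun j => ?_, ?_, ?_⟩
    · rw [← hu j]; exact hx _
    · have h1 : f ∘ (fun j => x (u j)) = (fun v : t => (v : E)) ∘ u := by
        funext j
        exact hfx _
      rw [h1]
      refine LinearIndependent.comp hli u fun j j' h => ?_
      apply Subtype.ext
      rw [← hu j, ← hu j', h]
    · rw [Finset.card_image_of_injective _ hinj, Finset.card_univ, ← Set.toFinset_card]
      exact hk

/-! ### The amortized closure -/

variable {n b : ℕ}

/-- The column of the matrix with row set `W` at a coordinate. -/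
def blockColumn (W : Set (BlockVec (Fin n) b)) (p : Fin n × Fin b) : W → ZMod 2 :=
  fun v => v.1 p.1 p.2

/-- Acceptable sets are seen as partial transversals of independent sets of coordinates, which is
the form in which coordinates can be exchanged. -/
theorem isAcceptable_iff {W : Set (BlockVec (Fin n) b)} {S : Finset (Fin n)} :
    IsAcceptable W S ↔ ∃ P : Finset (Fin n × Fin b), P.image Prod.fst = S ∧
      Set.InjOn Prod.fst (P : Set (Fin n × Fin b)) ∧
      LinearIndepOn (ZMod 2) (blockColumn W) (P : Set (Fin n × Fin b)) := by
  constructor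
  · rintro ⟨c, hc⟩
    let q : S → Fin n × Fin b := fun s => (s, c s)
    have hq : Function.Injective q := fun s s' h => Subtype.ext (congrArg Prod.fst h)
    refine ⟨Finset.univ.image q, ?_, ?_, ?_⟩
    · ext i
      simp [q]
    · intro p hp p' hp' h
      simp only [Finset.coe_image, Finset.coe_univ, Set.image_univ, Set.mem_range] at hp hp'
      obtain ⟨s, rfl⟩ := hp
      obtain ⟨s', rfl⟩ := hp'
      have : s = s' := Subtype.ext h
      rw [this]
    · rw [Finset.coe_image, Finset.coe_univ, Set.image_univ,
        linearIndepOn_range_iff hq]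
      exact hc
  · rintro ⟨P, rfl, hinj, hli⟩
    have h : ∀ s : P.image Prod.fst, ∃ j, ((s : Fin n), j) ∈ P := fun s => by
      obtain ⟨p, hp, hps⟩ := Finset.mem_image.1 s.2
      exact ⟨p.2, by rw [← hps]; exact hp⟩
    choose c hc using h
    refine ⟨c, ?_⟩
    exact LinearIndependent.comp hli
      (fun s : P.image Prod.fst => (⟨((s : Fin n), c s), hc s⟩ : (P : Set (Fin n × Fin b))))
      (fun s s' h => Subtype.ext (congrArg (fun p => p.1.1) h))

/-- Matroid augmentation. Among the coordinate sets P realising I, take one sharing most elements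
with a realisation Q of J. Some q ∈ Q has its column outside the span of P. If its block were
already used by p ∈ P, replacing p by q would increase the overlap; so its block is new. -/
theorem IsAcceptable.exists_insert {W : Set (BlockVec (Fin n) b)} {I J : Finset (Fin n)}
    (hI : IsAcceptable W I) (hJ : IsAcceptable W J) (hIJ : I.card < J.card) :
    ∃ j ∉ I, IsAcceptable W (insert j I) := by
  rw [isAcceptable_iff] at hI hJ
  obtain ⟨Q, hQJ, hQinj, hQ⟩ := hJ
  obtain ⟨P₀, hP₀⟩ := hI
  obtain ⟨P, hPmem, hmax⟩ := Finset.exists_max_image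
    (Finset.univ.filter fun P : Finset (Fin n × Fin b) => P.image Prod.fst = I ∧
      Set.InjOn Prod.fst (P : Set (Fin n × Fin b)) ∧
      LinearIndepOn (ZMod 2) (blockColumn W) (P : Set (Fin n × Fin b)))
    (fun P => (P ∩ Q).card) ⟨P₀, by simpa using hP₀⟩
  simp only [Finset.mem_filter, Finset.mem_univ, true_and] at hPmem hmax
  obtain ⟨hPI, hPinj, hP⟩ := hPmem
  have hcard : P.card < Q.card := by
    rw [← Finset.card_image_of_injOn hPinj, ← Finset.card_image_of_injOn hQinj, hPI, hQJ]
    exact hIJ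
  have hq : ∃ q ∈ Q, blockColumn W q ∉ Submodule.span (ZMod 2) (blockColumn W '' P) := by
    by_contra hcon
    push Not at hcon
    have h1 : LinearIndependent (ZMod 2) (fun q : (Q : Set (Fin n × Fin b)) =>
        (⟨blockColumn W q, hcon q q.2⟩ : Submodule.span (ZMod 2) (blockColumn W '' P))) :=
      LinearIndependent.of_comp (Submodule.subtype _) hQ
    have h2 := h1.fintype_card_le_finrank
    have h3 : Module.finrank (ZMod 2) (Submodule.span (ZMod 2) (blockColumn W '' P)) ≤ P.card := by
      rw [← Finset.coe_image]
      exact (finrank_span_finset_le_card _).trans Finset.card_image_le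
    simp only [SetLike.coe_sort_coe, Fintype.card_coe] at h2
    omega
  obtain ⟨q, hqQ, hq⟩ := hq
  have hqP : q ∉ P := fun h => hq (Submodule.subset_span ⟨q, h, rfl⟩)
  by_cases hqI : q.1 ∈ I
  · exfalso
    rw [← hPI, Finset.mem_image] at hqI
    obtain ⟨p, hp, hpq⟩ := hqI
    have hpQ : p ∉ Q := by
      intro h
      have := hQinj h hqQ hpq
      exact hqP (this ▸ hp)
    have hle : ((P.erase p : Finset _) : Set (Fin n × Fin b)) ⊆ P := by
      exact_mod_cast Finset.erase_subset p P
    have himg : (insert q (P.erase p)).image Prod.fst = I := by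
      rw [← hPI, Finset.image_insert, ← hpq, ← Finset.image_insert, Finset.insert_erase hp]
    have hinj : Set.InjOn Prod.fst ((insert q (P.erase p) : Finset _) : Set (Fin n × Fin b)) := by
      rw [Finset.coe_insert, Set.injOn_insert (fun h => hqP (Finset.mem_of_mem_erase h))]
      refine ⟨hPinj.mono hle, ?_⟩
      rintro ⟨p', hp', h⟩
      have h1 : p' ∈ P.erase p := hp'
      have h2 := hPinj (Finset.mem_of_mem_erase h1) hp (h.trans hpq.symm)
      exact (Finset.ne_of_mem_erase h1) h2
    have hli : LinearIndepOn (ZMod 2) (blockColumn W)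
        ((insert q (P.erase p) : Finset _) : Set (Fin n × Fin b)) := by
      rw [Finset.coe_insert]
      refine LinearIndepOn.insert (hP.mono hle) fun h => hq ?_
      exact Submodule.span_mono (Set.image_mono hle) h
    have h1 := hmax _ ⟨himg, hinj, hli⟩
    have h2 : insert q (P ∩ Q) ⊆ insert q (P.erase p) ∩ Q := by
      intro r hr
      rw [Finset.mem_insert, Finset.mem_inter] at hr
      rw [Finset.mem_inter, Finset.mem_insert, Finset.mem_erase]
      rcases hr with rfl | ⟨h3, h4⟩
      · exact ⟨Or.inl rfl, hqQ⟩
      · exact ⟨Or.inr ⟨fun h => hpQ (h ▸ h4), h3⟩, h4⟩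
    have h3 := Finset.card_le_card h2
    rw [Finset.card_insert_of_notMem (fun h => hqP (Finset.mem_inter.1 h).1)] at h3
    omega
  · refine ⟨q.1, hqI, isAcceptable_iff.2 ⟨insert q P, ?_, ?_, ?_⟩⟩
    · rw [Finset.image_insert, hPI]
    · rw [Finset.coe_insert, Set.injOn_insert hqP]
      refine ⟨hPinj, ?_⟩
      rintro ⟨p', hp', h⟩
      exact hqI (hPI ▸ Finset.mem_image.2 ⟨p', hp', h⟩)
    · rw [Finset.coe_insert]
      exact hP.insert hq

/-- Inserting a block makes the indicator vector lexicographically larger, so by augmentation the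
lexicographic maximum also has maximum size. -/
theorem IsAcceptable.card_le {W : Set (BlockVec (Fin n) b)} {J : Finset (Fin n)}
    (hJ : IsAcceptable W J) : J.card ≤ (vecAmortizedClosure W).card := by
  obtain ⟨hS, hmax⟩ := Classical.choose_spec (exists_lexMax_acceptable W)
  by_contra hlt
  rw [not_le] at hlt
  obtain ⟨j, hj, hacc⟩ := IsAcceptable.exists_insert hS hJ hlt
  refine absurd (hmax _ hacc) (not_le.2 (Pi.toLex_strictMono ?_))
  rw [Pi.lt_def]
  refine ⟨fun i => ?_, j, ?_⟩
  · by_cases h : i ∈ (exists_lexMax_acceptable W).choose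
    · simp [h]
    · simp [h]
  · simp [hj]

theorem closureRank_le_card_vecAmortizedClosure
    (W : Submodule (ZMod 2) (BlockVec (Fin n) b)) :
    closureRank W ≤ (vecAmortizedClosure (W : Set (BlockVec (Fin n) b))).card := by
  -- Columns are taken as functionals on W: those over the blocks of T vanish together exactly on
  -- the vectors supported off T, so they have rank dim W − r(Tᶜ). Rado's condition is then
  -- `closureRank_le` for Tᶜ.
  let f : Fin n × Fin b → Module.Dual (ZMod 2) W := fun p =>
    ((LinearMap.proj p.2 : (Fin b → ZMod 2) →ₗ[ZMod 2] ZMod 2) ∘ₗ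
      (LinearMap.proj p.1 : BlockVec (Fin n) b →ₗ[ZMod 2] (Fin b → ZMod 2))) ∘ₗ W.subtype
  have hf : ∀ p (w : W), f p w = (w : BlockVec (Fin n) b) p.1 p.2 := fun _ _ => rfl
  have hcond : ∀ T : Finset (Fin n), closureRank W ≤ Module.finrank (ZMod 2)
      (Submodule.span (ZMod 2) (f '' {x | ∃ i ∈ T,
        x ∈ Finset.univ.map ⟨Prod.mk i, Prod.mk_right_injective i⟩})) + Tᶜ.card := by
    intro T
    have h1 := closureRank_le W Tᶜ
    have h2 := finrank_map_dropLin W Tᶜ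
    set C := Submodule.span (ZMod 2) (f '' {x | ∃ i ∈ T,
      x ∈ Finset.univ.map ⟨Prod.mk i, Prod.mk_right_injective i⟩}) with hC
    have h3 := Subspace.finrank_add_finrank_dualCoannihilator_eq C
    have h4 : Module.finrank (ZMod 2) C.dualCoannihilator ≤ blockRank W Tᶜ := by
      unfold blockRank
      rw [LinearEquiv.finrank_eq (Submodule.equivMapOfInjective _ W.injective_subtype
        C.dualCoannihilator)]
      apply Submodule.finrank_mono
      rintro _ ⟨w, hw, rfl⟩
      refine ⟨w.2, mem_supportedOn.2 fun i hi => ?_⟩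
      rw [Finset.mem_compl, not_not] at hi
      funext j
      refine (Submodule.mem_dualCoannihilator w).1 hw (f (i, j))
        (Submodule.subset_span ⟨(i, j), ⟨i, hi, ?_⟩, rfl⟩)
      simp
    omega
  obtain ⟨I, c, hc, hli, hk⟩ := exists_linearIndependent_transversal (K := ZMod 2) f
    (closureRank W) _ (fun i => Finset.univ.map ⟨Prod.mk i, Prod.mk_right_injective i⟩) rfl hcond
  refine hk.trans (IsAcceptable.card_le ⟨fun i => (c i).2, ?_⟩)
  have h1 : ∀ i : I, (c i).1 = i := by
    intro i
    obtain ⟨j, -, hj⟩ := Finset.mem_map.1 (hc i)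
    rw [← hj]; rfl
  have h2 := hli.map' (LinearMap.ltoFun (ZMod 2) W (ZMod 2) (ZMod 2))
    (LinearMap.ker_eq_bot.2 DFunLike.coe_injective)
  have h3 : (fun (i : I) (w : W) => w.1 i (c i).2)
      = LinearMap.ltoFun (ZMod 2) W (ZMod 2) (ZMod 2) ∘ f ∘ c := by
    funext i w
    change w.1 i (c i).2 = w.1 (c i).1 (c i).2
    rw [h1]
  rw [← h3] at h2
  exact h2

/-! ### Linear forms on the lifted space -/

section Forms

variable {n b : ℕ}

theorem pairing_comm (l x : BlockVec (Fin n) b) : pairing l x = pairing x l := by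
  simp only [pairing, mul_comm]

theorem pairing_add_right (l x y : BlockVec (Fin n) b) :
    pairing l (x + y) = pairing l x + pairing l y := by
  simp only [pairing, Pi.add_apply, mul_add, Finset.sum_add_distrib]

theorem pairing_smul_right (c : ZMod 2) (l x : BlockVec (Fin n) b) :
    pairing l (c • x) = c * pairing l x := by
  simp only [pairing, Pi.smul_apply, smul_eq_mul, Finset.mul_sum]
  exact Finset.sum_congr rfl fun i _ => Finset.sum_congr rfl fun j _ => by ring

theorem pairing_add_left (l l' x : BlockVec (Fin n) b) :
    pairing (l + l') x = pairing l x + pairing l' x := by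
  simp only [pairing_comm _ x, pairing_add_right]

theorem pairing_smul_left (c : ZMod 2) (l x : BlockVec (Fin n) b) :
    pairing (c • l) x = c * pairing l x := by
  simp only [pairing_comm _ x, pairing_smul_right]

theorem pairing_zero_left (x : BlockVec (Fin n) b) : pairing 0 x = 0 := by
  simp [pairing]

theorem pairing_sub_right (l x y : BlockVec (Fin n) b) :
    pairing l (x - y) = pairing l x - pairing l y := by
  have h := pairing_add_right l (x - y) y
  rw [sub_add_cancel] at h
  rw [h, add_sub_cancel_right]

/-- A separating functional is the pairing with the vector of its values on the standard basis. -/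
theorem exists_pairing_ne_zero {W : Submodule (ZMod 2) (BlockVec (Fin n) b)}
    {l : BlockVec (Fin n) b} (hl : l ∉ W) : ∃ d, (∀ w ∈ W, pairing w d = 0) ∧ pairing l d ≠ 0 := by
  obtain ⟨f, hfl, hW⟩ := Submodule.exists_le_ker_of_notMem hl
  have hf : ∀ w, pairing w (fun i j => f (Pi.single i (Pi.single j 1))) = f w := by
    intro w
    have h1 : w = ∑ i, ∑ j, w i j • (Pi.single i (Pi.single j 1) : BlockVec (Fin n) b) := by
      funext i j
      simp only [Finset.sum_apply, Pi.smul_apply, smul_eq_mul]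
      rw [Finset.sum_eq_single i, Finset.sum_eq_single j]
      · simp
      · intro j' _ hj'
        simp [hj'.symm]
      · simp
      · intro i' _ hi'
        refine Finset.sum_eq_zero fun j' _ => ?_
        rw [Pi.single_eq_of_ne hi'.symm]
        simp
      · simp
    conv_rhs => rw [h1]
    simp only [pairing, map_sum, map_smul, smul_eq_mul]
  refine ⟨fun i j => f (Pi.single i (Pi.single j 1)), fun w hw => ?_, ?_⟩
  · rw [hf]
    exact hW hw
  · rwa [hf]

/-- `definingForms` as a subspace. -/
def formsOf (A : AffSpace n b) : Submodule (ZMod 2) (BlockVec (Fin n) b) where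
  carrier := definingForms A
  add_mem' := by
    rintro l l' ⟨c, hc⟩ ⟨c', hc'⟩
    exact ⟨c + c', fun x hx => by rw [pairing_add_left, hc x hx, hc' x hx]⟩
  zero_mem' := ⟨0, fun x _ => pairing_zero_left x⟩
  smul_mem' := by
    rintro a l ⟨c, hc⟩
    exact ⟨a * c, fun x hx => by rw [pairing_smul_left, hc x hx]⟩

theorem mem_formsOf {A : AffSpace n b} {x₀ : BlockVec (Fin n) b} (hx₀ : x₀ ∈ A)
    {l : BlockVec (Fin n) b} : l ∈ formsOf A ↔ ∀ x ∈ A, pairing l x = pairing l x₀ := by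
  constructor
  · rintro ⟨c, hc⟩ x hx
    rw [hc x hx, hc x₀ hx₀]
  · intro h
    exact ⟨_, h⟩

theorem formsOf_anti {A B : AffSpace n b} (h : A ≤ B) : formsOf B ≤ formsOf A := by
  rintro l ⟨c, hc⟩
  exact ⟨c, fun x hx => hc x (h hx)⟩

/-- Double annihilator: a difference outside the direction of A would be detected by a form
vanishing on the direction, that is, by a form constant on A. -/
theorem mem_of_forall_formsOf {A : AffSpace n b} {x x₀ : BlockVec (Fin n) b} (hx₀ : x₀ ∈ A)
    (h : ∀ l ∈ formsOf A, pairing l x = pairing l x₀) : x ∈ A := by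
  by_contra hx
  have h1 : x - x₀ ∉ A.direction := by
    intro h2
    apply hx
    have := AffineSubspace.vadd_mem_of_mem_direction h2 hx₀
    simpa using this
  obtain ⟨d, hd, hne⟩ := exists_pairing_ne_zero h1
  apply hne
  have hdA : d ∈ formsOf A := by
    rw [mem_formsOf hx₀]
    intro x' hx'
    have h3 := hd _ (AffineSubspace.vsub_mem_direction hx' hx₀)
    rw [vsub_eq_sub, pairing_comm, pairing_sub_right] at h3
    exact sub_eq_zero.1 h3
  rw [pairing_comm, pairing_sub_right, h d hdA, sub_self]

theorem mem_formsOf_iff_of_mem {A : AffSpace n b} {x x₀ : BlockVec (Fin n) b} (hx₀ : x₀ ∈ A) :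
    x ∈ A ↔ ∀ l ∈ formsOf A, pairing l x = pairing l x₀ :=
  ⟨fun h _ hl => (mem_formsOf hx₀).1 hl x h, mem_of_forall_formsOf hx₀⟩

/-- A subspace of forms whose annihilator, translated to `x₀`, stays in `A` contains all
forms constant on `A`. -/
theorem formsOf_le {A : AffSpace n b} {x₀ : BlockVec (Fin n) b} (hx₀ : x₀ ∈ A)
    {W : Submodule (ZMod 2) (BlockVec (Fin n) b)}
    (h : ∀ d, (∀ w ∈ W, pairing w d = 0) → x₀ + d ∈ A) : formsOf A ≤ W := by
  intro l hl
  by_contra hlW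
  obtain ⟨d, hd, hne⟩ := exists_pairing_ne_zero hlW
  apply hne
  have h1 := (mem_formsOf hx₀).1 hl _ (h d hd)
  rw [pairing_add_right] at h1
  exact add_eq_left.1 h1

theorem formsOf_inf_consistentSpace_le {A : AffSpace n b} {S : Finset (Fin n)}
    {y : BlockVec S b} {x₀ : BlockVec (Fin n) b} (hx₀ : x₀ ∈ A) (hy : x₀ ∈ consistentSpace y) :
    formsOf (A ⊓ consistentSpace y) ≤ formsOf A ⊔ supportedOn b S := by
  have hxy : x₀ ∈ A ⊓ consistentSpace y := ⟨hx₀, hy⟩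
  refine formsOf_le hxy fun d hd => ⟨?_, ?_⟩
  · refine mem_of_forall_formsOf hx₀ fun l hl => ?_
    rw [pairing_add_right, hd l (Submodule.mem_sup_left hl), add_zero]
  · intro i
    have h0 : ∀ j, d i j = 0 := by
      intro j
      have h1 := hd (Pi.single i (Pi.single j 1)) (Submodule.mem_sup_right
        (mem_supportedOn.2 fun i' hi' =>
          Pi.single_eq_of_ne (fun h => hi' (by rw [h]; exact i.2)) _))
      rw [pairing, Finset.sum_eq_single (i : Fin n), Finset.sum_eq_single j] at h1
      · simpa using h1
      · intro j' _ hj'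
        simp [hj']
      · simp
      · intro i' _ hi'
        refine Finset.sum_eq_zero fun j' _ => ?_
        rw [Pi.single_eq_of_ne hi']
        simp
      · simp
    have h2 : d i = 0 := funext h0
    rw [Pi.add_apply, h2, add_zero]
    exact hy i

/-- The affine space of all `x` with `⟨l, x⟩ = c`. -/
def levelSpace (l : BlockVec (Fin n) b) (c : ZMod 2) : AffSpace n b where
  carrier := {x | pairing l x = c}
  smul_vsub_vadd_mem' a p₁ p₂ p₃ h₁ h₂ h₃ := by
    change pairing l (a • (p₁ - p₂) + p₃) = c
    rw [pairing_add_right, pairing_smul_right, pairing_sub_right, h₁, h₂, h₃, sub_self,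
      mul_zero, zero_add]

theorem formsOf_inf_levelSpace_le {A : AffSpace n b} {l : BlockVec (Fin n) b} {c : ZMod 2}
    {x₀ : BlockVec (Fin n) b} (hx₀ : x₀ ∈ A ⊓ levelSpace l c) :
    formsOf (A ⊓ levelSpace l c) ≤ formsOf A ⊔ Submodule.span (ZMod 2) {l} := by
  refine formsOf_le hx₀ fun d hd => ⟨?_, ?_⟩
  · refine mem_of_forall_formsOf hx₀.1 fun l hl => ?_
    rw [pairing_add_right, hd l (Submodule.mem_sup_left hl), add_zero]
  · have h1 := hd l (Submodule.mem_sup_right (Submodule.mem_span_singleton_self l))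
    change pairing l (x₀ + d) = c
    rw [pairing_add_right, h1, add_zero]
    exact hx₀.2

/-- Two non-empty level sets of l in A are translates of each other, so the same forms are constant
on both. Hence the two answers to a query lead to the same closure. -/
theorem formsOf_inf_levelSpace_le_of_mem {A : AffSpace n b} {l : BlockVec (Fin n) b}
    {c c' : ZMod 2} {x₀ x₁ : BlockVec (Fin n) b} (hx₀ : x₀ ∈ A ⊓ levelSpace l c)
    (hx₁ : x₁ ∈ A ⊓ levelSpace l c') :
    formsOf (A ⊓ levelSpace l c) ≤ formsOf (A ⊓ levelSpace l c') := by
  intro m hm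
  rw [mem_formsOf hx₁]
  intro x hx
  have h1 : x - x₁ + x₀ ∈ A ⊓ levelSpace l c := by
    refine ⟨?_, ?_⟩
    · have := A.smul_vsub_vadd_mem' 1 hx.1 hx₁.1 hx₀.1
      simpa using this
    · change pairing l (x - x₁ + x₀) = c
      have h2 : pairing l x = c' := hx.2
      have h3 : pairing l x₁ = c' := hx₁.2
      have h4 : pairing l x₀ = c := hx₀.2
      rw [pairing_add_right, pairing_sub_right, h2, h3, h4, sub_self, zero_add]
  have h5 := (mem_formsOf hx₀).1 hm _ h1
  rw [pairing_add_right, pairing_sub_right] at h5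
  exact sub_eq_zero.1 (add_eq_right.1 h5)

theorem closureBlocks_eq (A : AffSpace n b) :
    closureBlocks A = vecClosure (formsOf A : Set (BlockVec (Fin n) b)) :=
  rfl

theorem isDeviolator_closureBlocks (A : AffSpace n b) :
    IsDeviolator (formsOf A : Set (BlockVec (Fin n) b)) (closureBlocks A) :=
  isDeviolator_vecClosure _

theorem closureBlocks_mono {A B : AffSpace n b} (h : A ≤ B) :
    closureBlocks B ⊆ closureBlocks A :=
  vecClosure_mono (W := formsOf B) (W' := formsOf A) (formsOf_anti h)

theorem closureBlocks_inf_consistentSpace {A : AffSpace n b} {y : BlockVec (closureBlocks A) b}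
    (h : ∃ x ∈ A, x ∈ consistentSpace y) :
    closureBlocks (A ⊓ consistentSpace y) = closureBlocks A := by
  obtain ⟨x, hx, hy⟩ := h
  apply Finset.Subset.antisymm
  · exact vecClosure_subset (W := formsOf (A ⊓ consistentSpace y))
      (isDeviolator_of_le_sup_supportedOn (isDeviolator_closureBlocks A)
        (formsOf_inf_consistentSpace_le hx hy))
  · exact closureBlocks_mono inf_le_left

theorem closureRank_inf_consistentSpace_le {A : AffSpace n b}
    {y : BlockVec (closureBlocks A) b} (h : ∃ x ∈ A, x ∈ consistentSpace y) :
    closureRank (formsOf (A ⊓ consistentSpace y)) ≤ (amortizedClosure A).card := by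
  obtain ⟨x, hx, hy⟩ := h
  exact (closureRank_le_of_le_sup_supportedOn (W := formsOf A)
    (formsOf_inf_consistentSpace_le hx hy)).trans
      (closureRank_le_card_vecAmortizedClosure (formsOf A))

theorem closureRank_inf_levelSpace_le {A : AffSpace n b} {l : BlockVec (Fin n) b} {c : ZMod 2}
    {x₀ : BlockVec (Fin n) b} (hx₀ : x₀ ∈ A ⊓ levelSpace l c) :
    closureRank (formsOf (A ⊓ levelSpace l c)) ≤ closureRank (formsOf A) + 1 :=
  closureRank_le_add_one (formsOf_inf_levelSpace_le hx₀)

theorem closureBlocks_inf_levelSpace_eq {A : AffSpace n b} {l : BlockVec (Fin n) b}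
    {c c' : ZMod 2} {x₀ x₁ : BlockVec (Fin n) b} (hx₀ : x₀ ∈ A ⊓ levelSpace l c)
    (hx₁ : x₁ ∈ A ⊓ levelSpace l c') :
    closureBlocks (A ⊓ levelSpace l c) = closureBlocks (A ⊓ levelSpace l c') := by
  have h : formsOf (A ⊓ levelSpace l c) = formsOf (A ⊓ levelSpace l c') :=
    le_antisymm (formsOf_inf_levelSpace_le_of_mem hx₀ hx₁)
      (formsOf_inf_levelSpace_le_of_mem hx₁ hx₀)
  rw [closureBlocks_eq, closureBlocks_eq, h]

theorem PDT.mem_pathSpace {T : PDT n b} {x x' : BlockVec (Fin n) b} :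
    x' ∈ T.pathSpace x ↔ ∀ m ∈ T.queries x, pairing m x' = pairing m x :=
  Iff.rfl

theorem mem_levelSpace {l x : BlockVec (Fin n) b} {c : ZMod 2} :
    x ∈ levelSpace l c ↔ pairing l x = c :=
  Iff.rfl

theorem PDT.pathSpace_query_zero {l x : BlockVec (Fin n) b} {T₀ T₁ : PDT n b}
    (h : pairing l x = 0) :
    (PDT.query l T₀ T₁).pathSpace x = levelSpace l 0 ⊓ T₀.pathSpace x := by
  refine SetLike.ext fun x' => ?_
  rw [AffineSubspace.mem_inf_iff, PDT.mem_pathSpace, PDT.mem_pathSpace, mem_levelSpace,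
    PDT.queries, if_pos h, List.forall_mem_cons, h]

theorem PDT.pathSpace_query_one {l x : BlockVec (Fin n) b} {T₀ T₁ : PDT n b}
    (h : pairing l x = 1) :
    (PDT.query l T₀ T₁).pathSpace x = levelSpace l 1 ⊓ T₁.pathSpace x := by
  refine SetLike.ext fun x' => ?_
  rw [AffineSubspace.mem_inf_iff, PDT.mem_pathSpace, PDT.mem_pathSpace, mem_levelSpace,
    PDT.queries, if_neg (by rw [h]; decide), List.forall_mem_cons, h]

theorem PDT.pathSpace_leaf (x : BlockVec (Fin n) b) : (PDT.leaf : PDT n b).pathSpace x = ⊤ := by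
  refine SetLike.ext fun x' => ?_
  rw [PDT.mem_pathSpace]
  simp [PDT.queries]

end Forms

/-! ### Signs and Fourier coefficients -/

section Fourier

/-- The sign `(-1)^a` of an element of `𝔽₂`. -/
def signOf (a : ZMod 2) : ℝ := (-1) ^ a.val

theorem ZMod.two_cases (a : ZMod 2) : a = 0 ∨ a = 1 := by
  revert a; decide

theorem signOf_zero : signOf 0 = 1 := by simp [signOf]

theorem signOf_one : signOf 1 = -1 := by
  simp [signOf, ZMod.val_one]

theorem signOf_add (a c : ZMod 2) : signOf (a + c) = signOf a * signOf c := by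
  have h : (1 + 1 : ZMod 2) = 0 := by decide
  rcases a.two_cases with rfl | rfl <;> rcases c.two_cases with rfl | rfl <;>
    simp [signOf_zero, signOf_one, h]

theorem abs_signOf (a : ZMod 2) : |signOf a| = 1 := by
  rcases a.two_cases with rfl | rfl <;> simp [signOf_zero, signOf_one]

theorem signOf_sum {ι : Type*} (s : Finset ι) (f : ι → ZMod 2) :
    signOf (∑ i ∈ s, f i) = ∏ i ∈ s, signOf (f i) := by
  induction s using Finset.induction_on with
  | empty => simp [signOf_zero]
  | insert a s ha ih => rw [Finset.sum_insert ha, Finset.prod_insert ha, signOf_add, ih]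

variable {b : ℕ}

theorem dotProduct_add_single (u a : Fin b → ZMod 2) (j : Fin b) :
    u ⬝ᵥ (a + Pi.single j 1) = u ⬝ᵥ a + u j := by
  rw [dotProduct_add, dotProduct_single, mul_one]

theorem sum_signOf_dotProduct (u : Fin b → ZMod 2) :
    ∑ a : Fin b → ZMod 2, signOf (u ⬝ᵥ a) = if u = 0 then 2 ^ b else 0 := by
  split_ifs with h
  · subst h
    simp [signOf_zero, ZMod.card]
  · obtain ⟨j, hj⟩ : ∃ j, u j ≠ 0 := by
      by_contra hcon
      push Not at hcon
      exact h (funext hcon)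
    have hj1 : u j = 1 := (u j).two_cases.resolve_left hj
    have h1 := Equiv.sum_comp (Equiv.addRight (Pi.single j 1 : Fin b → ZMod 2))
      (fun a => signOf (u ⬝ᵥ a))
    simp only [Equiv.coe_addRight, dotProduct_add_single, hj1, signOf_add, signOf_one,
      mul_neg, mul_one, Finset.sum_neg_distrib] at h1
    linarith

/-- The Fourier coefficient of the gadget, indexed by a vector. -/
def gadgetHat (g : (Fin b → ZMod 2) → ZMod 2) (u : Fin b → ZMod 2) : ℝ :=
  (∑ a, signOf (g a) * signOf (u ⬝ᵥ a)) / 2 ^ b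

theorem gadgetHat_eq (g : (Fin b → ZMod 2) → ZMod 2) (u : Fin b → ZMod 2) :
    gadgetHat g u = gadgetFourierCoeff g {j | u j = 1} := by
  unfold gadgetHat gadgetFourierCoeff
  congr 1
  refine Finset.sum_congr rfl fun a _ => ?_
  have h : ∑ i with u i = 1, a i = u ⬝ᵥ a := by
    rw [Finset.sum_filter, dotProduct]
    refine Finset.sum_congr rfl fun i _ => ?_
    rcases (u i).two_cases with h | h <;> simp [h]
  rw [h]
  rfl

/-- The indicator of g(a) = c is half of 1 + (-1)^(c + g(a)). -/
theorem sum_fiber_signOf (g : (Fin b → ZMod 2) → ZMod 2) (u : Fin b → ZMod 2) (c : ZMod 2) :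
    ∑ a with g a = c, signOf (u ⬝ᵥ a)
      = 2 ^ b / 2 * ((if u = 0 then 1 else 0) + signOf c * gadgetHat g u) := by
  have h1 : ∀ a, (if g a = c then signOf (u ⬝ᵥ a) else 0)
      = (signOf (u ⬝ᵥ a) + signOf c * (signOf (g a) * signOf (u ⬝ᵥ a))) / 2 := by
    intro a
    have h01 : (0 : ZMod 2) ≠ 1 := by decide
    rcases (g a).two_cases with h | h <;> rcases c.two_cases with rfl | rfl <;>
      simp [h, signOf_zero, signOf_one, h01]
  rw [Finset.sum_filter, Finset.sum_congr rfl fun a _ => h1 a, ← Finset.sum_div,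
    Finset.sum_add_distrib, sum_signOf_dotProduct, ← Finset.mul_sum, gadgetHat]
  have h2 : (2 : ℝ) ^ b ≠ 0 := by positivity
  split_ifs <;> (field_simp; try ring)

end Fourier

/-! ### Equidistribution of the gadget values on safe affine spaces -/

section Equidistribution

theorem abs_prod_one_add_sub_one_le {ι : Type*} (s : Finset ι) (f : ι → ℝ) {δ : ℝ} (hδ : 0 ≤ δ)
    (hf : ∀ i ∈ s, |f i - 1| ≤ δ) : |∏ i ∈ s, f i - 1| ≤ (1 + δ) ^ s.card - 1 := by
  induction s using Finset.induction_on with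
  | empty => simp
  | insert a s ha ih =>
    rw [Finset.prod_insert ha, Finset.card_insert_of_notMem ha]
    have h1 := ih fun i hi => hf i (Finset.mem_insert_of_mem hi)
    have h2 := hf a (Finset.mem_insert_self _ _)
    have h3 : f a * ∏ i ∈ s, f i - 1
        = (f a - 1) * (∏ i ∈ s, f i - 1) + (f a - 1) + (∏ i ∈ s, f i - 1) := by ring
    rw [h3]
    calc _ ≤ |(f a - 1) * (∏ i ∈ s, f i - 1)| + |f a - 1| + |∏ i ∈ s, f i - 1| :=
          (abs_add_le _ _).trans (add_le_add_left (abs_add_le _ _) _)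
      _ ≤ δ * ((1 + δ) ^ s.card - 1) + δ + ((1 + δ) ^ s.card - 1) := by
          rw [abs_mul]
          gcongr
      _ = _ := by ring

variable {n b : ℕ}

theorem pairing_eq_sum_dotProduct (l x : BlockVec (Fin n) b) :
    pairing l x = ∑ i, l i ⬝ᵥ x i := rfl

theorem sum_signOf_pairing (W : Submodule (ZMod 2) (BlockVec (Fin n) b))
    (z : BlockVec (Fin n) b) :
    ∑ w : W, signOf (pairing w z)
      = if ∀ w ∈ W, pairing w z = 0 then (Fintype.card W : ℝ) else 0 := by
  split_ifs with h
  · rw [Finset.sum_congr rfl fun w _ => by rw [h w w.2, signOf_zero]]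
    simp
  · push Not at h
    obtain ⟨w₀, hw₀, hne⟩ := h
    have h1 : pairing w₀ z = 1 := (ZMod.two_cases _).resolve_left hne
    have h2 := Equiv.sum_comp (Equiv.addRight (⟨w₀, hw₀⟩ : W)) (fun w => signOf (pairing w z))
    simp only [Equiv.coe_addRight, Submodule.coe_add, pairing_add_left, h1, signOf_add,
      signOf_one, mul_neg, mul_one, Finset.sum_neg_distrib] at h2
    linarith

theorem card_inf_supportedOn (W : Submodule (ZMod 2) (BlockVec (Fin n) b))
    (S : Finset (Fin n)) :
    (Finset.univ.filter fun w : W => (w : BlockVec (Fin n) b) ∈ supportedOn b S).card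
      = 2 ^ blockRank W S := by
  have h := Module.card_eq_pow_finrank (K := ZMod 2)
    (V := (W ⊓ supportedOn b S : Submodule (ZMod 2) (BlockVec (Fin n) b)))
  rw [ZMod.card] at h
  rw [blockRank, ← h, ← Fintype.card_subtype]
  exact Fintype.card_congr
    { toFun := fun w => ⟨w.1.1, w.1.2, w.2⟩
      invFun := fun w => ⟨⟨w.1, w.2.1⟩, w.2.2⟩
      left_inv := fun _ => rfl
      right_inv := fun _ => rfl }

/-- The points of `B` that agree with `x₀` on the blocks in `S` and have gadget values `ζ`. -/
def fiberIn (g : (Fin b → ZMod 2) → ZMod 2) (B : AffSpace n b) (S : Finset (Fin n))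
    (x₀ : BlockVec (Fin n) b) (ζ : Fin n → ZMod 2) : Finset (BlockVec (Fin n) b) :=
  {x | x ∈ B ∧ (∀ i ∈ S, x i = x₀ i) ∧ ∀ i, g (x i) = ζ i}

/-- Membership in B is the average of the characters given by the forms constant on B. For each form
the sum over x factors over blocks; the blocks in S are pinned to x₀ and contribute 1. -/
theorem card_fiberIn_mul_card (g : (Fin b → ZMod 2) → ZMod 2) (B : AffSpace n b)
    (S : Finset (Fin n)) {x₀ : BlockVec (Fin n) b} (hx₀ : x₀ ∈ B) (ζ : Fin n → ZMod 2)
    (hζ : ∀ i ∈ S, g (x₀ i) = ζ i) :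
    ((fiberIn g B S x₀ ζ).card : ℝ) * Fintype.card (formsOf B)
      = ∑ w : formsOf B, (2 ^ b / 2 : ℝ) ^ Sᶜ.card * ∏ i ∈ Sᶜ,
        (signOf (w.1 i ⬝ᵥ x₀ i) * ((if w.1 i = 0 then 1 else 0)
          + signOf (ζ i) * gadgetHat g (w.1 i))) := by
  let R : Fin n → Finset (Fin b → ZMod 2) := fun i =>
    if i ∈ S then {x₀ i} else Finset.univ.filter fun a => g a = ζ i
  have h1 : fiberIn g B S x₀ ζ = (Fintype.piFinset R).filter
      fun x => ∀ w ∈ formsOf B, pairing w (x - x₀) = 0 := by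
    ext x
    simp only [fiberIn, Finset.mem_filter, Finset.mem_univ, true_and, Fintype.mem_piFinset]
    rw [mem_formsOf_iff_of_mem hx₀, and_comm]
    refine and_congr ⟨?_, ?_⟩ ?_
    · rintro ⟨h1, h2⟩ i
      by_cases hi : i ∈ S
      · simp [R, hi, h1 i hi]
      · simp [R, hi, h2 i]
    · intro h
      have hS : ∀ i ∈ S, x i = x₀ i := fun i hi => by simpa [R, hi] using h i
      refine ⟨hS, fun i => ?_⟩
      by_cases hi : i ∈ S
      · rw [hS i hi, hζ i hi]
      · simpa [R, hi] using h i
    · simp only [pairing_sub_right, sub_eq_zero]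
  rw [h1, Finset.card_filter, Nat.cast_sum, Finset.sum_mul]
  have h2 : ∀ x : BlockVec (Fin n) b,
      ((if ∀ w ∈ formsOf B, pairing w (x - x₀) = 0 then 1 else 0 : ℕ) : ℝ)
        * Fintype.card (formsOf B) = ∑ w : formsOf B, signOf (pairing w (x - x₀)) := by
    intro x
    rw [sum_signOf_pairing]
    split_ifs <;> simp
  rw [Finset.sum_congr rfl fun x _ => h2 x, Finset.sum_comm]
  refine Finset.sum_congr rfl fun w _ => ?_
  have h3 : ∀ x : BlockVec (Fin n) b, signOf (pairing (w : BlockVec (Fin n) b) (x - x₀))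
      = ∏ i, signOf (w.1 i ⬝ᵥ (x i - x₀ i)) := fun x => by
    rw [pairing_eq_sum_dotProduct, signOf_sum]; rfl
  rw [Finset.sum_congr rfl fun x _ => h3 x,
    ← Finset.prod_univ_sum R (fun i a => signOf (w.1 i ⬝ᵥ (a - x₀ i))),
    ← Finset.prod_mul_prod_compl S]
  have h4 : ∏ i ∈ S, ∑ a ∈ R i, signOf (w.1 i ⬝ᵥ (a - x₀ i)) = 1 := by
    refine Finset.prod_eq_one fun i hi => ?_
    simp [R, hi, signOf_zero]
  rw [h4, one_mul, ← Finset.prod_const, ← Finset.prod_mul_distrib]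
  refine Finset.prod_congr rfl fun i hi => ?_
  rw [Finset.mem_compl] at hi
  have h5 : ∀ a, signOf (w.1 i ⬝ᵥ (a - x₀ i)) = signOf (w.1 i ⬝ᵥ x₀ i) * signOf (w.1 i ⬝ᵥ a) := by
    intro a
    rw [← signOf_add, dotProduct_sub, sub_eq_add_neg, ZMod.neg_eq_self_mod_two, add_comm]
  simp only [R, hi, if_false]
  rw [Finset.sum_congr rfl fun a _ => h5 a, ← Finset.mul_sum, sum_fiber_signOf]
  ring

/-- In the Fourier expansion the forms supported on S give the main term. A form meeting the blocks
t outside S contributes at most δ^|t| (1 + δ)^(k − |t|) in relative size, and safety leaves at most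
2^(r(S) + |t|) such forms, so the union over all t stays small. -/
theorem IsDeviolator.exists_abs_card_fiberIn_sub_le {g : (Fin b → ZMod 2) → ZMod 2} {δ : ℝ}
    (hδ : 0 ≤ δ) (hg : ∀ u, |gadgetHat g u| ≤ δ) {B : AffSpace n b} {S : Finset (Fin n)}
    (hS : IsDeviolator (formsOf B : Set (BlockVec (Fin n) b)) S)
    {x₀ : BlockVec (Fin n) b} (hx₀ : x₀ ∈ B) :
    ∃ M : ℝ, 0 < M ∧ ∀ ζ : Fin n → ZMod 2, (∀ i ∈ S, g (x₀ i) = ζ i) →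
      |((fiberIn g B S x₀ ζ).card : ℝ) - M| ≤ ((1 + 3 * δ) ^ n - 1) * M := by
  set W := formsOf B with hW
  set k := Sᶜ.card with hk
  have hWpos : (0 : ℝ) < Fintype.card W := by exact_mod_cast Fintype.card_pos
  have hbpos : (0 : ℝ) < 2 ^ b / 2 := by positivity
  -- The contribution of the 2^r(S) forms supported on S, each counted with product 1. It does not
  -- depend on ζ.
  refine ⟨(2 ^ b / 2) ^ k * 2 ^ blockRank W S / Fintype.card W, by positivity, fun ζ hζ => ?_⟩
  let T : W → Finset (Fin n) := fun w => Sᶜ.filter fun i => w.1 i ≠ 0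
  let P : W → ℝ := fun w => ∏ i ∈ Sᶜ, (signOf (w.1 i ⬝ᵥ x₀ i) *
    ((if w.1 i = 0 then 1 else 0) + signOf (ζ i) * gadgetHat g (w.1 i)))
  have hsmall : ∀ i (u : Fin b → ZMod 2), |signOf (ζ i) * gadgetHat g u| ≤ δ := fun i u => by
    rw [abs_mul, abs_signOf, one_mul]; exact hg u
  have hP : ∀ w, |P w - if T w = ∅ then 1 else 0|
      ≤ δ ^ (T w).card * (1 + δ) ^ (k - (T w).card) - if T w = ∅ then 1 else 0 := by
    intro w
    split_ifs with hT
    · rw [hT, Finset.card_empty, pow_zero, one_mul, Nat.sub_zero]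
      refine abs_prod_one_add_sub_one_le _ _ hδ fun i hi => ?_
      have hi0 : w.1 i = 0 := by
        by_contra h
        have : i ∈ T w := Finset.mem_filter.2 ⟨hi, h⟩
        rw [hT] at this
        exact absurd this (Finset.notMem_empty _)
      rw [hi0, zero_dotProduct, signOf_zero, one_mul, if_pos rfl, add_sub_cancel_left]
      exact hsmall i 0
    · rw [sub_zero, sub_zero, Finset.abs_prod,
        ← Finset.prod_sdiff (Finset.filter_subset (fun i => w.1 i ≠ 0) Sᶜ), mul_comm]
      have hc : (Sᶜ \ T w).card = k - (T w).card :=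
        Finset.card_sdiff_of_subset (Finset.filter_subset _ _)
      rw [← hc]
      refine mul_le_mul ?_ ?_ (Finset.prod_nonneg fun _ _ => abs_nonneg _) (by positivity)
      · refine (Finset.prod_le_prod (fun _ _ => abs_nonneg _) fun i hi => ?_).trans_eq
          (Finset.prod_const _)
        rw [Finset.mem_filter] at hi
        rw [abs_mul, abs_signOf, one_mul, if_neg hi.2, zero_add]
        exact hsmall _ _
      · refine (Finset.prod_le_prod (fun _ _ => abs_nonneg _) fun i hi => ?_).trans_eq
          (Finset.prod_const _)
        rw [abs_mul, abs_signOf, one_mul]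
        refine (abs_add_le _ _).trans (add_le_add ?_ (hsmall _ _))
        split_ifs <;> simp
  have hTcard : ∀ t ∈ Sᶜ.powerset,
      ((Finset.univ.filter fun w : W => T w = t).card : ℝ) ≤ 2 ^ blockRank W S * 2 ^ t.card := by
    intro t ht
    rw [Finset.mem_powerset] at ht
    have hdisj : Disjoint S t := by
      rw [Finset.disjoint_right]
      exact fun i hi => Finset.mem_compl.1 (ht hi)
    have h1 := hS.blockRank_le (Finset.subset_union_left : S ⊆ S ∪ t)
    rw [Finset.card_union_of_disjoint hdisj] at h1
    have h2 : (Finset.univ.filter fun w : W => T w = t).card ≤ 2 ^ blockRank W (S ∪ t) := by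
      rw [← card_inf_supportedOn]
      refine Finset.card_le_card fun w hw => ?_
      simp only [Finset.mem_filter, Finset.mem_univ, true_and] at hw ⊢
      rw [mem_supportedOn]
      intro i hi
      rw [Finset.mem_union, not_or] at hi
      by_contra h
      exact hi.2 (hw ▸ Finset.mem_filter.2 ⟨Finset.mem_compl.2 hi.1, h⟩)
    rw [← pow_add]
    calc ((Finset.univ.filter fun w : W => T w = t).card : ℝ) ≤ (2 : ℝ) ^ blockRank W (S ∪ t) := by
          exact_mod_cast h2
      _ ≤ _ := pow_le_pow_right₀ (by norm_num) (by omega)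
  have hT0 : ((Finset.univ.filter fun w : W => T w = ∅).card : ℝ) = 2 ^ blockRank W S := by
    have h2 := card_inf_supportedOn W S
    have h3 : (Finset.univ.filter fun w : W => T w = ∅)
        = Finset.univ.filter fun w : W => (w : BlockVec (Fin n) b) ∈ supportedOn b S := by
      ext w
      simp only [Finset.mem_filter, Finset.mem_univ, true_and]
      rw [mem_supportedOn, Finset.filter_eq_empty_iff]
      simp only [Finset.mem_compl, not_not]
    rw [h3, h2]
    push_cast
    rfl
  have hind : ∑ w : W, (if T w = ∅ then (1 : ℝ) else 0) = 2 ^ blockRank W S := by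
    rw [← hT0, Finset.card_filter]
    push_cast
    rfl
  have hsum : |∑ w : W, P w - 2 ^ blockRank W S|
      ≤ 2 ^ blockRank W S * ((1 + 3 * δ) ^ k - 1) := by
    have h1 : ∑ w : W, δ ^ (T w).card * (1 + δ) ^ (k - (T w).card)
        ≤ 2 ^ blockRank W S * (1 + 3 * δ) ^ k := by
      rw [← Finset.sum_fiberwise_of_maps_to (s := Finset.univ) (t := Sᶜ.powerset) (g := T)
        (fun w _ => Finset.mem_powerset.2 (Finset.filter_subset _ _))]
      -- The factor 2^|t| from counting forms turns δ into 2δ, and the binomial theorem gives 2δ +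
      -- (1 + δ) = 1 + 3δ.
      have h3 : (1 + 3 * δ) ^ k = ∑ t ∈ Sᶜ.powerset, (2 * δ) ^ t.card * (1 + δ) ^ (k - t.card) := by
        rw [Finset.sum_pow_mul_eq_add_pow]
        congr 1
        ring
      rw [h3, Finset.mul_sum]
      refine Finset.sum_le_sum fun t ht => ?_
      rw [Finset.sum_congr rfl fun w hw => by rw [(Finset.mem_filter.1 hw).2], Finset.sum_const,
        nsmul_eq_mul]
      calc _ ≤ (2 ^ blockRank W S * 2 ^ t.card) * (δ ^ t.card * (1 + δ) ^ (k - t.card)) :=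
            mul_le_mul_of_nonneg_right (hTcard t ht) (by positivity)
        _ = _ := by rw [mul_pow]; ring
    calc |∑ w : W, P w - 2 ^ blockRank W S| = |∑ w : W, (P w - if T w = ∅ then 1 else 0)| := by
          rw [Finset.sum_sub_distrib, hind]
      _ ≤ ∑ w : W, |P w - if T w = ∅ then 1 else 0| := Finset.abs_sum_le_sum_abs _ _
      _ ≤ ∑ w : W, (δ ^ (T w).card * (1 + δ) ^ (k - (T w).card) - if T w = ∅ then 1 else 0) :=
          Finset.sum_le_sum fun w _ => hP w
      _ = ∑ w : W, δ ^ (T w).card * (1 + δ) ^ (k - (T w).card) - 2 ^ blockRank W S := by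
          rw [Finset.sum_sub_distrib, hind]
      _ ≤ _ := by linarith
  have hmain := card_fiberIn_mul_card g B S hx₀ ζ hζ
  rw [← Finset.mul_sum] at hmain
  have hN : ((fiberIn g B S x₀ ζ).card : ℝ)
      = (2 ^ b / 2) ^ k * (∑ w : W, P w) / Fintype.card W := by
    rw [eq_div_iff hWpos.ne']
    exact hmain
  rw [hN, ← sub_div, ← mul_sub, abs_div, abs_mul, abs_of_pos hWpos,
    abs_of_pos (pow_pos hbpos k), ← mul_div_assoc]
  refine div_le_div_of_nonneg_right ?_ hWpos.le
  calc _ ≤ (2 ^ b / 2) ^ k * (2 ^ blockRank W S * ((1 + 3 * δ) ^ k - 1)) :=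
        mul_le_mul_of_nonneg_left hsum (by positivity)
    _ = ((1 + 3 * δ) ^ k - 1) * ((2 ^ b / 2) ^ k * 2 ^ blockRank W S) := by ring
    _ ≤ _ := by
      refine mul_le_mul_of_nonneg_right (sub_le_sub_right ?_ _) (by positivity)
      refine pow_le_pow_right₀ (by linarith) ?_
      exact (Finset.card_le_univ _).trans (by simp)

end Equidistribution

/-! ### Resampling the gadget values outside a deviolator -/

section Resampling

variable {n b : ℕ}

/-- The gadget applied blockwise. -/
def gadgetMap (g : (Fin b → ZMod 2) → ZMod 2) (x : BlockVec (Fin n) b) : Fin n → ZMod 2 :=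
  fun i => g (x i)

/-- The assignments that agree with `z₀` on `S`. -/
def agreeOn (S : Finset (Fin n)) (z₀ : Fin n → ZMod 2) : Finset (Fin n → ZMod 2) :=
  {z | ∀ i ∈ S, z i = z₀ i}

theorem mem_agreeOn {S : Finset (Fin n)} {z₀ z : Fin n → ZMod 2} :
    z ∈ agreeOn S z₀ ↔ ∀ i ∈ S, z i = z₀ i := by
  simp [agreeOn]

theorem agreeOn_congr {S : Finset (Fin n)} {z z' : Fin n → ZMod 2} (h : ∀ i ∈ S, z i = z' i) :
    agreeOn S z = agreeOn S z' := by
  ext w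
  rw [mem_agreeOn, mem_agreeOn]
  exact forall₂_congr fun i hi => by rw [h i hi]

theorem card_agreeOn (S : Finset (Fin n)) (z₀ : Fin n → ZMod 2) :
    (agreeOn S z₀).card = 2 ^ Sᶜ.card := by
  have h : agreeOn S z₀ = Fintype.piFinset fun i => if i ∈ S then {z₀ i} else Finset.univ := by
    ext z
    rw [mem_agreeOn, Fintype.mem_piFinset]
    refine forall_congr' fun i => ?_
    by_cases hi : i ∈ S <;> simp [hi]
  rw [h, Fintype.card_piFinset, ← Finset.prod_mul_prod_compl S]
  rw [Finset.prod_eq_one fun i hi => by simp [hi], one_mul,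
    Finset.prod_congr rfl fun i hi => by
      rw [if_neg (Finset.mem_compl.1 hi), Finset.card_univ, ZMod.card]]
  simp

/-- The points of an affine space, as a finset. -/
def pointsOf (B : AffSpace n b) : Finset (BlockVec (Fin n) b) := {x | x ∈ B}

theorem mem_pointsOf {B : AffSpace n b} {x : BlockVec (Fin n) b} : x ∈ pointsOf B ↔ x ∈ B := by
  simp [pointsOf]

/-- B is cut into slices by the values on S. On a slice every admissible vector of gadget values has
between (2 − c)M and cM preimages, where c = (1 + 3δ)^n. The constant M may depend on the slice, but
it cancels because the size of the slice is controlled by the same bounds. -/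
theorem IsDeviolator.sum_agreeOn_bounds {g : (Fin b → ZMod 2) → ZMod 2} {δ : ℝ}
    (hδ : 0 ≤ δ) (hδ1 : (1 + 3 * δ) ^ n < 2) (hg : ∀ u, |gadgetHat g u| ≤ δ)
    {B : AffSpace n b} {S : Finset (Fin n)}
    (hS : IsDeviolator (formsOf B : Set (BlockVec (Fin n) b)) S)
    {h : (Fin n → ZMod 2) → ℝ} (hh : ∀ z, 0 ≤ h z) :
    (2 - (1 + 3 * δ) ^ n) * ∑ x ∈ pointsOf B, ∑ z ∈ agreeOn S (gadgetMap g x), h z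
      ≤ (1 + 3 * δ) ^ n * (2 ^ Sᶜ.card * ∑ x ∈ pointsOf B, h (gadgetMap g x)) ∧
    (2 - (1 + 3 * δ) ^ n) * (2 ^ Sᶜ.card * ∑ x ∈ pointsOf B, h (gadgetMap g x))
      ≤ (1 + 3 * δ) ^ n * ∑ x ∈ pointsOf B, ∑ z ∈ agreeOn S (gadgetMap g x), h z := by
  set c := (1 + 3 * δ) ^ n with hc
  have hc0 : 0 ≤ c := by positivity
  have key : ∀ y : BlockVec S b,
      (2 - c) * ∑ x ∈ pointsOf B with restrictBlocks x S = y, ∑ z ∈ agreeOn S (gadgetMap g x), h z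
        ≤ c * (2 ^ Sᶜ.card * ∑ x ∈ pointsOf B with restrictBlocks x S = y, h (gadgetMap g x)) ∧
      (2 - c) * (2 ^ Sᶜ.card * ∑ x ∈ pointsOf B with restrictBlocks x S = y, h (gadgetMap g x))
        ≤ c * ∑ x ∈ pointsOf B with restrictBlocks x S = y,
          ∑ z ∈ agreeOn S (gadgetMap g x), h z := by
    intro y
    rcases ((pointsOf B).filter fun x => restrictBlocks x S = y).eq_empty_or_nonempty with he | hne
    · simp [he]
    obtain ⟨x₀, hx₀⟩ := hne
    rw [Finset.mem_filter, mem_pointsOf] at hx₀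
    obtain ⟨hx₀, rfl⟩ := hx₀
    obtain ⟨M, hM, hbound⟩ := hS.exists_abs_card_fiberIn_sub_le hδ hg hx₀
    set C := (pointsOf B).filter fun x => restrictBlocks x S = restrictBlocks x₀ S with hC
    have hCS : ∀ x ∈ C, ∀ i ∈ S, x i = x₀ i := fun x hx i hi =>
      congrFun (Finset.mem_filter.1 hx).2 ⟨i, hi⟩
    have hagree : ∀ x ∈ C, agreeOn S (gadgetMap g x) = agreeOn S (gadgetMap g x₀) :=
      fun x hx => agreeOn_congr fun i hi => congrArg g (hCS x hx i hi)
    have hsum : ∀ f : (Fin n → ZMod 2) → ℝ, ∑ x ∈ C, f (gadgetMap g x)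
        = ∑ ζ ∈ agreeOn S (gadgetMap g x₀), ((fiberIn g B S x₀ ζ).card : ℝ) * f ζ := by
      intro f
      rw [← Finset.sum_fiberwise_of_maps_to (s := C) (t := agreeOn S (gadgetMap g x₀))
        (g := gadgetMap g) (fun x hx => mem_agreeOn.2 fun i hi => congrArg g (hCS x hx i hi))]
      refine Finset.sum_congr rfl fun ζ _ => ?_
      rw [Finset.sum_congr rfl fun x hx => by rw [(Finset.mem_filter.1 hx).2], Finset.sum_const,
        nsmul_eq_mul]
      congr 3
      ext x
      simp only [hC, fiberIn, Finset.mem_filter, Finset.mem_univ, true_and, mem_pointsOf, and_assoc]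
      refine and_congr_right fun _ => and_congr ?_ ?_
      · rw [funext_iff, Subtype.forall]; rfl
      · rw [funext_iff]; rfl
    have hlow : ∀ f : (Fin n → ZMod 2) → ℝ, (∀ z, 0 ≤ f z) →
        (2 - c) * M * ∑ ζ ∈ agreeOn S (gadgetMap g x₀), f ζ ≤ ∑ x ∈ C, f (gadgetMap g x) := by
      intro f hf
      rw [hsum, Finset.mul_sum]
      refine Finset.sum_le_sum fun ζ hζ => mul_le_mul_of_nonneg_right ?_ (hf ζ)
      have := (abs_le.1 (hbound ζ fun i hi => ((mem_agreeOn.1 hζ) i hi).symm)).1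
      linarith
    have hupp : ∀ f : (Fin n → ZMod 2) → ℝ, (∀ z, 0 ≤ f z) →
        ∑ x ∈ C, f (gadgetMap g x) ≤ c * M * ∑ ζ ∈ agreeOn S (gadgetMap g x₀), f ζ := by
      intro f hf
      rw [hsum, Finset.mul_sum]
      refine Finset.sum_le_sum fun ζ hζ => mul_le_mul_of_nonneg_right ?_ (hf ζ)
      have := (abs_le.1 (hbound ζ fun i hi => ((mem_agreeOn.1 hζ) i hi).symm)).2
      linarith
    set H := ∑ ζ ∈ agreeOn S (gadgetMap g x₀), h ζ with hH
    have hH0 : 0 ≤ H := Finset.sum_nonneg fun z _ => hh z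
    have h1 : ∑ x ∈ C, ∑ z ∈ agreeOn S (gadgetMap g x), h z = C.card * H := by
      rw [Finset.sum_congr rfl fun x hx => by rw [hagree x hx], Finset.sum_const, nsmul_eq_mul]
    -- The constant function 1 yields the bounds on the size of the slice.
    have hl1 := hlow (fun _ => 1) fun _ => zero_le_one
    have hu1 := hupp (fun _ => 1) fun _ => zero_le_one
    simp only [Finset.sum_const, nsmul_eq_mul, mul_one, card_agreeOn, Nat.cast_pow,
      Nat.cast_ofNat] at hl1 hu1
    have hl := hlow h hh
    have hu := hupp h hh
    rw [h1]
    have hc2 : 0 ≤ 2 - c := by linarith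
    constructor
    · calc (2 - c) * (C.card * H) ≤ (2 - c) * (c * M * 2 ^ Sᶜ.card * H) := by gcongr
        _ = c * (2 ^ Sᶜ.card * ((2 - c) * M * H)) := by ring
        _ ≤ _ := by gcongr
    · calc (2 - c) * (2 ^ Sᶜ.card * ∑ x ∈ C, h (gadgetMap g x))
          ≤ (2 - c) * (2 ^ Sᶜ.card * (c * M * H)) := by gcongr
        _ = c * ((2 - c) * M * 2 ^ Sᶜ.card * H) := by ring
        _ ≤ _ := by gcongr
  rw [← Finset.sum_fiberwise (pointsOf B) (fun x => restrictBlocks x S),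
    ← Finset.sum_fiberwise (pointsOf B) (fun x => restrictBlocks x S) (fun x => h (gadgetMap g x))]
  constructor
  · rw [Finset.mul_sum, Finset.mul_sum, Finset.mul_sum]
    exact Finset.sum_le_sum fun y _ => (key y).1
  · rw [Finset.mul_sum, Finset.mul_sum, Finset.mul_sum]
    exact Finset.sum_le_sum fun y _ => (key y).2

/-- Equidistribution on the whole space with nothing fixed. It shows that the weights 1/|G⁻¹(z)| in
the lifted distribution are nearly constant. -/
theorem exists_abs_card_gadgetFiber_sub_le {g : (Fin b → ZMod 2) → ZMod 2} {δ : ℝ}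
    (hδ : 0 ≤ δ) (hg : ∀ u, |gadgetHat g u| ≤ δ) :
    ∃ M : ℝ, 0 < M ∧ ∀ z : Fin n → ZMod 2,
      |((gadgetFiber g z).card : ℝ) - M| ≤ ((1 + 3 * δ) ^ n - 1) * M := by
  have h0 : (0 : BlockVec (Fin n) b) ∈ (⊤ : AffSpace n b) := AffineSubspace.mem_top _ _ _
  have hbot : formsOf (⊤ : AffSpace n b) = ⊥ :=
    le_bot_iff.1 (formsOf_le h0 fun d _ => AffineSubspace.mem_top _ _ _)
  have hdev : IsDeviolator (formsOf (⊤ : AffSpace n b) : Set (BlockVec (Fin n) b)) ∅ := by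
    apply isDeviolator_of_blockRank_le
    intro T _
    have : blockRank (formsOf (⊤ : AffSpace n b)) T = 0 := by
      rw [hbot, blockRank, bot_inf_eq, finrank_bot]
    rw [this, Finset.card_empty]
    omega
  obtain ⟨M, hM, h⟩ := hdev.exists_abs_card_fiberIn_sub_le hδ hg h0
  refine ⟨M, hM, fun z => ?_⟩
  have h1 := h z fun i hi => absurd hi (Finset.notMem_empty _)
  have h2 : fiberIn g ⊤ ∅ 0 z = gadgetFiber g z := by
    ext x
    simp [fiberIn, gadgetFiber, AffineSubspace.mem_top]
  rwa [h2] at h1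

end Resampling

section TseitinGraph

variable {V : Type*} [Fintype V] {G : SimpleGraph V} {n : ℕ}

/-! ### Vertex parities -/

/-- The parity of an assignment to the edges at a vertex. -/
def vertexParity (e : Fin n ≃ G.edgeSet) (z : Fin n → ZMod 2) (u : V) : ZMod 2 :=
  ∑ i ∈ incidentVars e u, z i

theorem mem_incidentVars {e : Fin n ≃ G.edgeSet} {u : V} {i : Fin n} :
    i ∈ incidentVars e u ↔ u ∈ (e i : Sym2 V) := by
  simp [incidentVars]

theorem vertexParity_add (e : Fin n ≃ G.edgeSet) (z w : Fin n → ZMod 2) (u : V) :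
    vertexParity e (z + w) u = vertexParity e z u + vertexParity e w u := by
  simp [vertexParity, Finset.sum_add_distrib]

theorem vertexParity_sum_smul (e : Fin n ≃ G.edgeSet) {ι : Type*} (s : Finset ι) (c : ι → ZMod 2)
    (w : ι → Fin n → ZMod 2) (u : V) :
    vertexParity e (∑ j ∈ s, c j • w j) u = ∑ j ∈ s, c j * vertexParity e (w j) u := by
  simp only [vertexParity, Finset.sum_apply, Pi.smul_apply, smul_eq_mul]
  rw [Finset.sum_comm]
  simp only [Finset.mul_sum]

theorem ZMod.add_self_two (a : ZMod 2) : a + a = 0 := CharTwo.add_self_eq_zero a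

theorem vertexParity_single (e : Fin n ≃ G.edgeSet) {i : Fin n} {a c : V}
    (hi : (e i : Sym2 V) = s(a, c)) (t : ZMod 2) (u : V) :
    vertexParity e (Pi.single i t) u = (if u = a then t else 0) + if u = c then t else 0 := by
  have hac : a ≠ c := by
    have h := (e i).2
    rw [hi, SimpleGraph.mem_edgeSet] at h
    exact h.ne
  rw [vertexParity, Finset.sum_pi_single']
  simp only [mem_incidentVars, hi, Sym2.mem_iff]
  by_cases h1 : u = a
  · have h2 : u ≠ c := fun h => hac (h1 ▸ h)
    simp [h1, hac]
  · simp [h1]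

/-- The edges of a walk, counted mod 2, have odd degree only at its two ends; the ends cancel when
they coincide. -/
theorem exists_vertexParity_of_reachable (e : Fin n ≃ G.edgeSet) {H : SimpleGraph V} (hH : H ≤ G)
    {u w : V} (h : H.Reachable u w) :
    ∃ z : Fin n → ZMod 2, (∀ i, (e i : Sym2 V) ∉ H.edgeSet → z i = 0) ∧
      ∀ x, vertexParity e z x = (if x = u then 1 else 0) + if x = w then 1 else 0 := by
  obtain ⟨p⟩ := h
  induction p with
  | nil =>
    refine ⟨0, fun _ _ => rfl, fun x => ?_⟩
    rw [ZMod.add_self_two]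
    simp [vertexParity]
  | @cons a c d hac p ih =>
    obtain ⟨z, hz, hzp⟩ := ih
    set i := e.symm ⟨s(a, c), hH hac⟩ with hi
    have hei : (e i : Sym2 V) = s(a, c) := by rw [hi, Equiv.apply_symm_apply]
    refine ⟨Pi.single i 1 + z, fun j hj => ?_, fun x => ?_⟩
    · rw [Pi.add_apply, hz j hj, add_zero, Pi.single_eq_of_ne]
      rintro rfl
      exact hj (by rw [hei]; exact hac)
    · rw [vertexParity_add, vertexParity_single e hei, hzp]
      have h1 := ZMod.add_self_two (if x = c then (1 : ZMod 2) else 0)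
      linear_combination h1

/-- Handshake argument: an edge of the support of z has both ends or no end in X. -/
theorem sum_vertexParity_eq_zero (e : Fin n ≃ G.edgeSet) (X : Finset V) (z : Fin n → ZMod 2)
    (hz : ∀ i a c, (e i : Sym2 V) = s(a, c) → z i ≠ 0 → (a ∈ X ↔ c ∈ X)) :
    ∑ u ∈ X, vertexParity e z u = 0 := by
  have h1 : z = ∑ i, (1 : ZMod 2) • Pi.single i (z i) := by
    simp only [one_smul]
    exact (Finset.univ_sum_single z).symm
  rw [h1]
  simp only [vertexParity_sum_smul, one_mul]
  rw [Finset.sum_comm]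
  refine Finset.sum_eq_zero fun i _ => ?_
  obtain ⟨a, c, hac⟩ : ∃ a c, (e i : Sym2 V) = s(a, c) := by
    induction h : (e i : Sym2 V) using Sym2.ind with
    | _ a c => exact ⟨a, c, rfl⟩
  simp only [vertexParity_single e hac, Finset.sum_add_distrib, Finset.sum_ite_eq']
  by_cases h0 : z i = 0
  · simp [h0]
  · have h2 := hz i a c hac h0
    by_cases ha : a ∈ X
    · rw [if_pos ha, if_pos (h2.1 ha), ZMod.add_self_two]
    · rw [if_neg ha, if_neg (fun h => ha (h2.2 h)), add_zero]

/-! ### Removing edges -/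

/-- `G` with the edges in `S` removed. -/
def remainingGraph (e : Fin n ≃ G.edgeSet) (S : Finset (Fin n)) : SimpleGraph V :=
  G.deleteEdges {s | ∃ i ∈ S, (e i : Sym2 V) = s}

theorem remainingGraph_adj {e : Fin n ≃ G.edgeSet} {S : Finset (Fin n)} {i : Fin n} {a c : V}
    (hi : (e i : Sym2 V) = s(a, c)) : (remainingGraph e S).Adj a c ↔ i ∉ S := by
  have h : G.Adj a c := by
    have h := (e i).2
    rwa [hi, SimpleGraph.mem_edgeSet] at h
  simp only [remainingGraph, SimpleGraph.deleteEdges_adj, h, true_and, Set.mem_ofPred_eq,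
    not_exists, not_and]
  constructor
  · intro h1 h2
    exact h1 i h2 hi
  · intro h1 j hj hj'
    have : e j = e i := Subtype.ext (hj'.trans hi.symm)
    exact h1 (e.injective this ▸ hj)

theorem remainingGraph_le (e : Fin n ≃ G.edgeSet) (S : Finset (Fin n)) : remainingGraph e S ≤ G :=
  SimpleGraph.deleteEdges_le _

theorem remainingGraph_anti (e : Fin n ≃ G.edgeSet) {S T : Finset (Fin n)} (h : S ⊆ T) :
    remainingGraph e T ≤ remainingGraph e S := by
  refine SimpleGraph.deleteEdges_anti ?_
  rintro s ⟨i, hi, his⟩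
  exact ⟨i, h hi, his⟩

theorem mem_edgeSet_remainingGraph {e : Fin n ≃ G.edgeSet} {S : Finset (Fin n)} {i : Fin n} :
    (e i : Sym2 V) ∈ (remainingGraph e S).edgeSet ↔ i ∉ S := by
  induction h : (e i : Sym2 V) using Sym2.ind with
  | _ a c => rw [SimpleGraph.mem_edgeSet, remainingGraph_adj h]

/-- The vertices that can be reached from `v` when the edges in `S` are removed. -/
def componentOf (e : Fin n ≃ G.edgeSet) (S : Finset (Fin n)) (v : V) : Finset V :=
  {u | (remainingGraph e S).Reachable v u}

theorem mem_componentOf {e : Fin n ≃ G.edgeSet} {S : Finset (Fin n)} {v u : V} :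
    u ∈ componentOf e S v ↔ (remainingGraph e S).Reachable v u := by
  simp [componentOf]

theorem componentOf_anti (e : Fin n ≃ G.edgeSet) {S T : Finset (Fin n)} (h : S ⊆ T) (v : V) :
    componentOf e T v ⊆ componentOf e S v := by
  intro u hu
  rw [mem_componentOf] at hu ⊢
  exact hu.mono (remainingGraph_anti e h)

/-- The vertices in a component with more than half of all vertices after the edges in `S` are
removed. -/
def bigVertices (e : Fin n ≃ G.edgeSet) (S : Finset (Fin n)) : Finset V :=
  {v | Fintype.card V < 2 * (componentOf e S v).card}

theorem mem_bigVertices {e : Fin n ≃ G.edgeSet} {S : Finset (Fin n)} {v : V} :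
    v ∈ bigVertices e S ↔ Fintype.card V < 2 * (componentOf e S v).card := by
  simp [bigVertices]

theorem bigVertices_anti (e : Fin n ≃ G.edgeSet) {S T : Finset (Fin n)} (h : S ⊆ T) :
    bigVertices e T ⊆ bigVertices e S := by
  intro v hv
  rw [mem_bigVertices] at hv ⊢
  exact hv.trans_le (Nat.mul_le_mul_left 2 (Finset.card_le_card (componentOf_anti e h v)))

theorem reachable_of_mem_bigVertices {e : Fin n ≃ G.edgeSet} {S : Finset (Fin n)} {v w : V}
    (hv : v ∈ bigVertices e S) (hw : w ∈ bigVertices e S) : (remainingGraph e S).Reachable v w := by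
  rw [mem_bigVertices] at hv hw
  by_contra h
  have hd : Disjoint (componentOf e S v) (componentOf e S w) := by
    rw [Finset.disjoint_left]
    intro u hu hu'
    rw [mem_componentOf] at hu hu'
    exact h (hu.trans hu'.symm)
  have h1 := Finset.card_union_of_disjoint hd
  have h2 := Finset.card_le_univ (componentOf e S v ∪ componentOf e S w)
  omega

/-! ### Assignments violating the constraint at one vertex only -/

/-- `z` violates the Tseitin constraint at `v` and at no other vertex. -/
def ViolatesAt (e : Fin n ≃ G.edgeSet) (v : V) (z : Fin n → ZMod 2) : Prop :=
  ∀ u, vertexParity e z u = if u = v then 0 else 1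

/-- The number of assignments that agree with `z₀` on `S` and violate the constraint at `v`
only. -/
def violCount (e : Fin n ≃ G.edgeSet) (v : V) (S : Finset (Fin n)) (z₀ : Fin n → ZMod 2) : ℕ :=
  ((agreeOn S z₀).filter (ViolatesAt e v)).card

/-- Adding a walk from v to w that avoids S moves the violation from v to w and leaves the values on
S unchanged. -/
theorem violCount_le_of_reachable (e : Fin n ≃ G.edgeSet) {S : Finset (Fin n)} {v w : V}
    (h : (remainingGraph e S).Reachable v w) (z₀ : Fin n → ZMod 2) :
    violCount e v S z₀ ≤ violCount e w S z₀ := by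
  obtain ⟨y, hy, hyp⟩ := exists_vertexParity_of_reachable e (remainingGraph_le e S) h
  refine Finset.card_le_card_of_injOn (fun z => z + y) ?_ (add_left_injective y).injOn
  intro z hz
  simp only [Finset.coe_filter, Set.mem_ofPred_eq, mem_agreeOn] at hz ⊢
  refine ⟨fun i hi => ?_, fun u => ?_⟩
  · rw [Pi.add_apply, hz.1 i hi, hy i (fun h => mem_edgeSet_remainingGraph.1 h hi), add_zero]
  · rw [vertexParity_add, hz.2 u, hyp u]
    split_ifs <;> decide

theorem violCount_eq_of_mem_bigVertices (e : Fin n ≃ G.edgeSet) {S : Finset (Fin n)} {v w : V}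
    (hv : v ∈ bigVertices e S) (hw : w ∈ bigVertices e S) (z₀ : Fin n → ZMod 2) :
    violCount e v S z₀ = violCount e w S z₀ :=
  le_antisymm (violCount_le_of_reachable e (reachable_of_mem_bigVertices hv hw) z₀)
    (violCount_le_of_reachable e (reachable_of_mem_bigVertices hw hv) z₀)

/-! ### Odd components -/

/-- The variables fixed by `ρ`. -/
def fixedVars (ρ : PartialAssignment n) : Finset (Fin n) := {i | ρ i ≠ none}

theorem mem_fixedVars {ρ : PartialAssignment n} {i : Fin n} : i ∈ fixedVars ρ ↔ ρ i ≠ none := by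
  simp [fixedVars]

theorem freeGraph_eq (e : Fin n ≃ G.edgeSet) (ρ : PartialAssignment n) :
    freeGraph e ρ = remainingGraph e (fixedVars ρ) := by
  simp only [freeGraph, remainingGraph, mem_fixedVars]

/-- `z` extends the partial assignment `ρ`. -/
def Extends (z : Fin n → ZMod 2) (ρ : PartialAssignment n) : Prop :=
  ∀ i a, ρ i = some a → z i = a

theorem Extends.iff_mem_agreeOn {z₀ z : Fin n → ZMod 2} {ρ : PartialAssignment n}
    (h₀ : Extends z₀ ρ) : Extends z ρ ↔ z ∈ agreeOn (fixedVars ρ) z₀ := by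
  rw [mem_agreeOn]
  constructor
  · intro h i hi
    obtain ⟨a, ha⟩ := Option.ne_none_iff_exists'.1 (mem_fixedVars.1 hi)
    rw [h i a ha, h₀ i a ha]
  · intro h i a ha
    rw [h i (mem_fixedVars.2 (by simp [ha])), h₀ i a ha]

theorem vertexParity_eq_of_extends (e : Fin n ≃ G.edgeSet) {ρ : PartialAssignment n}
    {z : Fin n → ZMod 2} (hz : Extends z ρ) (u : V) :
    vertexParity e z u
      = ∑ i ∈ incidentVars e u with ρ i = none, z i + ∑ i ∈ incidentVars e u, (ρ i).getD 0 := by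
  rw [Finset.sum_filter, ← Finset.sum_add_distrib]
  refine Finset.sum_congr rfl fun i _ => ?_
  cases h : ρ i with
  | none => simp
  | some a => simp [hz i a h]

theorem sum_free_eq_residualParity_iff (e : Fin n ≃ G.edgeSet) {ρ : PartialAssignment n}
    {z : Fin n → ZMod 2} (hz : Extends z ρ) (u : V) :
    ∑ i ∈ incidentVars e u with ρ i = none, z i = residualParity e ρ u
      ↔ vertexParity e z u = 1 := by
  rw [vertexParity_eq_of_extends e hz, residualParity]
  have h := ZMod.add_self_two (∑ i ∈ incidentVars e u, (ρ i).getD 0)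
  constructor
  · intro h1
    linear_combination h1 + h
  · intro h1
    linear_combination h1 - h

/-- Free edges do not leave a component, so they cancel in the sum. The right side counts mod 2 the
constraints violated by z, whence a component is odd precisely when any extension violates an odd
number of its constraints. -/
theorem sum_residualParity_eq (e : Fin n ≃ G.edgeSet) {ρ : PartialAssignment n}
    {z : Fin n → ZMod 2} (hz : Extends z ρ) (K : (freeGraph e ρ).ConnectedComponent) :
    ∑ v with (freeGraph e ρ).connectedComponentMk v = K, residualParity e ρ v
      = ∑ v with (freeGraph e ρ).connectedComponentMk v = K, (1 + vertexParity e z v) := by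
  have h := sum_vertexParity_eq_zero e
    (Finset.univ.filter fun v => (freeGraph e ρ).connectedComponentMk v = K)
    (fun i => if ρ i = none then z i else 0) ?_
  · have h1 : ∀ v, 1 + vertexParity e z v = residualParity e ρ v
        + vertexParity e (fun i => if ρ i = none then z i else 0) v := by
      intro v
      rw [vertexParity_eq_of_extends e hz, residualParity, vertexParity, Finset.sum_filter]
      ring
    rw [Finset.sum_congr rfl fun v _ => h1 v, Finset.sum_add_distrib, h, add_zero]
  · intro i a c hac hi
    have hi' : ρ i = none := by
      by_contra hne
      exact hi (if_neg hne)
    have hadj : (freeGraph e ρ).Adj a c := by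
      rw [freeGraph_eq, remainingGraph_adj hac, mem_fixedVars, not_not]
      exact hi'
    simp only [Finset.mem_filter, Finset.mem_univ, true_and]
    rw [SimpleGraph.ConnectedComponent.connectedComponentMk_eq_of_adj hadj]

theorem isOddComponent_iff_of_violatesAt (e : Fin n ≃ G.edgeSet) {ρ : PartialAssignment n}
    {z : Fin n → ZMod 2} (hz : Extends z ρ) {v : V} (hv : ViolatesAt e v z)
    (K : (freeGraph e ρ).ConnectedComponent) :
    IsOddComponent e ρ K ↔ (freeGraph e ρ).connectedComponentMk v = K := by
  rw [IsOddComponent, sum_residualParity_eq e hz]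
  have h1 : ∀ u, 1 + vertexParity e z u = if u = v then 1 else 0 := by
    intro u
    rw [hv u]
    split_ifs
    · rw [add_zero]
    · exact ZMod.add_self_two 1
  rw [Finset.sum_congr rfl fun u _ => h1 u, Finset.sum_ite_eq']
  simp

theorem ncard_supp_eq (e : Fin n ≃ G.edgeSet) (ρ : PartialAssignment n) (v : V) :
    ((freeGraph e ρ).connectedComponentMk v).supp.ncard
      = (componentOf e (fixedVars ρ) v).card := by
  rw [← Set.ncard_coe_finset]
  congr 1
  ext u
  rw [Finset.mem_coe, mem_componentOf, ← freeGraph_eq, SimpleGraph.ConnectedComponent.mem_supp_iff,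
    SimpleGraph.ConnectedComponent.eq]
  exact ⟨fun h => h.symm, fun h => h.symm⟩

theorem half_lt_ncard_supp_iff (e : Fin n ≃ G.edgeSet) (ρ : PartialAssignment n) (v : V) :
    (Fintype.card V : ℝ) / 2 < (((freeGraph e ρ).connectedComponentMk v).supp.ncard : ℝ)
      ↔ v ∈ bigVertices e (fixedVars ρ) := by
  rw [ncard_supp_eq, mem_bigVertices, div_lt_iff₀ (by norm_num : (0 : ℝ) < 2), mul_comm]
  exact_mod_cast Iff.rfl

theorem isValid_of_violatesAt (e : Fin n ≃ G.edgeSet) {ρ : PartialAssignment n}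
    {z : Fin n → ZMod 2} (hz : Extends z ρ) {v : V} (hv : ViolatesAt e v z)
    (hbig : v ∈ bigVertices e (fixedVars ρ)) : IsValid e ρ :=
  ⟨_, (isOddComponent_iff_of_violatesAt e hz hv _).2 rfl,
    fun K' hK' => ((isOddComponent_iff_of_violatesAt e hz hv K').1 hK').symm,
    (half_lt_ncard_supp_iff e ρ v).2 hbig⟩

theorem mem_oddVertices {e : Fin n ≃ G.edgeSet} {ρ : PartialAssignment n} {v : V} :
    v ∈ oddVertices e ρ ↔ IsOddComponent e ρ ((freeGraph e ρ).connectedComponentMk v) := by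
  simp [oddVertices]

theorem IsValid.oddVertices_eq {e : Fin n ≃ G.edgeSet} {ρ : PartialAssignment n}
    (h : IsValid e ρ) : oddVertices e ρ = bigVertices e (fixedVars ρ) := by
  obtain ⟨K, hK, huniq, hbig⟩ := h
  ext v
  rw [mem_oddVertices, ← half_lt_ncard_supp_iff]
  constructor
  · intro h1
    rw [huniq _ h1]
    exact hbig
  · intro h1
    induction K using SimpleGraph.ConnectedComponent.ind with
    | h w =>
    have h2 := reachable_of_mem_bigVertices ((half_lt_ncard_supp_iff e ρ v).1 h1)
      ((half_lt_ncard_supp_iff e ρ w).1 hbig)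
    rw [← freeGraph_eq] at h2
    rw [SimpleGraph.ConnectedComponent.sound h2]
    exact hK

end TseitinGraph

section TreeChoices

variable {V : Type*} [Fintype V] {G : SimpleGraph V} {n : ℕ}

/-! ### Spanning forests and the sampling procedure -/

theorem nonempty_treeChoice (e : Fin n ≃ G.edgeSet) (ρ : PartialAssignment n) (v : V) :
    Nonempty (TreeChoice e ρ v) := by
  obtain ⟨F, hF, hacyc, hreach⟩ := (freeGraph e ρ).exists_isAcyclic_reachable_eq_le
  let root : (freeGraph e ρ).ConnectedComponent → V := fun K =>
    if (freeGraph e ρ).connectedComponentMk v = K then v else K.exists_rep.choose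
  have hroot : ∀ K, (freeGraph e ρ).connectedComponentMk (root K) = K := by
    intro K
    by_cases h : (freeGraph e ρ).connectedComponentMk v = K
    · simp only [root, if_pos h]
      exact h
    · simp only [root, if_neg h]
      exact K.exists_rep.choose_spec
  exact ⟨{
    forest := F
    forest_le := hF
    acyclic := hacyc
    spanning := fun u w h => by rw [hreach]; exact h
    roots := Set.range root
    mem_roots := ⟨(freeGraph e ρ).connectedComponentMk v, if_pos rfl⟩
    existsUnique_root := fun K => by
      refine ⟨root K, ⟨⟨K, rfl⟩, hroot K⟩, ?_⟩
      rintro _ ⟨⟨K', rfl⟩, h⟩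
      rw [hroot] at h
      rw [h] }⟩

namespace TreeChoice

variable {e : Fin n ≃ G.edgeSet} {ρ : PartialAssignment n} {v : V} (t : TreeChoice e ρ v)

/-- The specification of `TreeChoice.extend`. -/
def IsExtension (h : t.NonTree → ZMod 2) (z : Fin n → ZMod 2) : Prop :=
  Extends z ρ ∧ (∀ i : t.NonTree, z i = h i) ∧ ∀ u, u ∉ t.roots → vertexParity e z u = 1

theorem forest_le_graph : t.forest ≤ G :=
  t.forest_le.trans (by rw [freeGraph_eq]; exact remainingGraph_le e _)

theorem eq_none_of_mem_forest {i : Fin n} (hi : (e i : Sym2 V) ∈ t.forest.edgeSet) :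
    ρ i = none := by
  have h1 : (e i : Sym2 V) ∈ (freeGraph e ρ).edgeSet := SimpleGraph.edgeSet_mono t.forest_le hi
  rw [freeGraph_eq, mem_edgeSet_remainingGraph, mem_fixedVars, not_not] at h1
  exact h1

/-- Starting from 0 on the tree edges, every vertex of wrong parity is repaired by flipping the tree
path to its root. -/
theorem exists_isExtension (h : t.NonTree → ZMod 2) : ∃ z, t.IsExtension h z := by
  let z₀ : Fin n → ZMod 2 := fun i =>
    if hi : ρ i = none ∧ (e i : Sym2 V) ∉ t.forest.edgeSet then h ⟨i, hi⟩ else (ρ i).getD 0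
  have hr : ∀ u, ∃ r ∈ t.roots, t.forest.Reachable u r := by
    intro u
    obtain ⟨r, ⟨hr, hru⟩, -⟩ := t.existsUnique_root ((freeGraph e ρ).connectedComponentMk u)
    exact ⟨r, hr, t.spanning _ _ (SimpleGraph.ConnectedComponent.exact hru.symm)⟩
  choose r hr hreach using hr
  choose w hw hwp using fun u => exists_vertexParity_of_reachable e t.forest_le_graph (hreach u)
  let z := z₀ + ∑ u, (1 + vertexParity e z₀ u) • w u
  have hz : ∀ i, (e i : Sym2 V) ∉ t.forest.edgeSet → z i = z₀ i := by
    intro i hi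
    simp only [z, Pi.add_apply, Finset.sum_apply, Pi.smul_apply, smul_eq_mul]
    rw [Finset.sum_eq_zero fun u _ => by rw [hw u i hi, mul_zero], add_zero]
  refine ⟨z, ?_, ?_, ?_⟩
  · intro i a hia
    have hne : ρ i ≠ none := by simp [hia]
    rw [hz i fun hi => hne (t.eq_none_of_mem_forest hi)]
    simp only [z₀]
    rw [dif_neg fun hi => hne hi.1, hia, Option.getD_some]
  · intro i
    rw [hz i i.2.2]
    simp only [z₀]
    rw [dif_pos i.2]
  · intro x hx
    simp only [z]
    rw [vertexParity_add, vertexParity_sum_smul]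
    -- The path from u ends at a root, so at the non-root x only the path starting at x is felt.
    have h1 : ∀ u, (1 + vertexParity e z₀ u) * vertexParity e (w u) x
        = if u = x then 1 + vertexParity e z₀ u else 0 := by
      intro u
      rw [hwp, if_neg (fun h => hx (h ▸ hr u) : x ≠ r u), add_zero]
      by_cases hux : u = x
      · rw [if_pos hux, if_pos hux.symm, mul_one]
      · rw [if_neg hux, if_neg fun h => hux h.symm, mul_zero]
    rw [Finset.sum_congr rfl fun u _ => h1 u, Finset.sum_ite_eq', if_pos (Finset.mem_univ _)]
    have h2 := ZMod.add_self_two (vertexParity e z₀ x)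
    linear_combination h2

/-- If w is non-zero on a forest edge, removing that edge splits its tree. A side without root would
have total parity 0 by hypothesis, yet total parity 1 because of the cut edge. So both sides contain
a root, although a component has only one. -/
theorem eq_zero_of_supported_on_forest {w : Fin n → ZMod 2}
    (hw : ∀ i, (e i : Sym2 V) ∉ t.forest.edgeSet → w i = 0)
    (hp : ∀ u ∉ t.roots, vertexParity e w u = 0) : w = 0 := by
  funext i
  by_contra hi
  obtain ⟨a, c, hac⟩ : ∃ a c, (e i : Sym2 V) = s(a, c) := by
    induction h : (e i : Sym2 V) using Sym2.ind with
    | _ a c => exact ⟨a, c, rfl⟩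
  have hmem : s(a, c) ∈ t.forest.edgeSet := by
    by_contra h
    exact hi (hw i (hac ▸ h))
  have hadj : t.forest.Adj a c := hmem
  set F := t.forest.deleteEdges {s(a, c)} with hF
  have hbridge : ¬ F.Reachable a c :=
    SimpleGraph.isBridge_iff.1 (SimpleGraph.isAcyclic_iff_forall_isBridge.1 t.acyclic hmem)
  have hFle : F ≤ t.forest := SimpleGraph.deleteEdges_le _
  have key : ∀ a' c', s(a', c') = s(a, c) → ¬ F.Reachable a' c' →
      ∃ r ∈ t.roots, F.Reachable a' r := by
    intro a' c' hs hnr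
    by_contra hcon
    push Not at hcon
    have hac' : (e i : Sym2 V) = s(a', c') := hac.trans hs.symm
    set X : Finset V := {u | F.Reachable a' u} with hX
    have hmX : ∀ u, u ∈ X ↔ F.Reachable a' u := fun u => by simp [hX]
    have h1 : ∑ u ∈ X, vertexParity e w u = 0 :=
      Finset.sum_eq_zero fun u hu => hp u fun h => hcon u h ((hmX u).1 hu)
    -- Adding `w i` at i erases the cut edge, after which no edge of the support leaves X.
    have h2 := sum_vertexParity_eq_zero e X (w + Pi.single i (w i)) ?_
    · simp only [vertexParity_add, Finset.sum_add_distrib, h1, zero_add,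
        vertexParity_single e hac', Finset.sum_ite_eq'] at h2
      rw [if_pos ((hmX a').2 SimpleGraph.Reachable.rfl), if_neg fun h => hnr ((hmX c').1 h),
        add_zero] at h2
      exact hi h2
    · intro j p q hpq hj
      have hji : j ≠ i := by
        rintro rfl
        apply hj
        rw [Pi.add_apply, Pi.single_eq_same, ZMod.add_self_two]
      have hjF : F.Adj p q := by
        rw [hF, SimpleGraph.deleteEdges_adj]
        refine ⟨?_, fun h => hji ?_⟩
        · by_contra h
          apply hj
          rw [Pi.add_apply, Pi.single_eq_of_ne hji, add_zero]
          exact hw j (by rw [hpq]; exact h)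
        · exact e.injective (Subtype.ext (hpq.trans (h.trans hac.symm)))
      rw [hmX, hmX]
      exact ⟨fun h => h.trans hjF.reachable, fun h => h.trans hjF.symm.reachable⟩
  obtain ⟨r, hr, har⟩ := key a c rfl hbridge
  obtain ⟨r', hr', har'⟩ := key c a Sym2.eq_swap fun h => hbridge h.symm
  have h3 : (freeGraph e ρ).Reachable r r' :=
    ((har.symm.mono hFle).trans (hadj.reachable.trans (har'.mono hFle))).mono t.forest_le
  obtain ⟨q, -, hq⟩ := t.existsUnique_root ((freeGraph e ρ).connectedComponentMk r)
  have h4 := hq r ⟨hr, rfl⟩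
  have h5 := hq r' ⟨hr', (SimpleGraph.ConnectedComponent.sound h3).symm⟩
  rw [h5.trans h4.symm] at har'
  exact hbridge (har.trans har'.symm)

theorem IsExtension.unique {t : TreeChoice e ρ v} {h : t.NonTree → ZMod 2} {z z' : Fin n → ZMod 2}
    (hz : t.IsExtension h z) (hz' : t.IsExtension h z') : z = z' := by
  have h0 : z + z' = 0 := by
    refine t.eq_zero_of_supported_on_forest (fun i hi => ?_) fun u hu => ?_
    · have heq : z i = z' i := by
        cases hi' : ρ i with
        | none => rw [hz.2.1 ⟨i, hi', hi⟩, hz'.2.1 ⟨i, hi', hi⟩]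
        | some a => rw [hz.1 i a hi', hz'.1 i a hi']
      rw [Pi.add_apply, heq, ZMod.add_self_two]
    · rw [vertexParity_add, hz.2.2 u hu, hz'.2.2 u hu, ZMod.add_self_two]
  funext i
  have h1 := congrFun h0 i
  rw [Pi.add_apply, Pi.zero_apply] at h1
  have h2 := ZMod.add_self_two (z' i)
  linear_combination h1 - h2

theorem isExtension_extend (h : t.NonTree → ZMod 2) : t.IsExtension h (t.extend h) := by
  let p : (Fin n → ZMod 2) → Prop := fun z =>
    (∀ i a, ρ i = some a → z i = a) ∧ (∀ i : t.NonTree, z i = h i) ∧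
      ∀ u, u ∉ t.roots → ∑ i ∈ incidentVars e u with ρ i = none, z i = residualParity e ρ u
  have hiff : ∀ z, p z ↔ t.IsExtension h z := by
    intro z
    refine and_congr_right fun hz => and_congr_right fun _ => forall₂_congr fun u _ => ?_
    exact sum_free_eq_residualParity_iff e hz u
  obtain ⟨z, hz⟩ := t.exists_isExtension h
  exact (hiff _).1 (Classical.epsilon_spec (p := p) ⟨z, (hiff z).2 hz⟩)

/-- When all other constraints of a component hold, its parity decides the constraint at its root,
which fails only in the odd component, at v. -/
theorem forall_notMem_roots_iff (hρ : IsValid e ρ) (hv : v ∈ oddVertices e ρ)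
    {z : Fin n → ZMod 2} (hz : Extends z ρ) :
    (∀ u, u ∉ t.roots → vertexParity e z u = 1) ↔ ViolatesAt e v z := by
  constructor
  · intro h u
    by_cases hu : u ∈ t.roots
    · have h1 := sum_residualParity_eq e hz ((freeGraph e ρ).connectedComponentMk u)
      rw [Finset.sum_eq_single_of_mem (f := fun v => 1 + vertexParity e z v) u (by simp)] at h1
      · rw [mem_oddVertices] at hv
        split_ifs with huv
        · subst huv
          rw [IsOddComponent] at hv
          rw [hv] at h1
          exact add_eq_left.1 h1.symm
        · have h2 : ¬ IsOddComponent e ρ ((freeGraph e ρ).connectedComponentMk u) := by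
            intro h3
            obtain ⟨K, -, huniq, -⟩ := hρ
            have h4 := (huniq _ h3).trans (huniq _ hv).symm
            obtain ⟨q, -, hq⟩ := t.existsUnique_root ((freeGraph e ρ).connectedComponentMk u)
            exact huv ((hq u ⟨hu, rfl⟩).trans (hq v ⟨t.mem_roots, h4.symm⟩).symm)
          rw [IsOddComponent] at h2
          rw [(ZMod.two_cases _).resolve_right h2] at h1
          have h5 := ZMod.add_self_two 1
          linear_combination -h1 - h5
      · intro w hw hwu
        have hwr : w ∉ t.roots := by
          intro hwr
          obtain ⟨q, -, hq⟩ := t.existsUnique_root ((freeGraph e ρ).connectedComponentMk u)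
          exact hwu ((hq w ⟨hwr, (Finset.mem_filter.1 hw).2⟩).trans (hq u ⟨hu, rfl⟩).symm)
        rw [h w hwr]
        exact ZMod.add_self_two 1
    · rw [h u hu, if_neg]
      rintro rfl
      exact hu t.mem_roots
  · intro h u hu
    rw [h u, if_neg]
    rintro rfl
    exact hu t.mem_roots

theorem extend_injective : Function.Injective t.extend := by
  intro h h' heq
  funext i
  rw [← (t.isExtension_extend h).2.1 i, ← (t.isExtension_extend h').2.1 i, heq]

/-- The right side mentions neither trees nor roots; this is why every choice of them gives the same
μ_ρ. -/
theorem range_extend (hρ : IsValid e ρ) (hv : v ∈ oddVertices e ρ) :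
    Set.range t.extend = {z | Extends z ρ ∧ ViolatesAt e v z} := by
  ext z
  constructor
  · rintro ⟨h, rfl⟩
    have h1 := t.isExtension_extend h
    exact ⟨h1.1, (t.forall_notMem_roots_iff hρ hv h1.1).1 h1.2.2⟩
  · rintro ⟨h1, h2⟩
    refine ⟨fun i => z i, IsExtension.unique (t.isExtension_extend _)
      ⟨h1, fun _ => rfl, (t.forall_notMem_roots_iff hρ hv h1).2 h2⟩⟩

end TreeChoice

theorem IsValid.exists_violatesAt {e : Fin n ≃ G.edgeSet} {ρ : PartialAssignment n}
    (hρ : IsValid e ρ) {v : V} (hv : v ∈ oddVertices e ρ) :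
    ∃ z, Extends z ρ ∧ ViolatesAt e v z := by
  obtain ⟨t⟩ := nonempty_treeChoice e ρ v
  have h : t.extend 0 ∈ Set.range t.extend := ⟨0, rfl⟩
  rw [t.range_extend hρ hv] at h
  exact ⟨_, h⟩

/-- Validity is witnessed by one total assignment and one vertex, and both survive the unfixing of
bits. -/
theorem isValid_iff {e : Fin n ≃ G.edgeSet} {ρ : PartialAssignment n} :
    IsValid e ρ ↔ ∃ v ∈ bigVertices e (fixedVars ρ), ∃ z, Extends z ρ ∧ ViolatesAt e v z := by
  constructor
  · intro h
    obtain ⟨v, hv⟩ := oddVertices_nonempty h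
    exact ⟨v, by rwa [← h.oddVertices_eq], h.exists_violatesAt hv⟩
  · rintro ⟨v, hv, z, hz, hzv⟩
    exact isValid_of_violatesAt e hz hzv hv

theorem IsValid.of_unfix {e : Fin n ≃ G.edgeSet} {ρ ρ' : PartialAssignment n}
    (hρ : IsValid e ρ) (h : ∀ i, ρ' i = none ∨ ρ' i = ρ i) : IsValid e ρ' := by
  obtain ⟨v, hv, z, hz, hzv⟩ := isValid_iff.1 hρ
  refine isValid_iff.2 ⟨v, bigVertices_anti e ?_ hv, z, ?_, hzv⟩
  · intro i hi
    rw [mem_fixedVars] at hi ⊢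
    rwa [← (h i).resolve_left hi]
  · intro i a hia
    refine hz i a ?_
    rw [← (h i).resolve_left (by simp [hia]), hia]

/-- A falsified clause at u fixes all edges at u to a violating assignment, so u is the violated
vertex of the witness. But then u is isolated in G_ρ, and a single vertex is no majority. -/
theorem IsValid.not_falsifies {e : Fin n ≃ G.edgeSet} {ρ : PartialAssignment n}
    (hρ : IsValid e ρ) (hV : 2 ≤ Fintype.card V) {C : Clause n} (hC : C ∈ tseitin e) :
    ¬ Falsifies ρ C := by
  intro hf
  obtain ⟨u, a, ha, rfl⟩ := hC
  obtain ⟨v, hv, z, hz, hzv⟩ := isValid_iff.1 hρ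
  have hfix : ∀ i ∈ incidentVars e u, ρ i = some (a i) := by
    intro i hi
    obtain ⟨c, hc, hne⟩ := hf (i, a i + 1) (Finset.mem_image.2 ⟨i, hi, rfl⟩)
    rw [hc]
    congr 1
    have : ∀ c d : ZMod 2, c ≠ d + 1 → c = d := by decide
    exact this _ _ hne
  have huv : u = v := by
    by_contra hne
    have h1 := hzv u
    rw [if_neg hne, vertexParity, Finset.sum_congr rfl fun i hi => hz i _ (hfix i hi)] at h1
    exact ha h1
  subst huv
  have hsub : componentOf e (fixedVars ρ) u ⊆ {u} := by
    intro w hw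
    rw [mem_componentOf] at hw
    obtain ⟨p⟩ := hw
    cases p with
    | nil => simp
    | @cons _ c _ hadj p =>
      exfalso
      have hG := remainingGraph_le e _ hadj
      have hei : (e (e.symm ⟨s(u, c), hG⟩) : Sym2 V) = s(u, c) := by rw [Equiv.apply_symm_apply]
      have h1 := (remainingGraph_adj hei).1 hadj
      apply h1
      rw [mem_fixedVars, hfix _ (by rw [mem_incidentVars, hei]; exact Sym2.mem_mk_left _ _)]
      simp
  have h1 := Finset.card_le_card hsub
  rw [Finset.card_singleton] at h1
  rw [mem_bigVertices] at hv
  omega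

end TreeChoices

section Expansion

variable {V : Type*} [Fintype V] {G : SimpleGraph V} {n : ℕ}

/-! ### Expansion -/

theorem IsSpectralExpander.sum_adjMatrix {d : ℕ} {lam : ℝ} (hG : IsSpectralExpander G d lam)
    (u : V) : ∑ w, G.adjMatrix ℝ u w = d := by
  have h := hG.1 u
  rw [← SimpleGraph.card_neighborFinset_eq_degree] at h
  simp only [SimpleGraph.adjMatrix_apply, Finset.sum_boole]
  rw [← h]
  congr 2
  ext w
  simp

theorem IsSpectralExpander.two_mul_card_edges {d : ℕ} {lam : ℝ}
    (hG : IsSpectralExpander G d lam) (e : Fin n ≃ G.edgeSet) : 2 * n = d * Fintype.card V := by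
  have h := G.sum_degrees_eq_twice_card_edges
  have hdeg : ∀ v, G.degree v = d := fun v => hG.1 v
  rw [Finset.sum_congr rfl fun v _ => hdeg v, Finset.sum_const, Finset.card_univ, smul_eq_mul] at h
  have h2 : G.edgeFinset.card = n := by
    rw [SimpleGraph.edgeFinset_card, ← Fintype.card_congr e, Fintype.card_fin]
  rw [h2] at h
  rw [← h, mul_comm]

/-- The Laplacian form ∑ A_uw (x_u − x_w)² of the centred indicator of X is computed twice: it
counts the cut, and by the norm bound it is at least 2(1 − lam) d ‖x‖². -/
theorem IsSpectralExpander.mul_card_le_cut {d : ℕ} {lam : ℝ} (hG : IsSpectralExpander G d lam)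
    (X : Finset V) :
    (1 - lam) * d * (X.card * (Fintype.card V - X.card))
      ≤ Fintype.card V * ∑ u ∈ X, ∑ w ∈ Xᶜ, G.adjMatrix ℝ u w := by
  set N : ℝ := ((Fintype.card V : ℕ) : ℝ) with hN
  set k : ℝ := (X.card : ℝ) with hk
  rcases isEmpty_or_nonempty V with hemp | hne
  · have : N = 0 := by simp [hN]
    have hX : k = 0 := by
      rw [hk, Finset.eq_empty_of_isEmpty X]
      simp
    rw [this, hX]
    simp
  have hNpos : 0 < N := by
    rw [hN]
    exact_mod_cast Fintype.card_pos
  -- The indicator of X minus its mean, multiplied by |V| to avoid fractions.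
  let x : V → ℝ := fun v => (if v ∈ X then N else 0) - k
  have hsum : ∑ v, x v = 0 := by
    simp only [x, Finset.sum_sub_distrib, Finset.sum_const, Finset.card_univ, nsmul_eq_mul,
      Finset.sum_ite_mem, Finset.univ_inter]
    ring
  have hsq : ∑ v, x v ^ 2 = N * (k * (N - k)) := by
    have h1 : ∀ v, x v ^ 2 = (if v ∈ X then N ^ 2 - 2 * N * k else 0) + k ^ 2 := by
      intro v
      simp only [x]
      split_ifs <;> ring
    rw [Finset.sum_congr rfl fun v _ => h1 v]
    simp only [Finset.sum_add_distrib, Finset.sum_const, Finset.card_univ, nsmul_eq_mul,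
      Finset.sum_ite_mem, Finset.univ_inter]
    ring
  have hinner : ∑ v, x v * (G.adjMatrix ℝ).mulVec x v ≤ lam * d * ∑ v, x v ^ 2 := by
    have h1 := real_inner_le_norm (WithLp.toLp 2 ((G.adjMatrix ℝ).mulVec x)) (WithLp.toLp 2 x)
    have h2 := hG.2 x hsum
    rw [EuclideanSpace.inner_toLp_toLp] at h1
    have h3 : ‖WithLp.toLp 2 x‖ ^ 2 = ∑ v, x v ^ 2 := EuclideanSpace.real_norm_sq_eq _
    have h4 : x ⬝ᵥ star ((G.adjMatrix ℝ).mulVec x) = ∑ v, x v * (G.adjMatrix ℝ).mulVec x v := rfl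
    rw [h4] at h1
    refine h1.trans ?_
    calc _ ≤ lam * d * ‖WithLp.toLp 2 x‖ * ‖WithLp.toLp 2 x‖ :=
          mul_le_mul_of_nonneg_right h2 (norm_nonneg _)
      _ = _ := by rw [← h3]; ring
  have hlap : ∑ u, ∑ w, G.adjMatrix ℝ u w * (x u - x w) ^ 2
      = 2 * d * ∑ v, x v ^ 2 - 2 * ∑ v, x v * (G.adjMatrix ℝ).mulVec x v := by
    have h1 : ∀ u w, G.adjMatrix ℝ u w * (x u - x w) ^ 2
        = G.adjMatrix ℝ u w * x u ^ 2 + G.adjMatrix ℝ u w * x w ^ 2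
          - 2 * (x u * (G.adjMatrix ℝ u w * x w)) := fun u w => by ring
    have hsymm : ∀ u w, G.adjMatrix ℝ u w = G.adjMatrix ℝ w u := fun u w => by
      simp only [SimpleGraph.adjMatrix_apply, G.adj_comm]
    have h2 : ∑ u, ∑ w, G.adjMatrix ℝ u w * x u ^ 2 = d * ∑ v, x v ^ 2 := by
      rw [Finset.mul_sum]
      exact Finset.sum_congr rfl fun u _ => by rw [← Finset.sum_mul, hG.sum_adjMatrix]
    have h3 : ∑ u, ∑ w, G.adjMatrix ℝ u w * x w ^ 2 = d * ∑ v, x v ^ 2 := by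
      rw [Finset.sum_comm, ← h2]
      exact Finset.sum_congr rfl fun u _ => Finset.sum_congr rfl fun w _ => by rw [hsymm]
    have h4 : ∑ u, ∑ w, 2 * (x u * (G.adjMatrix ℝ u w * x w))
        = 2 * ∑ v, x v * (G.adjMatrix ℝ).mulVec x v := by
      rw [Finset.mul_sum]
      refine Finset.sum_congr rfl fun u _ => ?_
      rw [← Finset.mul_sum, ← Finset.mul_sum]
      rfl
    simp only [h1, Finset.sum_sub_distrib, Finset.sum_add_distrib, h2, h3, h4]
    ring
  have hcut : ∑ u, ∑ w, G.adjMatrix ℝ u w * (x u - x w) ^ 2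
      = 2 * N ^ 2 * ∑ u ∈ X, ∑ w ∈ Xᶜ, G.adjMatrix ℝ u w := by
    have hsymm : ∀ u w, G.adjMatrix ℝ u w = G.adjMatrix ℝ w u := fun u w => by
      simp only [SimpleGraph.adjMatrix_apply, G.adj_comm]
    have h1 : ∀ u w, G.adjMatrix ℝ u w * (x u - x w) ^ 2
        = N ^ 2 * (if u ∈ X then if w ∈ Xᶜ then G.adjMatrix ℝ u w else 0 else 0)
          + N ^ 2 * (if w ∈ X then if u ∈ Xᶜ then G.adjMatrix ℝ w u else 0 else 0) := by
      intro u w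
      rw [hsymm w u]
      simp only [x, Finset.mem_compl]
      by_cases hu : u ∈ X <;> by_cases hw : w ∈ X <;>
        (simp only [hu, hw, if_true, if_false, not_true_eq_false, not_false_eq_true]; ring)
    have h2 : ∑ u, ∑ w, (if u ∈ X then if w ∈ Xᶜ then G.adjMatrix ℝ u w else 0 else 0)
        = ∑ u ∈ X, ∑ w ∈ Xᶜ, G.adjMatrix ℝ u w := by
      rw [← Finset.sum_filter_add_sum_filter_not Finset.univ (fun u => u ∈ X)]
      rw [Finset.sum_eq_zero (s := Finset.univ.filter fun u => u ∉ X), add_zero]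
      · rw [Finset.filter_mem_eq_inter, Finset.univ_inter]
        refine Finset.sum_congr rfl fun u hu => ?_
        simp only [hu, if_true, Finset.sum_ite_mem, Finset.univ_inter]
      · intro u hu
        rw [Finset.mem_filter] at hu
        simp [hu.2]
    simp only [h1, Finset.sum_add_distrib, ← Finset.mul_sum]
    rw [h2, Finset.sum_comm, h2]
    ring
  have hfin : N * ((1 - lam) * d * (k * (N - k)))
      ≤ N * (N * ∑ u ∈ X, ∑ w ∈ Xᶜ, G.adjMatrix ℝ u w) := by
    have h1 : 2 * N ^ 2 * ∑ u ∈ X, ∑ w ∈ Xᶜ, G.adjMatrix ℝ u w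
        ≥ 2 * d * ∑ v, x v ^ 2 - 2 * (lam * d * ∑ v, x v ^ 2) := by
      rw [← hcut, hlap]
      linarith
    rw [hsq] at h1
    nlinarith [h1]
  exact le_of_mul_le_mul_left hfin hNpos

/-- `X` is a union of components of the graph with the edges in `S` removed. -/
def IsClosedUnder (e : Fin n ≃ G.edgeSet) (S : Finset (Fin n)) (X : Finset V) : Prop :=
  ∀ u ∈ X, ∀ w, (remainingGraph e S).Reachable u w → w ∈ X

/-- Every edge leaving X was removed, and X determines its orientation, so it is counted once. -/
theorem IsClosedUnder.cut_le {e : Fin n ≃ G.edgeSet} {S : Finset (Fin n)} {X : Finset V}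
    (hX : IsClosedUnder e S X) : ∑ u ∈ X, ∑ w ∈ Xᶜ, G.adjMatrix ℝ u w ≤ S.card := by
  simp only [SimpleGraph.adjMatrix_apply]
  rw [← Finset.sum_product' X Xᶜ fun u w => if G.Adj u w then (1 : ℝ) else 0, Finset.sum_boole]
  norm_cast
  refine Finset.card_le_card_of_forall_subsingleton
    (fun p i => (e i : Sym2 V) = s(p.1, p.2)) ?_ ?_
  · rintro ⟨u, w⟩ hp
    rw [Finset.mem_filter, Finset.mem_product, Finset.mem_compl] at hp
    have hei : (e (e.symm ⟨s(u, w), hp.2⟩) : Sym2 V) = s(u, w) := by rw [Equiv.apply_symm_apply]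
    refine ⟨_, ?_, hei⟩
    by_contra hS
    exact hp.1.2 (hX u hp.1.1 w ((remainingGraph_adj hei).2 hS).reachable)
  · rintro i _ ⟨u, w⟩ ⟨hp, hpi⟩ ⟨u', w'⟩ ⟨hp', hpi'⟩
    rw [Finset.mem_filter, Finset.mem_product, Finset.mem_compl] at hp hp'
    have h := hpi.symm.trans hpi'
    simp only at h
    rw [Sym2.eq_iff] at h
    rcases h with ⟨rfl, rfl⟩ | ⟨rfl, rfl⟩
    · rfl
    · exact absurd hp.1.1 hp'.1.2

theorem IsSpectralExpander.mul_card_le_of_isClosedUnder {d : ℕ} {lam : ℝ}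
    (hG : IsSpectralExpander G d lam) {e : Fin n ≃ G.edgeSet} {S : Finset (Fin n)} {X : Finset V}
    (hX : IsClosedUnder e S X) :
    (1 - lam) * d * (X.card * (Fintype.card V - X.card)) ≤ Fintype.card V * S.card :=
  (hG.mul_card_le_cut X).trans (mul_le_mul_of_nonneg_left hX.cut_le (Nat.cast_nonneg _))

theorem isClosedUnder_componentOf (e : Fin n ≃ G.edgeSet) (S : Finset (Fin n)) (v : V) :
    IsClosedUnder e S (componentOf e S v) := by
  intro u hu w huw
  rw [mem_componentOf] at hu ⊢
  exact hu.trans huw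

theorem IsClosedUnder.union {e : Fin n ≃ G.edgeSet} {S : Finset (Fin n)} {X Y : Finset V}
    (hX : IsClosedUnder e S X) (hY : IsClosedUnder e S Y) : IsClosedUnder e S (X ∪ Y) := by
  intro u hu w huw
  rcases Finset.mem_union.1 hu with h | h
  · exact Finset.mem_union_left _ (hX u h w huw)
  · exact Finset.mem_union_right _ (hY u h w huw)

theorem componentOf_eq_of_reachable {e : Fin n ≃ G.edgeSet} {S : Finset (Fin n)} {u w : V}
    (h : (remainingGraph e S).Reachable u w) : componentOf e S u = componentOf e S w := by
  ext x
  rw [mem_componentOf, mem_componentOf]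
  exact ⟨fun h' => h.symm.trans h', fun h' => h.trans h'⟩

theorem isClosedUnder_compl_bigVertices (e : Fin n ≃ G.edgeSet) (S : Finset (Fin n)) :
    IsClosedUnder e S (bigVertices e S)ᶜ := by
  intro u hu w huw
  rw [Finset.mem_compl, mem_bigVertices] at hu ⊢
  rwa [← componentOf_eq_of_reachable huw]

/-- With |V| − |X| ≥ |V|/2 and |S| ≤ n/1000 = d|V|/2000, the cut bound reads (999/1000) d |X| |V|/2
≤ |V| · d|V|/2000. -/
theorem IsSpectralExpander.card_le_of_isClosedUnder {d : ℕ} {lam : ℝ} (hd : 1 ≤ d)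
    (hlam : lam < 1 / 1000) (hG : IsSpectralExpander G d lam) {e : Fin n ≃ G.edgeSet}
    {S : Finset (Fin n)} (hS : (S.card : ℝ) ≤ n / 1000) {X : Finset V}
    (hX : IsClosedUnder e S X) (hX2 : 2 * X.card ≤ Fintype.card V) :
    999 * X.card ≤ Fintype.card V := by
  rcases Nat.eq_zero_or_pos (Fintype.card V) with h0 | hpos
  · omega
  have h1 := hG.mul_card_le_of_isClosedUnder hX
  have h2 := hG.two_mul_card_edges e
  have h2' : 2 * (n : ℝ) = d * Fintype.card V := by exact_mod_cast h2
  have hX2' : 2 * (X.card : ℝ) ≤ Fintype.card V := by exact_mod_cast hX2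
  have hd' : (0 : ℝ) < d := by exact_mod_cast hd
  have hN : (0 : ℝ) < Fintype.card V := by exact_mod_cast hpos
  have hk : (0 : ℝ) ≤ X.card := Nat.cast_nonneg _
  set N : ℝ := ((Fintype.card V : ℕ) : ℝ)
  set k : ℝ := (X.card : ℝ) with hkdef
  have h3 : 999 / 1000 * d * (k * (N / 2)) ≤ (1 - lam) * d * (k * (N - k)) := by
    exact mul_le_mul (mul_le_mul_of_nonneg_right (by linarith) hd'.le)
      (mul_le_mul_of_nonneg_left (by linarith) hk) (by positivity)
      (mul_nonneg (by linarith) hd'.le)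
  have h4 : N * S.card ≤ N * (d * N / 2000) := by
    refine mul_le_mul_of_nonneg_left ?_ hN.le
    linarith
  have h5 : (d * N) * (999 * k) ≤ (d * N) * N := by nlinarith [h1, h3, h4]
  have h6 : 999 * k ≤ N := le_of_mul_le_mul_left h5 (by positivity)
  have h7 : 999 * (X.card : ℝ) ≤ ((Fintype.card V : ℕ) : ℝ) := h6
  exact_mod_cast h7

/-- A closed set of at most half the vertices has at most |V|/999 of them. If X is a largest such
set and v lies outside it, a small component of v could be added to X, the union still being below
one half. So v lies in a component with a majority, and the rest is a closed set below one half. -/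
theorem IsSpectralExpander.card_compl_bigVertices_le {d : ℕ} {lam : ℝ} (hd : 1 ≤ d)
    (hlam : lam < 1 / 1000) (hG : IsSpectralExpander G d lam) (hV : 0 < Fintype.card V)
    (e : Fin n ≃ G.edgeSet) {S : Finset (Fin n)} (hS : (S.card : ℝ) ≤ n / 1000) :
    999 * (bigVertices e S)ᶜ.card ≤ Fintype.card V := by
  refine hG.card_le_of_isClosedUnder hd hlam hS (isClosedUnder_compl_bigVertices e S) ?_
  obtain ⟨X, hX, hmax⟩ := Finset.exists_max_image
    (Finset.univ.filter fun X : Finset V => IsClosedUnder e S X ∧ 2 * X.card ≤ Fintype.card V)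
    Finset.card ⟨∅, by
      rw [Finset.mem_filter]
      exact ⟨Finset.mem_univ _, fun u hu => absurd hu (Finset.notMem_empty _), by simp⟩⟩
  simp only [Finset.mem_filter, Finset.mem_univ, true_and] at hX hmax
  have hXc := hG.card_le_of_isClosedUnder hd hlam hS hX.1 hX.2
  obtain ⟨v, hv⟩ : ∃ v, v ∉ X := by
    by_contra hcon
    push Not at hcon
    rw [Finset.eq_univ_iff_forall.2 hcon, Finset.card_univ] at hXc
    omega
  have hvbig : v ∈ bigVertices e S := by
    rw [mem_bigVertices]
    by_contra hsmall
    rw [not_lt] at hsmall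
    have h1 := hG.card_le_of_isClosedUnder hd hlam hS (isClosedUnder_componentOf e S v) hsmall
    have h2 := Finset.card_union_le X (componentOf e S v)
    have h3 := hmax (X ∪ componentOf e S v)
      ⟨hX.1.union (isClosedUnder_componentOf e S v), by omega⟩
    have h4 : X ⊂ X ∪ componentOf e S v := by
      refine Finset.ssubset_iff_subset_ne.2 ⟨Finset.subset_union_left, fun h => hv ?_⟩
      rw [h]
      exact Finset.mem_union_right _ (mem_componentOf.2 SimpleGraph.Reachable.rfl)
    have := Finset.card_lt_card h4
    omega
  have hsub : componentOf e S v ⊆ bigVertices e S := by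
    intro w hw
    rw [mem_componentOf] at hw
    rw [mem_bigVertices] at hvbig ⊢
    rwa [← componentOf_eq_of_reachable hw]
  have h1 := Finset.card_le_card hsub
  have h2 := Finset.card_add_card_compl (bigVertices e S)
  rw [mem_bigVertices] at hvbig
  omega

theorem IsSpectralExpander.isValid_none {d : ℕ} {lam : ℝ} (hd : 1 ≤ d)
    (hlam : lam < 1 / 1000) (hG : IsSpectralExpander G d lam) (hV : Odd (Fintype.card V))
    (e : Fin n ≃ G.edgeSet) : IsValid e (fun _ => none) := by
  have hfix : fixedVars (fun _ : Fin n => (none : Option (ZMod 2))) = ∅ := by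
    ext i
    simp [mem_fixedVars]
  have hbig : ∀ v, v ∈ bigVertices e (fixedVars (fun _ : Fin n => (none : Option (ZMod 2)))) := by
    intro v
    rw [hfix, mem_bigVertices]
    by_contra hsmall
    rw [not_lt] at hsmall
    have h1 := hG.mul_card_le_of_isClosedUnder (isClosedUnder_componentOf e ∅ v)
    rw [Finset.card_empty, Nat.cast_zero, mul_zero] at h1
    have h2 : 0 < (componentOf e ∅ v).card :=
      Finset.card_pos.2 ⟨v, mem_componentOf.2 SimpleGraph.Reachable.rfl⟩
    have h2' : (0 : ℝ) < (componentOf e ∅ v).card := by exact_mod_cast h2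
    have h3 : 2 * ((componentOf e ∅ v).card : ℝ) ≤ Fintype.card V := by exact_mod_cast hsmall
    have h4 : (0 : ℝ) < d := by exact_mod_cast hd
    have h5 : 0 < (1 - lam) * d *
        ((componentOf e ∅ v).card * (Fintype.card V - (componentOf e ∅ v).card)) := by
      apply mul_pos (mul_pos (by linarith) h4) (mul_pos h2' (by linarith))
    linarith
  obtain ⟨v⟩ : Nonempty V := Fintype.card_pos_iff.1 hV.pos
  have hconn : ∀ w, (freeGraph e (fun _ => none)).connectedComponentMk w
      = (freeGraph e (fun _ => none)).connectedComponentMk v := by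
    intro w
    apply SimpleGraph.ConnectedComponent.sound
    rw [freeGraph_eq]
    exact reachable_of_mem_bigVertices (hbig w) (hbig v)
  refine ⟨(freeGraph e (fun _ => none)).connectedComponentMk v, ?_, ?_,
    (half_lt_ncard_supp_iff e _ v).2 (hbig v)⟩
  · rw [IsOddComponent, Finset.filter_true_of_mem fun w _ => hconn w]
    have h1 : ∀ u, residualParity e (fun _ => none) u = 1 := by
      intro u
      simp [residualParity]
    rw [Finset.sum_congr rfl fun u _ => h1 u, Finset.sum_const, Finset.card_univ, nsmul_one]
    exact (ZMod.natCast_eq_one_iff_odd).2 hV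
  · intro K' _
    induction K' using SimpleGraph.ConnectedComponent.ind with
    | h w => exact hconn w

end Expansion

section Hardness

variable {V : Type*} [Fintype V] {G : SimpleGraph V} {n b : ℕ}

/-! ### Parity decision trees -/

/-- The number of pairs of a point `x` of `B` and a vertex `v` such that the lifted assignment
is violated at `v` and `v` lies in the large component at the leaf reached by `x`. -/
def goodCount (e : Fin n ≃ G.edgeSet) (g : (Fin b → ZMod 2) → ZMod 2) (T : PDT n b)
    (B : AffSpace n b) : ℕ :=
  ∑ x ∈ pointsOf B, ((bigVertices e (closureBlocks (T.pathSpace x ⊓ B))).filter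
    fun v => ViolatesAt e v (gadgetMap g x)).card

theorem goodCount_query (e : Fin n ≃ G.edgeSet) (g : (Fin b → ZMod 2) → ZMod 2)
    (l : BlockVec (Fin n) b) (T₀ T₁ : PDT n b) (B : AffSpace n b) :
    goodCount e g (.query l T₀ T₁) B
      = goodCount e g T₀ (B ⊓ levelSpace l 0) + goodCount e g T₁ (B ⊓ levelSpace l 1) := by
  have h01 : (1 : ZMod 2) ≠ 0 := by decide
  have h0 : pointsOf (B ⊓ levelSpace l 0) = (pointsOf B).filter fun x => pairing l x = 0 := by
    ext x
    rw [mem_pointsOf, Finset.mem_filter, mem_pointsOf]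
    exact Iff.rfl
  have h1 : pointsOf (B ⊓ levelSpace l 1) = (pointsOf B).filter fun x => ¬ pairing l x = 0 := by
    ext x
    rw [mem_pointsOf, Finset.mem_filter, mem_pointsOf, AffineSubspace.mem_inf_iff, mem_levelSpace]
    refine and_congr_right fun _ => ⟨fun h => by rw [h]; exact h01, fun h => ?_⟩
    exact (ZMod.two_cases _).resolve_left h
  rw [goodCount, goodCount, goodCount, h0, h1,
    ← Finset.sum_filter_add_sum_filter_not (pointsOf B) (fun x => pairing l x = 0)]
  congr 1
  · refine Finset.sum_congr rfl fun x hx => ?_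
    have hx' := (Finset.mem_filter.1 hx).2
    rw [PDT.pathSpace_query_zero hx', inf_comm (levelSpace l 0), inf_assoc, inf_comm B]
  · refine Finset.sum_congr rfl fun x hx => ?_
    have hx' := (ZMod.two_cases _).resolve_left (Finset.mem_filter.1 hx).2
    rw [PDT.pathSpace_query_one hx', inf_comm (levelSpace l 1), inf_assoc, inf_comm B]

theorem goodCount_eq_zero (e : Fin n ≃ G.edgeSet) (g : (Fin b → ZMod 2) → ZMod 2) (T : PDT n b)
    {B : AffSpace n b} (h : ∀ x, x ∉ B) : goodCount e g T B = 0 := by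
  refine Finset.sum_eq_zero fun x hx => absurd (mem_pointsOf.1 hx) (h x)

theorem sum_pointsOf_inf_levelSpace (l : BlockVec (Fin n) b) (B : AffSpace n b)
    (f : BlockVec (Fin n) b → ℝ) :
    ∑ x ∈ pointsOf (B ⊓ levelSpace l 0), f x + ∑ x ∈ pointsOf (B ⊓ levelSpace l 1), f x
      = ∑ x ∈ pointsOf B, f x := by
  rw [← Finset.sum_union]
  · congr 1
    ext x
    rw [Finset.mem_union, mem_pointsOf, mem_pointsOf, mem_pointsOf, AffineSubspace.mem_inf_iff,
      AffineSubspace.mem_inf_iff, mem_levelSpace, mem_levelSpace, ← and_or_left]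
    exact and_iff_left (ZMod.two_cases _)
  · rw [Finset.disjoint_left]
    intro x hx hx'
    rw [mem_pointsOf] at hx hx'
    have h0 : pairing l x = 0 := hx.2
    have h1 : pairing l x = 1 := hx'.2
    rw [h0] at h1
    exact absurd h1 (by decide)

/-- Double counting of pairs: a violating completion z' of z₀ on S is seen by all z that agree with
it on S', and there are 2^|S'ᶜ| of these. -/
theorem sum_agreeOn_violCount (e : Fin n ≃ G.edgeSet) (v : V) {S S' : Finset (Fin n)}
    (h : S ⊆ S') (z₀ : Fin n → ZMod 2) :
    ∑ z ∈ agreeOn S z₀, violCount e v S' z = 2 ^ S'ᶜ.card * violCount e v S z₀ := by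
  have h1 : ∀ z ∈ agreeOn S z₀, violCount e v S' z
      = ∑ z' ∈ (agreeOn S z₀).filter (ViolatesAt e v), if z ∈ agreeOn S' z' then 1 else 0 := by
    intro z hz
    rw [← Finset.card_filter, violCount, Finset.filter_filter]
    congr 1
    ext z'
    simp only [Finset.mem_filter, mem_agreeOn] at hz ⊢
    constructor
    · rintro ⟨h2, h3⟩
      exact ⟨fun i hi => by rw [h2 i (h hi), hz i hi], h3, fun i hi => (h2 i hi).symm⟩
    · rintro ⟨-, h3, h2⟩
      exact ⟨fun i hi => (h2 i hi).symm, h3⟩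
  rw [Finset.sum_congr rfl h1, Finset.sum_comm]
  have h2 : ∀ z' ∈ (agreeOn S z₀).filter (ViolatesAt e v),
      ∑ z ∈ agreeOn S z₀, (if z ∈ agreeOn S' z' then 1 else 0) = 2 ^ S'ᶜ.card := by
    intro z' hz'
    rw [← Finset.card_filter, ← card_agreeOn S' z']
    congr 1
    ext z
    rw [Finset.mem_filter, and_iff_right_iff_imp]
    intro hz
    rw [Finset.mem_filter, mem_agreeOn] at hz'
    rw [mem_agreeOn] at hz ⊢
    exact fun i hi => by rw [hz i (h hi), hz'.1 i hi]
  rw [Finset.sum_congr rfl h2, Finset.sum_const, smul_eq_mul, mul_comm, violCount]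

theorem cast_violCount (e : Fin n ≃ G.edgeSet) (v : V) (S : Finset (Fin n))
    (z₀ : Fin n → ZMod 2) :
    (violCount e v S z₀ : ℝ) = ∑ z ∈ agreeOn S z₀, if ViolatesAt e v z then 1 else 0 := by
  rw [violCount, Finset.card_filter]
  push_cast
  rfl

theorem card_closureBlocks_le (A : AffSpace n b) :
    (closureBlocks A).card ≤ closureRank (formsOf A) :=
  card_vecClosure_le_closureRank (formsOf A)

/-- The resampling bound divided by c = (1 + 3δ)^n; thus κ = (2 − c)/c is the loss of one
resampling. -/
theorem mul_sum_agreeOn_le {g : (Fin b → ZMod 2) → ZMod 2} {δ κ : ℝ}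
    (hδ : 0 ≤ δ) (hδ1 : (1 + 3 * δ) ^ n < 2)
    (hg : ∀ u, |gadgetHat g u| ≤ δ)
    (hκ : κ * (1 + 3 * δ) ^ n = 2 - (1 + 3 * δ) ^ n) {B : AffSpace n b} {S : Finset (Fin n)}
    (hS : IsDeviolator (formsOf B : Set (BlockVec (Fin n) b)) S)
    {h : (Fin n → ZMod 2) → ℝ} (hh : ∀ z, 0 ≤ h z) :
    κ * ∑ x ∈ pointsOf B, ∑ z ∈ agreeOn S (gadgetMap g x), h z
      ≤ 2 ^ Sᶜ.card * ∑ x ∈ pointsOf B, h (gadgetMap g x) := by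
  have hc1 : 1 ≤ (1 + 3 * δ) ^ n := one_le_pow₀ (by linarith)
  have h1 := (hS.sum_agreeOn_bounds hδ hδ1 hg hh).1
  rw [← hκ, mul_comm κ, mul_assoc] at h1
  exact le_of_mul_le_mul_left h1 (by linarith)

theorem mul_sum_agreeOn_ge {g : (Fin b → ZMod 2) → ZMod 2} {δ κ : ℝ}
    (hδ : 0 ≤ δ) (hδ1 : (1 + 3 * δ) ^ n < 2)
    (hg : ∀ u, |gadgetHat g u| ≤ δ)
    (hκ : κ * (1 + 3 * δ) ^ n = 2 - (1 + 3 * δ) ^ n) {B : AffSpace n b} {S : Finset (Fin n)}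
    (hS : IsDeviolator (formsOf B : Set (BlockVec (Fin n) b)) S)
    {h : (Fin n → ZMod 2) → ℝ} (hh : ∀ z, 0 ≤ h z) :
    κ * (2 ^ Sᶜ.card * ∑ x ∈ pointsOf B, h (gadgetMap g x))
      ≤ ∑ x ∈ pointsOf B, ∑ z ∈ agreeOn S (gadgetMap g x), h z := by
  have hc1 : 1 ≤ (1 + 3 * δ) ^ n := one_le_pow₀ (by linarith)
  have h1 := (hS.sum_agreeOn_bounds hδ hδ1 hg hh).2
  rw [← hκ, mul_comm κ, mul_assoc] at h1
  exact le_of_mul_le_mul_left h1 (by linarith)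

/-- Resampling is applied to the indicator of a violation at w, for each w in the giant component.
All these w have the same `violCount` as v, and they make up at least 998/999 of the vertices. -/
theorem mul_sum_violCount_le_goodCount_leaf {d : ℕ} {lam : ℝ} (hd : 1 ≤ d)
    (hlam : lam < 1 / 1000) (hG : IsSpectralExpander G d lam) (hV : 0 < Fintype.card V)
    (e : Fin n ≃ G.edgeSet) {g : (Fin b → ZMod 2) → ZMod 2} {δ κ : ℝ}
    (hδ : 0 ≤ δ) (hδ1 : (1 + 3 * δ) ^ n < 2)
    (hg : ∀ u, |gadgetHat g u| ≤ δ) (hκ0 : 0 ≤ κ)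
    (hκ : κ * (1 + 3 * δ) ^ n = 2 - (1 + 3 * δ) ^ n) (B : AffSpace n b)
    (hB : ((closureBlocks B).card : ℝ) ≤ n / 1000) {v : V}
    (hv : v ∈ bigVertices e (closureBlocks B)) :
    κ * (998 / 999 * Fintype.card V)
        * ∑ x ∈ pointsOf B, (violCount e v (closureBlocks B) (gadgetMap g x) : ℝ)
      ≤ 2 ^ (closureBlocks B)ᶜ.card * (goodCount e g .leaf B : ℝ) := by
  have hdev := isDeviolator_closureBlocks B
  have hleaf : goodCount e g .leaf B = ∑ x ∈ pointsOf B, ((bigVertices e (closureBlocks B)).filter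
      fun v => ViolatesAt e v (gadgetMap g x)).card := by
    simp only [goodCount, PDT.pathSpace_leaf, top_inf_eq]
  rw [hleaf]
  generalize closureBlocks B = S at hB hv hdev
  have hbig := hG.card_compl_bigVertices_le hd hlam hV e hB
  have hbig' : 998 / 999 * (Fintype.card V : ℝ) ≤ (bigVertices e S).card := by
    have h1 := Finset.card_add_card_compl (bigVertices e S)
    have h2 : 998 * Fintype.card V ≤ 999 * (bigVertices e S).card := by omega
    have h3 : 998 * (Fintype.card V : ℝ) ≤ 999 * (bigVertices e S).card := by exact_mod_cast h2
    linarith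
  have hcount : ((∑ x ∈ pointsOf B, ((bigVertices e S).filter
      fun v => ViolatesAt e v (gadgetMap g x)).card : ℕ) : ℝ)
      = ∑ w ∈ bigVertices e S, ∑ x ∈ pointsOf B,
        if ViolatesAt e w (gadgetMap g x) then 1 else 0 := by
    rw [Finset.sum_comm]
    push_cast
    refine Finset.sum_congr rfl fun x _ => ?_
    rw [Finset.card_filter]
    push_cast
    rfl
  rw [hcount]
  set Q := ∑ x ∈ pointsOf B, (violCount e v S (gadgetMap g x) : ℝ) with hQ
  have hQ0 : 0 ≤ Q := Finset.sum_nonneg fun _ _ => Nat.cast_nonneg _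
  have hstep : ∑ _w ∈ bigVertices e S, κ * Q ≤ ∑ w ∈ bigVertices e S,
      2 ^ Sᶜ.card * ∑ x ∈ pointsOf B, if ViolatesAt e w (gadgetMap g x) then (1 : ℝ) else 0 := by
    refine Finset.sum_le_sum fun w hw => ?_
    have h1 := mul_sum_agreeOn_le hδ hδ1 hg hκ hdev
      (h := fun z => if ViolatesAt e w z then 1 else 0) fun z => by split_ifs <;> norm_num
    refine le_trans (le_of_eq ?_) h1
    congr 1
    refine Finset.sum_congr rfl fun x _ => ?_
    rw [violCount_eq_of_mem_bigVertices e hv hw, cast_violCount]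
  rw [Finset.sum_const, nsmul_eq_mul, ← Finset.mul_sum] at hstep
  refine le_trans ?_ hstep
  calc κ * (998 / 999 * Fintype.card V) * Q ≤ κ * (bigVertices e S).card * Q := by gcongr
    _ = _ := by ring

/-- Since v' is also in the giant component for S, v may be replaced by v' there. Then `violCount`
for S is the average of the one for S' over resampled assignments, and undoing the resampling costs
κ. -/
theorem mul_sum_violCount_le_add (e : Fin n ≃ G.edgeSet) {g : (Fin b → ZMod 2) → ZMod 2} {δ κ : ℝ}
    (hδ : 0 ≤ δ) (hδ1 : (1 + 3 * δ) ^ n < 2)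
    (hg : ∀ u, |gadgetHat g u| ≤ δ)
    (hκ : κ * (1 + 3 * δ) ^ n = 2 - (1 + 3 * δ) ^ n) {B : AffSpace n b} {l : BlockVec (Fin n) b}
    {S S' : Finset (Fin n)}
    (hS : IsDeviolator (formsOf B : Set (BlockVec (Fin n) b)) S) (hSS' : S ⊆ S') {v v' : V}
    (hv : v ∈ bigVertices e S) (hv' : v' ∈ bigVertices e S') :
    κ * (2 ^ S'ᶜ.card * ∑ x ∈ pointsOf B, (violCount e v S (gadgetMap g x) : ℝ))
      ≤ 2 ^ Sᶜ.card *
        (∑ x ∈ pointsOf (B ⊓ levelSpace l 0), (violCount e v' S' (gadgetMap g x) : ℝ)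
          + ∑ x ∈ pointsOf (B ⊓ levelSpace l 1), (violCount e v' S' (gadgetMap g x) : ℝ)) := by
  have h1 := mul_sum_agreeOn_le hδ hδ1 hg hκ hS
    (h := fun z => (violCount e v' S' z : ℝ)) fun _ => Nat.cast_nonneg _
  rw [sum_pointsOf_inf_levelSpace l B (fun x => (violCount e v' S' (gadgetMap g x) : ℝ))]
  refine le_trans (le_of_eq ?_) h1
  rw [Finset.mul_sum]
  congr 1
  refine Finset.sum_congr rfl fun x _ => ?_
  rw [violCount_eq_of_mem_bigVertices e hv (bigVertices_anti e hSS' hv')]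
  exact_mod_cast (sum_agreeOn_violCount e v' hSS' (gadgetMap g x)).symm

/-- Induction on the tree, with one factor κ per query and one at the leaf. The budget `closureRank`
plus depth does not increase along a path, so every closure met on the way leaves a giant component.
-/
theorem mul_sum_violCount_le_goodCount {d : ℕ} {lam : ℝ} (hd : 1 ≤ d) (hlam : lam < 1 / 1000)
    (hG : IsSpectralExpander G d lam) (hV : 0 < Fintype.card V) (e : Fin n ≃ G.edgeSet)
    {g : (Fin b → ZMod 2) → ZMod 2} {δ κ : ℝ}
    (hδ : 0 ≤ δ) (hδ1 : (1 + 3 * δ) ^ n < 2)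
    (hg : ∀ u, |gadgetHat g u| ≤ δ) (hκ0 : 0 ≤ κ)
    (hκ : κ * (1 + 3 * δ) ^ n = 2 - (1 + 3 * δ) ^ n) (T : PDT n b) (B : AffSpace n b)
    (hB : (closureRank (formsOf B) : ℝ) + T.depth ≤ n / 1000) {v : V}
    (hv : v ∈ bigVertices e (closureBlocks B)) :
    κ ^ (T.depth + 1) * (998 / 999 * Fintype.card V)
        * ∑ x ∈ pointsOf B, (violCount e v (closureBlocks B) (gadgetMap g x) : ℝ)
      ≤ 2 ^ (closureBlocks B)ᶜ.card * (goodCount e g T B : ℝ) := by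
  have hc1 : 1 ≤ (1 + 3 * δ) ^ n := one_le_pow₀ (by linarith)
  have hκ1 : κ ≤ 1 := by nlinarith
  induction T generalizing B v with
  | leaf =>
    rw [PDT.depth, zero_add, pow_one]
    rw [PDT.depth, Nat.cast_zero, add_zero] at hB
    have h1 : ((closureBlocks B).card : ℝ) ≤ closureRank (formsOf B) := by
      exact_mod_cast card_closureBlocks_le B
    exact mul_sum_violCount_le_goodCount_leaf hd hlam hG hV e hδ hδ1 hg hκ0 hκ B
      (h1.trans hB) hv
  | query l T₀ T₁ ih₀ ih₁ =>
    have hd₀ : T₀.depth + 1 ≤ (PDT.query l T₀ T₁).depth := Nat.succ_le_succ (le_max_left _ _)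
    have hd₁ : T₁.depth + 1 ≤ (PDT.query l T₀ T₁).depth := Nat.succ_le_succ (le_max_right _ _)
    have hd₀' : (T₀.depth : ℝ) + 1 ≤ (PDT.query l T₀ T₁).depth := by exact_mod_cast hd₀
    have hd₁' : (T₁.depth : ℝ) + 1 ≤ (PDT.query l T₀ T₁).depth := by exact_mod_cast hd₁
    set D := (PDT.query l T₀ T₁).depth with hD
    rw [goodCount_query]
    have hP : 0 ≤ 998 / 999 * (Fintype.card V : ℝ) := by positivity
    set P := 998 / 999 * (Fintype.card V : ℝ) with hPdef
    -- If one answer is impossible on B, the other child still lives on B itself and the factor κ ≤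
    -- 1 is given away.
    by_cases hne₀ : ∃ x₀, x₀ ∈ B ⊓ levelSpace l 0
    · by_cases hne₁ : ∃ x₁, x₁ ∈ B ⊓ levelSpace l 1
      · obtain ⟨x₀, hx₀⟩ := hne₀
        obtain ⟨x₁, hx₁⟩ := hne₁
        -- Both children have the same closure, so a single vertex v' serves both induction
        -- hypotheses.
        have hS'₁ := closureBlocks_inf_levelSpace_eq hx₁ hx₀
        have hSS' : closureBlocks B ⊆ closureBlocks (B ⊓ levelSpace l 0) :=
          closureBlocks_mono inf_le_left
        have hcard := card_closureBlocks_le (B ⊓ levelSpace l 0)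
        have hdev := isDeviolator_closureBlocks B
        have hr₀ : (closureRank (formsOf (B ⊓ levelSpace l 0)) : ℝ)
            ≤ closureRank (formsOf B) + 1 := by
          exact_mod_cast closureRank_inf_levelSpace_le hx₀
        have hr₁ : (closureRank (formsOf (B ⊓ levelSpace l 1)) : ℝ)
            ≤ closureRank (formsOf B) + 1 := by
          exact_mod_cast closureRank_inf_levelSpace_le hx₁
        have hS'card : ((closureBlocks (B ⊓ levelSpace l 0)).card : ℝ) ≤ n / 1000 := by
          have h2 : ((closureBlocks (B ⊓ levelSpace l 0)).card : ℝ)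
              ≤ closureRank (formsOf (B ⊓ levelSpace l 0)) := by exact_mod_cast hcard
          have h3 : (0 : ℝ) ≤ T₀.depth := Nat.cast_nonneg _
          linarith
        have hbig := hG.card_compl_bigVertices_le hd hlam hV e hS'card
        obtain ⟨v', hv'⟩ : (bigVertices e (closureBlocks (B ⊓ levelSpace l 0))).Nonempty := by
          rw [← Finset.card_pos]
          have h1 := Finset.card_add_card_compl
            (bigVertices e (closureBlocks (B ⊓ levelSpace l 0)))
          omega
        have i₀ := ih₀ (B ⊓ levelSpace l 0) (by linarith) hv'
        have i₁ := ih₁ (B ⊓ levelSpace l 1) (by linarith) (v := v') (by rw [hS'₁]; exact hv')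
        rw [hS'₁] at i₁
        have h1 := mul_sum_violCount_le_add e hδ hδ1 hg hκ (l := l) hdev hSS' hv hv'
        clear ih₀ ih₁ hcard hr₀ hr₁ hbig hB hdev
        generalize closureBlocks B = S at *
        generalize closureBlocks (B ⊓ levelSpace l 0) = S' at *
        set Q := ∑ x ∈ pointsOf B, (violCount e v S (gadgetMap g x) : ℝ) with hQ
        set Q₀ := ∑ x ∈ pointsOf (B ⊓ levelSpace l 0),
          (violCount e v' S' (gadgetMap g x) : ℝ) with hQ₀
        set Q₁ := ∑ x ∈ pointsOf (B ⊓ levelSpace l 1),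
          (violCount e v' S' (gadgetMap g x) : ℝ) with hQ₁
        have hQ₀n : 0 ≤ Q₀ := Finset.sum_nonneg fun _ _ => Nat.cast_nonneg _
        have hQ₁n : 0 ≤ Q₁ := Finset.sum_nonneg fun _ _ => Nat.cast_nonneg _
        have j₀ : κ ^ D * P * Q₀ ≤ κ ^ (T₀.depth + 1) * P * Q₀ := by
          have := pow_le_pow_of_le_one hκ0 hκ1 hd₀
          gcongr
        have j₁ : κ ^ D * P * Q₁ ≤ κ ^ (T₁.depth + 1) * P * Q₁ := by
          have := pow_le_pow_of_le_one hκ0 hκ1 hd₁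
          gcongr
        have hpos : (0 : ℝ) < 2 ^ S'ᶜ.card := by positivity
        refine le_of_mul_le_mul_left ?_ hpos
        push_cast
        calc 2 ^ S'ᶜ.card * (κ ^ (D + 1) * P * Q)
            = κ ^ D * P * (κ * (2 ^ S'ᶜ.card * Q)) := by ring
          _ ≤ κ ^ D * P * (2 ^ Sᶜ.card * (Q₀ + Q₁)) := by gcongr
          _ = 2 ^ Sᶜ.card * (κ ^ D * P * Q₀ + κ ^ D * P * Q₁) := by ring
          _ ≤ 2 ^ Sᶜ.card * (2 ^ S'ᶜ.card * (goodCount e g T₀ (B ⊓ levelSpace l 0) : ℝ)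
              + 2 ^ S'ᶜ.card * (goodCount e g T₁ (B ⊓ levelSpace l 1) : ℝ)) := by
              exact mul_le_mul_of_nonneg_left (add_le_add (j₀.trans i₀) (j₁.trans i₁))
                (by positivity)
          _ = _ := by ring
      · push Not at hne₁
        have hBeq : B ⊓ levelSpace l 0 = B := by
          refine inf_eq_left.2 fun x hx => (ZMod.two_cases _).resolve_right fun h => ?_
          exact hne₁ x ⟨hx, h⟩
        rw [goodCount_eq_zero e g T₁ hne₁, add_zero, hBeq]
        refine le_trans ?_ (ih₀ B (by linarith) hv)
        have := pow_le_pow_of_le_one hκ0 hκ1 (hd₀.trans (Nat.le_succ _))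
        have hQ0 : 0 ≤ ∑ x ∈ pointsOf B, (violCount e v (closureBlocks B) (gadgetMap g x) : ℝ) :=
          Finset.sum_nonneg fun _ _ => Nat.cast_nonneg _
        gcongr
    · push Not at hne₀
      have hBeq : B ⊓ levelSpace l 1 = B := by
        refine inf_eq_left.2 fun x hx => (ZMod.two_cases _).resolve_left fun h => ?_
        exact hne₀ x ⟨hx, h⟩
      rw [goodCount_eq_zero e g T₀ hne₀, zero_add, hBeq]
      refine le_trans ?_ (ih₁ B (by linarith) hv)
      have := pow_le_pow_of_le_one hκ0 hκ1 (hd₁.trans (Nat.le_succ _))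
      have hQ0 : 0 ≤ ∑ x ∈ pointsOf B, (violCount e v (closureBlocks B) (gadgetMap g x) : ℝ) :=
        Finset.sum_nonneg fun _ _ => Nat.cast_nonneg _
      gcongr

end Hardness

section Distributions

variable {V : Type*} [Fintype V] {G : SimpleGraph V} {n b : ℕ}

/-! ### The sampled and lifted distributions -/

theorem PMF.map_uniformOfFintype_apply {A B : Type*} [Fintype A] [Nonempty A] {f : A → B}
    (hf : Function.Injective f) (y : B) :
    ((PMF.uniformOfFintype A).map f) y
      = if y ∈ Set.range f then (Fintype.card A : ℝ≥0∞)⁻¹ else 0 := by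
  rw [PMF.map_apply, tsum_fintype]
  simp only [PMF.uniformOfFintype_apply]
  split_ifs with h
  · obtain ⟨a, rfl⟩ := h
    rw [Finset.sum_eq_single a]
    · simp
    · intro a' _ ha'
      rw [if_neg fun h => ha' (hf h).symm]
    · simp
  · refine Finset.sum_eq_zero fun a _ => if_neg ?_
    rintro rfl
    exact h ⟨a, rfl⟩

theorem card_nonTree (e : Fin n ≃ G.edgeSet) {ρ : PartialAssignment n} {v : V}
    (t : TreeChoice e ρ v) (hρ : IsValid e ρ) (hv : v ∈ oddVertices e ρ) {z₀ : Fin n → ZMod 2}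
    (hz₀ : Extends z₀ ρ) :
    Fintype.card (t.NonTree → ZMod 2) = violCount e v (fixedVars ρ) z₀ := by
  rw [← Finset.card_univ, ← Finset.card_image_of_injective _ t.extend_injective, violCount]
  congr 1
  ext z
  rw [Finset.mem_filter, ← hz₀.iff_mem_agreeOn]
  have h := t.range_extend hρ hv
  rw [Set.ext_iff] at h
  rw [← Finset.mem_coe, Finset.coe_image, Finset.coe_univ, Set.image_univ]
  exact h z

/-- Every root v gives the uniform law on equally many assignments, so the mass of z is proportional
to the number of roots v at which z is violated. -/
theorem exists_dtFooling_apply_eq (e : Fin n ≃ G.edgeSet) {ρ : PartialAssignment n}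
    (hρ : IsValid e ρ) (t : ∀ v, TreeChoice e ρ v) :
    ∃ c : ℝ, 0 < c ∧ ∀ z, dtFooling e ρ hρ t z = ENNReal.ofReal (c * if Extends z ρ then
      ((bigVertices e (fixedVars ρ)).filter fun v => ViolatesAt e v z).card else 0) := by
  obtain ⟨v₀, hv₀⟩ := oddVertices_nonempty hρ
  obtain ⟨z₀, hz₀, hz₀v⟩ := hρ.exists_violatesAt hv₀
  set N := violCount e v₀ (fixedVars ρ) z₀ with hN
  have hNpos : 0 < N := Finset.card_pos.2 ⟨z₀, Finset.mem_filter.2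
    ⟨hz₀.iff_mem_agreeOn.1 hz₀, hz₀v⟩⟩
  have hCpos : 0 < (oddVertices e ρ).card := Finset.card_pos.2 ⟨v₀, hv₀⟩
  have hcard : ∀ v ∈ oddVertices e ρ, Fintype.card ((t v).NonTree → ZMod 2) = N := by
    intro v hv
    rw [card_nonTree e (t v) hρ hv hz₀]
    rw [hρ.oddVertices_eq] at hv hv₀
    exact violCount_eq_of_mem_bigVertices e hv hv₀ z₀
  refine ⟨((oddVertices e ρ).card : ℝ)⁻¹ * (N : ℝ)⁻¹, by positivity, fun z => ?_⟩
  have h1 : dtFooling e ρ hρ t z = ∑ v ∈ oddVertices e ρ, ((oddVertices e ρ).card : ℝ≥0∞)⁻¹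
      * if Extends z ρ ∧ ViolatesAt e v z then (N : ℝ≥0∞)⁻¹ else 0 := by
    rw [dtFooling, PMF.bind_apply, tsum_fintype]
    rw [← Finset.sum_subset (Finset.subset_univ (oddVertices e ρ))]
    · refine Finset.sum_congr rfl fun v hv => ?_
      have hmem : z ∈ Set.range (t v).extend ↔ Extends z ρ ∧ ViolatesAt e v z := by
        rw [(t v).range_extend hρ hv]
        exact Iff.rfl
      rw [PMF.uniformOfFinset_apply, if_pos hv,
        PMF.map_uniformOfFintype_apply (t v).extend_injective, hcard v hv]
      simp only [hmem]
    · intro v _ hv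
      rw [PMF.uniformOfFinset_apply, if_neg hv, zero_mul]
  rw [h1, ← Finset.mul_sum, ← hρ.oddVertices_eq]
  have h2 : ∑ v ∈ oddVertices e ρ, (if Extends z ρ ∧ ViolatesAt e v z then (N : ℝ≥0∞)⁻¹ else 0)
      = (N : ℝ≥0∞)⁻¹ * (if Extends z ρ then
        ((oddVertices e ρ).filter fun v => ViolatesAt e v z).card else 0 : ℕ) := by
    by_cases hz : Extends z ρ
    · simp only [hz, true_and, if_true]
      rw [← Finset.sum_filter, Finset.sum_const, nsmul_eq_mul, mul_comm]
    · simp [hz]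
  rw [h2, mul_assoc, ENNReal.ofReal_mul (by positivity), ENNReal.ofReal_mul (by positivity),
    ENNReal.ofReal_inv_of_pos (by exact_mod_cast hCpos),
    ENNReal.ofReal_inv_of_pos (by exact_mod_cast hNpos), ENNReal.ofReal_natCast,
    ENNReal.ofReal_natCast]
  congr 2
  split_ifs
  · rw [ENNReal.ofReal_natCast]
  · simp

theorem liftDist_apply {g : (Fin b → ZMod 2) → ZMod 2}
    (hg : ∀ z : Fin n → ZMod 2, (gadgetFiber g z).Nonempty) (μ : PMF (Fin n → ZMod 2))
    (x : BlockVec (Fin n) b) :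
    liftDist g μ x = μ (gadgetMap g x) * ((gadgetFiber g (gadgetMap g x)).card : ℝ≥0∞)⁻¹ := by
  rw [liftDist, PMF.bind_apply, tsum_fintype, Finset.sum_eq_single (gadgetMap g x)]
  · rw [dif_pos (hg _), PMF.uniformOfFinset_apply, if_pos]
    exact Finset.mem_filter.2 ⟨Finset.mem_univ _, fun _ => rfl⟩
  · intro z _ hz
    rw [dif_pos (hg _), PMF.uniformOfFinset_apply, if_neg, mul_zero]
    intro h
    apply hz
    simp only [gadgetFiber, Finset.mem_filter, Finset.mem_univ, true_and] at h
    exact (funext h).symm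
  · intro h
    exact absurd (Finset.mem_univ _) h

theorem le_condProb {Ω : Type*} [Fintype Ω] {D : PMF Ω} {w : Ω → ℝ} (hw : ∀ x, 0 ≤ w x)
    (hD : ∀ x, D x = ENNReal.ofReal (w x)) {s t : Set Ω}
    (hpos : 0 < ∑ x with x ∈ t, w x)
    (h : ∑ x with x ∈ t, w x ≤ 3 * ∑ x with x ∈ s ∩ t, w x) : 1 / 3 ≤ condProb D s t := by
  have h1 : ∀ (u : Set Ω) [DecidablePred (· ∈ u)],
      D.toOuterMeasure u = ENNReal.ofReal (∑ x with x ∈ u, w x) := by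
    intro u _
    rw [PMF.toOuterMeasure_apply_fintype, ENNReal.ofReal_sum_of_nonneg fun x _ => hw x,
      Finset.sum_filter]
    refine Finset.sum_congr rfl fun x _ => ?_
    rw [Set.indicator_apply, hD]
  rw [condProb, h1, h1, ← ENNReal.ofReal_div_of_pos hpos]
  have h2 : (1 / 3 : ℝ≥0∞) = ENNReal.ofReal (1 / 3) := by
    rw [ENNReal.ofReal_div_of_pos (by norm_num), ENNReal.ofReal_one, ENNReal.ofReal_ofNat]
  rw [h2]
  apply ENNReal.ofReal_le_ofReal
  rw [div_le_div_iff₀ (by norm_num) hpos]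
  linarith

theorem fixedVars_gadgetPartial (g : (Fin b → ZMod 2) → ZMod 2) {S : Finset (Fin n)}
    (y : BlockVec S b) : fixedVars (gadgetPartial g y) = S := by
  ext i
  rw [mem_fixedVars, gadgetPartial]
  split_ifs with h <;> simp [h]

theorem extends_gadgetPartial_iff {g : (Fin b → ZMod 2) → ZMod 2} {S : Finset (Fin n)}
    {y : BlockVec S b} {z : Fin n → ZMod 2} :
    Extends z (gadgetPartial g y) ↔ ∀ i : S, z i = g (y i) := by
  constructor
  · intro h i
    refine h i _ ?_
    rw [gadgetPartial, dif_pos i.2]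
  · intro h i a hia
    rw [gadgetPartial] at hia
    split_ifs at hia with hi
    · rw [h ⟨i, hi⟩]
      exact Option.some_injective _ hia

/-! ### Numerical bounds -/

/-- The block size gives δ ≤ n^(-250), far less than required. -/
theorem gadget_bias_le {α δ : ℝ} (hα : 0 < α) (hn : 2 ≤ n)
    (hb : 250 / α * Real.logb 2 n ≤ b) (hδ : δ = (2 : ℝ) ^ (-(α * b))) :
    96 * (n : ℝ) ^ 2 * δ ≤ 1 := by
  have hn' : (2 : ℝ) ≤ n := by exact_mod_cast hn
  have h1 : 250 * Real.logb 2 n ≤ α * b := by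
    have := mul_le_mul_of_nonneg_left hb hα.le
    calc 250 * Real.logb 2 n = α * (250 / α * Real.logb 2 n) := by field_simp
      _ ≤ _ := this
  have h2 : (n : ℝ) ^ 250 ≤ (2 : ℝ) ^ (α * b) := by
    calc (n : ℝ) ^ 250 = ((2 : ℝ) ^ Real.logb 2 n) ^ 250 := by
          rw [Real.rpow_logb (by norm_num) (by norm_num) (by linarith)]
      _ = (2 : ℝ) ^ (250 * Real.logb 2 n) := by
          rw [← Real.rpow_mul_natCast (by norm_num), mul_comm]
          norm_num
      _ ≤ _ := Real.rpow_le_rpow_of_exponent_le (by norm_num) h1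
  have h3 : 96 * (n : ℝ) ^ 2 ≤ n ^ 250 := by
    calc 96 * (n : ℝ) ^ 2 ≤ n ^ 248 * n ^ 2 := by
          refine mul_le_mul_of_nonneg_right ?_ (by positivity)
          calc (96 : ℝ) ≤ 2 ^ 248 := by norm_num
            _ ≤ _ := pow_le_pow_left₀ (by norm_num) hn' _
      _ = _ := by rw [← pow_add]
  rw [hδ, Real.rpow_neg (by norm_num), ← div_eq_mul_inv, div_le_one (by positivity)]
  exact h3.trans h2

/-- From c ≤ exp(3nδ) ≤ 1 + 6nδ one gets κ ≥ 1 − 12nδ. Bernoulli's inequality over 4n factors gives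
1 − 48n²δ ≥ 1/2, whence the constant 96. -/
theorem exists_resampling_ratio {δ : ℝ} (hδ : 0 ≤ δ) (hn : 1 ≤ n)
    (h : 96 * (n : ℝ) ^ 2 * δ ≤ 1) :
    (1 + 3 * δ) ^ n < 2 ∧ ∃ κ : ℝ, 0 < κ ∧ κ * (1 + 3 * δ) ^ n = 2 - (1 + 3 * δ) ^ n ∧
      ∀ m ≤ 4 * n, 1 / 2 ≤ κ ^ m := by
  have hn' : (1 : ℝ) ≤ n := by exact_mod_cast hn
  have hnδ : 96 * (n * δ) ≤ 1 := by nlinarith [mul_nonneg (sub_nonneg.2 hn') hδ]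
  have hc1 : 1 ≤ (1 + 3 * δ) ^ n := one_le_pow₀ (by linarith)
  have hc : (1 + 3 * δ) ^ n ≤ 1 + 6 * (n * δ) := by
    calc (1 + 3 * δ) ^ n ≤ Real.exp (3 * δ) ^ n := by
          refine pow_le_pow_left₀ (by linarith) ?_ _
          linarith [Real.add_one_le_exp (3 * δ)]
      _ = Real.exp (n * (3 * δ)) := by rw [← Real.exp_nat_mul]
      _ ≤ _ := by
          have h1 := Real.abs_exp_sub_one_le (x := n * (3 * δ)) (by
            rw [abs_of_nonneg (by positivity)]; nlinarith)
          rw [abs_of_nonneg (a := (n : ℝ) * (3 * δ)) (by positivity)] at h1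
          linarith [(abs_le.1 h1).2]
  set c := (1 + 3 * δ) ^ n with hcdef
  have hc0 : 0 < c := by linarith
  refine ⟨by linarith, (2 - c) / c, div_pos (by linarith) hc0, by field_simp, fun m hm => ?_⟩
  have hκ : 1 + (-(12 * (n * δ))) ≤ (2 - c) / c := by
    rw [le_div_iff₀ hc0]
    have : 0 ≤ n * δ := by positivity
    nlinarith
  have h2 := one_add_mul_le_pow (a := -(12 * (n * δ))) (by linarith) m
  have hm' : (m : ℝ) ≤ 4 * n := by exact_mod_cast hm
  have h3 : (m : ℝ) * (12 * (n * δ)) ≤ 4 * n * (12 * (n * δ)) :=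
    mul_le_mul_of_nonneg_right hm' (by positivity)
  calc (1 / 2 : ℝ) ≤ 1 + m * (-(12 * (n * δ))) := by nlinarith
    _ ≤ (1 + (-(12 * (n * δ)))) ^ m := h2
    _ ≤ _ := pow_le_pow_left₀ (by linarith) hκ _

end Distributions

/-! ### Assembling the conditional probability bound and the theorem -/

section MainTheorem

variable {V : Type*} [Fintype V] {G : SimpleGraph V} {n b : ℕ}

theorem le_condProb_dtFooling {d : ℕ} {lam : ℝ} (hd : 1 ≤ d) (hlam : lam < 1 / 1000)
    (hG : IsSpectralExpander G d lam) (hV : 0 < Fintype.card V) (hn : 1 ≤ n)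
    (e : Fin n ≃ G.edgeSet) {g : (Fin b → ZMod 2) → ZMod 2} {δ : ℝ} (hδ : 0 ≤ δ)
    (hδn : 96 * (n : ℝ) ^ 2 * δ ≤ 1) (hg : ∀ u, |gadgetHat g u| ≤ δ)
    {A : AffSpace n b} {y : BlockVec (closureBlocks A) b}
    (hA : ((amortizedClosure A).card : ℝ) ≤ n / 2000) (hAy : ∃ x ∈ A, x ∈ consistentSpace y)
    (hα : IsValid e (gadgetPartial g y)) (t : ∀ v, TreeChoice e (gadgetPartial g y) v)
    {T : PDT n b} (hT : (T.depth : ℝ) ≤ n / 2000) :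
    1 / 3 ≤ condProb (liftDist g (dtFooling e _ hα t))
      {x | IsValid e (gadgetPartial g
        (restrictBlocks x (closureBlocks (T.pathSpace x ⊓ A ⊓ consistentSpace y))))}
      (A ⊓ consistentSpace y : AffSpace n b) := by
  obtain ⟨hδ1, κ, hκ0, hκ, hκpow⟩ := exists_resampling_ratio hδ hn hδn
  obtain ⟨M, hM, hfib⟩ := exists_abs_card_gadgetFiber_sub_le (n := n) hδ hg
  obtain ⟨c, hc, hdt⟩ := exists_dtFooling_apply_eq e hα t
  set c₀ := (1 + 3 * δ) ^ n with hc₀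
  have hc₁ : 1 ≤ c₀ := one_le_pow₀ (by linarith)
  have hlow : ∀ z : Fin n → ZMod 2, (2 - c₀) * M ≤ (gadgetFiber g z).card := fun z => by
    have := (abs_le.1 (hfib z)).1
    linarith
  have hupp : ∀ z : Fin n → ZMod 2, ((gadgetFiber g z).card : ℝ) ≤ c₀ * M := fun z => by
    have := (abs_le.1 (hfib z)).2
    linarith
  have hlowpos : 0 < (2 - c₀) * M := mul_pos (by linarith) hM
  have hfpos : ∀ z : Fin n → ZMod 2, (0 : ℝ) < (gadgetFiber g z).card := fun z =>
    hlowpos.trans_le (hlow z)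
  have hne : ∀ z : Fin n → ZMod 2, (gadgetFiber g z).Nonempty := fun z =>
    Finset.card_pos.1 (by exact_mod_cast hfpos z)
  have hcl := closureBlocks_inf_consistentSpace hAy
  have hrank := closureRank_inf_consistentSpace_le hAy
  have hext : ∀ x ∈ A ⊓ consistentSpace y, Extends (gadgetMap g x) (gadgetPartial g y) := by
    intro x hx
    rw [extends_gadgetPartial_iff]
    intro i
    exact congrArg g (hx.2 i)
  have hfix : fixedVars (gadgetPartial g y) = closureBlocks (A ⊓ consistentSpace y) :=
    (fixedVars_gadgetPartial g y).trans hcl.symm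
  have hinf : {x | IsValid e (gadgetPartial g
        (restrictBlocks x (closureBlocks (T.pathSpace x ⊓ A ⊓ consistentSpace y))))}
      = {x | IsValid e (gadgetPartial g
        (restrictBlocks x (closureBlocks (T.pathSpace x ⊓ (A ⊓ consistentSpace y)))))} := by
    ext x
    rw [Set.mem_ofPred_eq, Set.mem_ofPred_eq, inf_assoc]
  rw [hinf]
  obtain ⟨x₀, hx₀A, hx₀y⟩ := hAy
  have hx₀ : x₀ ∈ A ⊓ consistentSpace y := ⟨hx₀A, hx₀y⟩
  rw [hfix] at hdt
  have hodd := hα.oddVertices_eq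
  rw [hfix] at hodd
  obtain ⟨v, hv⟩ := oddVertices_nonempty hα
  obtain ⟨z₁, hz₁, hz₁v⟩ := hα.exists_violatesAt hv
  rw [hodd] at hv
  have hz₁' : z₁ ∈ agreeOn (closureBlocks (A ⊓ consistentSpace y)) (gadgetMap g x₀) := by
    have h1 := (hext x₀ hx₀).iff_mem_agreeOn.1 hz₁
    rwa [hfix] at h1
  set B := A ⊓ consistentSpace y with hB
  set S := closureBlocks B with hS
  let cnt : BlockVec (Fin n) b → ℝ := fun x =>
    ((bigVertices e S).filter fun v => ViolatesAt e v (gadgetMap g x)).card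
  -- The lifted probability of x as a real number; on B the extension condition holds automatically.
  let w : BlockVec (Fin n) b → ℝ := fun x =>
    c * (if Extends (gadgetMap g x) (gadgetPartial g y) then cnt x else 0)
      * ((gadgetFiber g (gadgetMap g x)).card : ℝ)⁻¹
  have hcnt : ∀ x, 0 ≤ cnt x := fun x => Nat.cast_nonneg _
  have hw : ∀ x, 0 ≤ w x := fun x => by
    refine mul_nonneg (mul_nonneg hc.le ?_) (inv_nonneg.2 (hfpos _).le)
    split_ifs
    exacts [hcnt x, le_rfl]
  have hD : ∀ x, liftDist g (dtFooling e _ hα t) x = ENNReal.ofReal (w x) := by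
    intro x
    have hwx : w x = c * (if Extends (gadgetMap g x) (gadgetPartial g y) then
        ((bigVertices e S).filter fun v => ViolatesAt e v (gadgetMap g x)).card else 0 : ℕ)
        * ((gadgetFiber g (gadgetMap g x)).card : ℝ)⁻¹ := by
      simp only [w, cnt]
      split_ifs
      exacts [rfl, by rw [Nat.cast_zero]]
    rw [liftDist_apply hne, hdt, hwx, ENNReal.ofReal_mul (p := c * _)
      (mul_nonneg hc.le (Nat.cast_nonneg _)), ENNReal.ofReal_inv_of_pos (hfpos _),
      ENNReal.ofReal_natCast]
  have hwB : ∀ x ∈ B, w x = c * cnt x * ((gadgetFiber g (gadgetMap g x)).card : ℝ)⁻¹ := by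
    intro x hx
    simp only [w, if_pos (hext x hx)]
  set good : Set (BlockVec (Fin n) b) := {x | IsValid e (gadgetPartial g
        (restrictBlocks x (closureBlocks (T.pathSpace x ⊓ B))))} with hgood
  have hden : ∑ x with x ∈ (B : Set (BlockVec (Fin n) b)), w x
      ≤ c / ((2 - c₀) * M) * ∑ x ∈ pointsOf B, cnt x := by
    rw [Finset.mul_sum]
    refine Finset.sum_le_sum fun x hx => ?_
    rw [hwB x (mem_pointsOf.1 hx), div_mul_eq_mul_div, div_eq_mul_inv]
    exact mul_le_mul_of_nonneg_left (inv_anti₀ hlowpos (hlow _)) (mul_nonneg hc.le (hcnt x))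
  have hnum : c / (c₀ * M) * (goodCount e g T B : ℝ)
      ≤ ∑ x with x ∈ good ∩ (B : Set (BlockVec (Fin n) b)), w x := by
    have h1 : (Finset.univ.filter fun x => x ∈ good ∩ (B : Set (BlockVec (Fin n) b)))
        = (pointsOf B).filter fun x => x ∈ good := by
      ext x
      rw [Finset.mem_filter, Finset.mem_filter, mem_pointsOf, Set.mem_inter_iff]
      exact ⟨fun h => ⟨h.2.2, h.2.1⟩, fun h => ⟨Finset.mem_univ _, h.2, h.1⟩⟩
    rw [h1, Finset.sum_filter, goodCount, Nat.cast_sum, Finset.mul_sum]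
    refine Finset.sum_le_sum fun x hx => ?_
    have hxB := mem_pointsOf.1 hx
    set S' := closureBlocks (T.pathSpace x ⊓ B) with hS'
    have hSS' : S ⊆ S' := closureBlocks_mono inf_le_right
    by_cases hxg : x ∈ good
    · rw [if_pos hxg, hwB x hxB]
      have h2 : (((bigVertices e S').filter
          fun v => ViolatesAt e v (gadgetMap g x)).card : ℝ) ≤ cnt x := by
        exact Nat.cast_le.2 <| Finset.card_le_card
          (Finset.filter_subset_filter _ (bigVertices_anti e hSS'))
      calc _ ≤ c / (c₀ * M) * cnt x := by gcongr
        _ = c * cnt x * (c₀ * M)⁻¹ := by rw [div_mul_eq_mul_div, div_eq_mul_inv]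
        _ ≤ _ := mul_le_mul_of_nonneg_left (inv_anti₀ (hfpos _) (hupp _))
            (mul_nonneg hc.le (hcnt x))
    · rw [if_neg hxg, Finset.filter_eq_empty_iff.2, Finset.card_empty, Nat.cast_zero, mul_zero]
      -- A violated vertex in the giant component at the leaf would certify validity, so bad inputs
      -- contribute nothing to `goodCount`.
      intro u hu huv
      refine hxg (isValid_of_violatesAt e (z := gadgetMap g x) (v := u) ?_ huv ?_)
      · rw [extends_gadgetPartial_iff]
        intro i
        rfl
      · rw [fixedVars_gadgetPartial]
        exact hu
  have hrank' : (closureRank (formsOf B) : ℝ) + T.depth ≤ n / 1000 := by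
    have : (closureRank (formsOf B) : ℝ) ≤ (amortizedClosure A).card := by exact_mod_cast hrank
    linarith
  have hmain := mul_sum_violCount_le_goodCount hd hlam hG hV e hδ hδ1 hg hκ0.le hκ T B hrank' hv
  set Q := ∑ x ∈ pointsOf B, (violCount e v S (gadgetMap g x) : ℝ) with hQ
  have hQpos : 0 < Q := by
    refine Finset.sum_pos' (fun _ _ => Nat.cast_nonneg _) ⟨x₀, mem_pointsOf.2 hx₀, ?_⟩
    exact_mod_cast Finset.card_pos.2 ⟨z₁, Finset.mem_filter.2 ⟨hz₁', hz₁v⟩⟩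
  have hupper : κ * (2 ^ Sᶜ.card * ∑ x ∈ pointsOf B, cnt x) ≤ Fintype.card V * Q := by
    have h1 : ∑ x ∈ pointsOf B, cnt x = ∑ u ∈ bigVertices e S, ∑ x ∈ pointsOf B,
        if ViolatesAt e u (gadgetMap g x) then (1 : ℝ) else 0 := by
      rw [Finset.sum_comm]
      refine Finset.sum_congr rfl fun x _ => ?_
      simp only [cnt]
      rw [Finset.card_filter]
      push_cast
      rfl
    have h2 : ∀ u ∈ bigVertices e S, κ * (2 ^ Sᶜ.card * ∑ x ∈ pointsOf B,
        if ViolatesAt e u (gadgetMap g x) then (1 : ℝ) else 0) ≤ Q := by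
      intro u hu
      have h3 := mul_sum_agreeOn_ge hδ hδ1 hg hκ (isDeviolator_closureBlocks B)
        (h := fun z => if ViolatesAt e u z then 1 else 0) fun z => by split_ifs <;> norm_num
      refine h3.trans (le_of_eq ?_)
      refine Finset.sum_congr rfl fun x _ => ?_
      rw [violCount_eq_of_mem_bigVertices e hv hu, cast_violCount]
    rw [h1, Finset.mul_sum, Finset.mul_sum]
    refine (Finset.sum_le_sum h2).trans ?_
    rw [Finset.sum_const, nsmul_eq_mul]
    exact mul_le_mul_of_nonneg_right (by exact_mod_cast Finset.card_le_univ _) hQpos.le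
  have hNpos : (0 : ℝ) < Fintype.card V := by exact_mod_cast hV
  -- The factors κ are depth + 1 from the tree, one from `hupper`, and one from the ratio of the
  -- bounds on the fibre sizes.
  have hdepth : T.depth + 3 ≤ 4 * n := by
    have h1 : (T.depth : ℝ) ≤ n := hT.trans (by
      have : (0 : ℝ) ≤ n := Nat.cast_nonneg _
      linarith)
    have h2 : T.depth ≤ n := by exact_mod_cast h1
    omega
  have hpow := hκpow _ hdepth
  set N : ℝ := ((Fintype.card V : ℕ) : ℝ)
  set C := ∑ x ∈ pointsOf B, cnt x with hC
  set E := (goodCount e g T B : ℝ) with hE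
  have hC0 : 0 ≤ C := Finset.sum_nonneg fun x _ => hcnt x
  have h2S : (0 : ℝ) < 2 ^ Sᶜ.card := by positivity
  have hEC : κ ^ (T.depth + 2) * (998 / 999) * C ≤ E := by
    refine le_of_mul_le_mul_left ?_ h2S
    calc 2 ^ Sᶜ.card * (κ ^ (T.depth + 2) * (998 / 999) * C)
        = κ ^ (T.depth + 1) * (998 / 999) * (κ * (2 ^ Sᶜ.card * C)) := by ring
      _ ≤ κ ^ (T.depth + 1) * (998 / 999) * (N * Q) := by gcongr
      _ = κ ^ (T.depth + 1) * (998 / 999 * N) * Q := by ring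
      _ ≤ _ := hmain
  have hEpos : 0 < E := by
    refine pos_of_mul_pos_right (lt_of_lt_of_le ?_ hmain) h2S.le
    positivity
  have hnumpos : 0 < ∑ x with x ∈ good ∩ (B : Set (BlockVec (Fin n) b)), w x :=
    lt_of_lt_of_le (by positivity) hnum
  refine le_condProb hw hD ?_ ?_
  · refine hnumpos.trans_le (Finset.sum_le_sum_of_subset_of_nonneg ?_ fun x _ _ => hw x)
    intro x hx
    rw [Finset.mem_filter] at hx ⊢
    exact ⟨hx.1, hx.2.2⟩
  · refine hden.trans ?_
    refine le_trans ?_ (mul_le_mul_of_nonneg_left hnum (by norm_num : (0 : ℝ) ≤ 3))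
    have h1 : c / ((2 - c₀) * M) * (κ * C) = c / (c₀ * M) * C := by
      rw [← hκ]
      have : c₀ ≠ 0 := by linarith
      field_simp
    -- The coefficient is at least 3 · (1/2) · (998/999) > 1.
    have h2 : C ≤ 3 * (κ ^ (T.depth + 2) * κ * (998 / 999) * C) := by
      rw [← pow_succ]
      nlinarith
    calc c / ((2 - c₀) * M) * C
        ≤ c / ((2 - c₀) * M) * (3 * (κ ^ (T.depth + 2) * κ * (998 / 999) * C)) := by gcongr
      _ = 3 * (κ ^ (T.depth + 2) * (998 / 999) * (c / ((2 - c₀) * M) * (κ * C))) := by ring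
      _ = 3 * (c / (c₀ * M) * (κ ^ (T.depth + 2) * (998 / 999) * C)) := by rw [h1]; ring
      _ ≤ _ := by gcongr

end MainTheorem

end

theorem mainTheorem5 {V : Type*} [Fintype V] (G : SimpleGraph V) (d : ℕ) (lam : ℝ)
    (hd : 1 ≤ d) (hV : Odd (Fintype.card V)) (hlam : lam < 1 / 1000)
    (hG : IsSpectralExpander G d lam)
    {n : ℕ} (e : Fin n ≃ G.edgeSet)
    {b : ℕ} (α : ℝ) (hα : 0 < α) (g : (Fin b → ZMod 2) → ZMod 2)
    (hg : ∀ S : Finset (Fin b), |gadgetFourierCoeff g S| ≤ (2 : ℝ) ^ (-(α * b)))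
    (hb : 250 / α * Real.logb 2 n ≤ b) :
    (∀ t : ∀ (ρ : PartialAssignment n) (v : V), TreeChoice e ρ v,
      IsPDTHardWith g (tseitin e) {ρ | IsValid e ρ}
        (fun ρ hρ => dtFooling e ρ hρ (t ρ)) ((n : ℝ) / 2000) ((n : ℝ) / 2000)) ∧
    IsPDTHard g (tseitin e) ((n : ℝ) / 2000) ((n : ℝ) / 2000) := by
  have h2n := hG.two_mul_card_edges e
  have hVpos := hV.pos
  -- A loopless graph on one vertex has degree 0 < d.
  have hV2 : 2 ≤ Fintype.card V := by
    by_contra hlt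
    have h1 : Fintype.card V = 1 := by omega
    obtain ⟨v⟩ : Nonempty V := Fintype.card_pos_iff.1 hVpos
    have h2 := hG.sum_adjMatrix v
    rw [Finset.sum_eq_zero] at h2
    · have : d = 0 := by exact_mod_cast h2.symm
      omega
    · intro w _
      have : w = v := Fintype.card_le_one_iff.1 h1.le w v
      rw [this, SimpleGraph.adjMatrix_apply, if_neg (G.loopless.irrefl v)]
  -- As |V| is odd and at least 2, it is at least 3, and 2n = d|V| ≥ 3.
  have hn : 2 ≤ n := by
    obtain ⟨k, hk⟩ := hV
    have : Fintype.card V ≤ d * Fintype.card V := Nat.le_mul_of_pos_left _ hd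
    omega
  have hδn := gadget_bias_le hα hn hb rfl
  have hδ : (0 : ℝ) ≤ (2 : ℝ) ^ (-(α * b)) := by positivity
  have hg' : ∀ u, |gadgetHat g u| ≤ (2 : ℝ) ^ (-(α * b)) := fun u => by
    rw [gadgetHat_eq]
    exact hg _
  have main : ∀ t : ∀ (ρ : PartialAssignment n) (v : V), TreeChoice e ρ v,
      IsPDTHardWith g (tseitin e) {ρ | IsValid e ρ}
        (fun ρ hρ => dtFooling e ρ hρ (t ρ)) ((n : ℝ) / 2000) ((n : ℝ) / 2000) := by
    intro t
    refine ⟨⟨_, hG.isValid_none hd hlam hV e⟩, fun ρ hρ C hC => hρ.not_falsifies hV2 hC,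
      fun ρ hρ ρ' h => hρ.of_unfix h, ?_, ?_⟩
    · intro A y _ _ hα z hz
      obtain ⟨c, -, hc⟩ := exists_dtFooling_apply_eq e hα (t _)
      rw [PMF.mem_support_iff, hc] at hz
      rw [← extends_gadgetPartial_iff]
      by_contra hcon
      rw [if_neg hcon, Nat.cast_zero, mul_zero, ENNReal.ofReal_zero] at hz
      exact hz rfl
    · intro A y hA hAy hα T hT
      exact le_condProb_dtFooling hd hlam hG hVpos (by omega) e hδ hδn hg' hA hAy hα (t _) hT
  exact ⟨main, _, _, main fun ρ v => Classical.choice (nonempty_treeChoice e ρ v)⟩
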